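/- **Game.** There are $N\ge 1$ coalitions; coalition $i$ has $n_i\ge 1$ members $ij$ ($j=1,\dots,n_i$), $n_{\mathrm{sum}}=\sum_i n_i\ge 2$. Agent $ij$ has a state $x_{ij}\in\mathbb R$, a local resource $R_{ij}\in\mathbb R$ and an objective $f_{ij}:\mathbb R^{n_{\mathrm{sum}}}\to\mathbb R$ depending on the collective state $\boldsymbol x$ of all agents. Put $f_i=\sum_{j}f_{ij}$, $R_i=\sum_j R_{ij}$, $\Omega_i=\{\boldsymbol x_i\in\mathbb R^{n_i}:\sum_j x_{ij}=R_i\}$. A Nash equilibrium (NE) is $\boldsymbol x^*\in\prod_i\Omega_i$ such that $f_i(\boldsymbol x_i^*,\boldsymbol x_{-i}^*)\le f_i(\boldsymbol x_i,\boldsymbol x_{-i}^*)$ for all $i$ and all $\boldsymbol x_i\in\Omega_i$. **Assumptions.** (1) Every $f_{ij}$ is convex and $C^1$, and $\nabla f_{ij}$ is Lipschitz with constant $l_{ij}$; put $l_i=\sum_j l_{ij}$. (2) There is $\mu>0$ such that the pseudo-gradient $\mathcal P=(\partial f_i/\partial\boldsymbol x_i)_{i=1}^N$ satisfies $(\boldsymbol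 a_1-\boldsymbol a_2)^T(\mathcal P(\boldsymbol a_1)-\mathcal P(\boldsymbol a_2))\ge\mu\|\boldsymbol a_1-\boldsymbol a_2\|^2$ for all $\boldsymbol a_1,\boldsymbol a_2$. (3) The agents communicate over an undirected connected graph $\mathcal G$ (without loops), and for each $i$ the induced subgraph $\mathcal G_i$ on coalition $i$ is connected. **Matrices.** $\mathcal N_{ij}$ and $\mathcal N_{ij}^i$ are the neighbour sets of $ij$ in $\mathcal G$ and $\mathcal G_i$. $L_i$ is the Laplacian matrix of $\mathcal G_i$ and $\breve L_i=\mathrm{diag}\{(L_i)_1,\dots,(L_i)_{n_i}\}\in\mathbb R^{n_i\times n_i^2}$, $(L_i)_j$ being the $j$th row of $L_i$. $W=[w_{ij}^{pq}]$ has $w_{ij}^{pq}>0$ if $pq\in\mathcal N_{ij}$ and $w_{ij}^{pq}=0$ otherwise, with $\sum_{pq}w_{ij}^{pq}+\max_{pq}w_{ij}^{pq}<1$ for all $ij$; $\bar w_{ij}^{pq}=1-\sum_{lm\in\mathcal N_{ij}}w_{ij}^{lm}-w_{ij}^{pq}$. $C_i=[c_{ij}^{im}]$ is doubly stochastic with $c_{ij}^{im}>0$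 if $im\in\mathcal N_{ij}^i\cup\{ij\}$ and $0$ otherwise. $\mathcal M=W\otimes I_{n_{\mathrm{sum}}}+\mathrm{diag}(\bar w_{ij}^{pq})$, $\bar C_i=C_i-\mathbf 1\mathbf 1^T/n_i$, $\bar I_i=I_{n_i}-\mathbf 1\mathbf 1^T/n_i$. $\|\cdot\|$ is the Euclidean (spectral) norm. **Algorithm** with step size $\beta>0$: for $k\in\mathbb N$, all agents $ij$, all $il$ in coalition $i$ and all agents $pq$, $$\begin{aligned}x_{ij}(k)&=x_{ij}(0)-\sum_{im\in\mathcal N_{ij}^i}(\eta_{ij}(k)-\eta_{im}(k)),\\ \eta_{ij}(k+1)&=\eta_{ij}(k)+\beta\sum_{im\in\mathcal N_{ij}^i}(\psi_{ij}^{ij}(k)-\psi_{ij}^{im}(k)),\\ \psi_{ij}^{il}(k+1)&=\sum_{m=1}^{n_i}c_{ij}^{im}\psi_{im}^{il}(k)+\tfrac{\partial f_{ij}}{\partial x_{il}}(\boldsymbol\xi_{ij}(k+1))-\tfrac{\partial f_{ij}}{\partial x_{il}}(\boldsymbol\xi_{ij}(k)),\\ \xi_{ij}^{pq}(k+1)&=\bar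 w_{ij}^{pq}\xi_{ij}^{pq}(k)+\sum_{lm\in\mathcal N_{ij}}w_{ij}^{lm}\xi_{lm}^{pq}(k)+w_{ij}^{pq}x_{pq}(k),\end{aligned}$$ where $\boldsymbol\xi_{ij}=(\xi_{ij}^{pq})_{pq}\in\mathbb R^{n_{\mathrm{sum}}}$, with $x_{ij}(0)=R_{ij}$, $\eta_{ij}(0)=0$, $\psi_{ij}^{il}(0)=\frac{\partial f_{ij}}{\partial x_{il}}(\boldsymbol\xi_{ij}(0))$ and arbitrary $\boldsymbol\xi_{ij}(0)$. **Theorem 2.** Under these assumptions there is exactly one NE $\boldsymbol x^*$, and there are symmetric positive definite matrices $W_{\mathcal M}$ and $W_{c_i}$ ($1\le i\le N$) with $\mathcal M^TW_{\mathcal M}\mathcal M-W_{\mathcal M}=-I$ and $\bar C_i^TW_{c_i}\bar C_i-W_{c_i}=-I$. For any such matrices put $$\gamma_\psi=4\max_i\{n_i\|\breve L_i\|^2\},\qquad b=n_{\mathrm{sum}}\big(2\|\mathcal M^TW_{\mathcal M}\|^2+\|W_{\mathcal M}\|\big),$$ $$\gamma_\xi=4\Big(\max_i\Big\{\tfrac1{n_i}\Big(\sum_{j}l_{ij}^2\Big)\|L_i\|^2\Big\}+2\gamma_\psi\max_{i,j}\big\{(2\|\bar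 C_i^TW_{c_i}\bar I_i\|^2+\|\bar I_i^TW_{c_i}\bar I_i\|)\,l_{ij}^2\big\}\,\|I-\mathcal M\|^2\Big).$$ If $\beta>0$ and $$\beta\le\min\left\{\frac{\mu}{2\big(\sum_{i=1}^N l_i^2\|L_i\|^2/n_i+\gamma_\xi b\big)},\ \frac{\gamma_\psi}{8\mu\max_i\|L_i\breve L_i\|^2},\ \frac{\gamma_\xi}{8\mu\max_i\{\|L_i\|^4(\sum_j l_{ij}^2)/n_i^2\}}\right\}$$ (a quotient with zero denominator imposing no restriction), then $\boldsymbol x(k)$ converges linearly to $\boldsymbol x^*$: there is $\rho\in(0,1)$, independent of the initial estimates $\boldsymbol\xi_{ij}(0)$, such that for every run of the algorithm there is a constant $c$ with $\|\boldsymbol x(k)-\boldsymbol x^*\|\le c\,\rho^k$ for all $k\in\mathbb N$. Moreover, $\sum_j x_{ij}(k)=R_i$ for all $i$ and all $k$. -/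

import Mathlib

open scoped NNReal

noncomputable section

namespace DRA

/-- The agents: `⟨i, j⟩` is the `j`-th member of coalition `i`, which has `n i` members. -/
abbrev Agent {N : ℕ} (n : Fin N → ℕ) : Type := (i : Fin N) × Fin (n i)

/-- Collective states: one real number per agent, with the Euclidean norm. -/
abbrev State {N : ℕ} (n : Fin N → ℕ) : Type := EuclideanSpace ℝ (Agent n)

variable {N : ℕ} {n : Fin N → ℕ}

/-! ### The game -/

/-- The partial derivative of `F` with respect to the coordinate `x_a`, at `x`. -/
def partialDeriv (F : State n → ℝ) (a : Agent n) (x : State n) : ℝ :=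
  gradient F x a

/-- The objective of coalition `i`: the sum of the objectives of its members. -/
def coalitionCost (f : Agent n → State n → ℝ) (i : Fin N) (x : State n) : ℝ :=
  ∑ j, f ⟨i, j⟩ x

/-- The pseudo-gradient: its `⟨i, j⟩` entry is the partial derivative of the objective of
coalition `i` with respect to `x_{ij}`. -/
def pseudoGradient (f : Agent n → State n → ℝ) (x : State n) : State n :=
  WithLp.toLp 2 fun a => partialDeriv (coalitionCost f a.1) a x

/-- The resource of coalition `i`: the sum of the local resources of its members. -/
def coalitionResource (R : Agent n → ℝ) (i : Fin N) : ℝ :=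
  ∑ j, R ⟨i, j⟩

/-- The resource constraint of coalition `i`. -/
def MeetsResource (R : Agent n → ℝ) (i : Fin N) (x : State n) : Prop :=
  ∑ j, x ⟨i, j⟩ = coalitionResource R i

/-- Nash equilibria of the resource allocation game: admissible states from which no coalition
can lower its objective by an admissible change of the states of its own members. -/
def IsNashEquilibrium (f : Agent n → State n → ℝ) (R : Agent n → ℝ) (x : State n) : Prop :=
  (∀ i, MeetsResource R i x) ∧
    ∀ i, ∀ y : State n, (∀ a : Agent n, a.1 ≠ i → y a = x a) → MeetsResource R i y →
      coalitionCost f i x ≤ coalitionCost f i y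

/-! ### The network and its matrices -/

/-- The subgraph induced on the members of coalition `i`. -/
def coalitionGraph (G : SimpleGraph (Agent n)) (i : Fin N) : SimpleGraph (Fin (n i)) :=
  G.comap fun j => (⟨i, j⟩ : Agent n)

open scoped Classical in
/-- The Laplacian matrix `L_i` of the subgraph of coalition `i`. -/
def lap (G : SimpleGraph (Agent n)) (i : Fin N) : Matrix (Fin (n i)) (Fin (n i)) ℝ :=
  (coalitionGraph G i).lapMatrix ℝ

/-- The `n_i × n_i²` block diagonal matrix whose `j`-th diagonal block is the `j`-th row
of `L_i`. -/
def lapRows (G : SimpleGraph (Agent n)) (i : Fin N) :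
    Matrix (Fin (n i)) (Fin (n i) × Fin (n i)) ℝ :=
  Matrix.of fun j q => if q.1 = j then lap G i j q.2 else 0

/-- Admissible weighted adjacency matrices of the network; the last condition says that each
row sum plus the maximal entry of that row is less than `1`. -/
structure IsWeightMatrix (G : SimpleGraph (Agent n)) (W : Matrix (Agent n) (Agent n) ℝ) :
    Prop where
  pos_of_adj : ∀ a c, G.Adj a c → 0 < W a c
  eq_zero : ∀ a c, ¬ G.Adj a c → W a c = 0
  sum_add_max_lt : ∀ a c, ∑ d, W a d + W a c < 1

/-- Doubly stochastic matrices whose positive entries are exactly the diagonal ones and those at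
the edges of the graph. -/
structure IsMixingMatrix {m : ℕ} (H : SimpleGraph (Fin m)) (C : Matrix (Fin m) (Fin m) ℝ) :
    Prop where
  mem_doublyStochastic : C ∈ doublyStochastic ℝ (Fin m)
  pos : ∀ j k, (j = k ∨ H.Adj j k) → 0 < C j k
  eq_zero : ∀ j k, ¬ (j = k ∨ H.Adj j k) → C j k = 0

/-- The coefficients `1 - ∑_{d neighbour of a} w_a^d - w_a^c`; the entries of `W` at
non-neighbours vanish. -/
def selfWeight (W : Matrix (Agent n) (Agent n) ℝ) (a c : Agent n) : ℝ :=
  1 - ∑ d, W a d - W a c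

open scoped Kronecker in
/-- The matrix `W ⊗ I` plus the diagonal matrix of the `selfWeight W a c`. Its rows and columns
are indexed by the pairs (estimating agent, estimated agent). -/
def estimationMatrix (W : Matrix (Agent n) (Agent n) ℝ) :
    Matrix (Agent n × Agent n) (Agent n × Agent n) ℝ :=
  Matrix.kronecker W (1 : Matrix (Agent n) (Agent n) ℝ) +
    Matrix.diagonal fun q => selfWeight W q.1 q.2

/-- The `m × m` matrix with all entries `1 / m`. -/
def averaging (m : ℕ) : Matrix (Fin m) (Fin m) ℝ :=
  Matrix.of fun _ _ => 1 / (m : ℝ)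

/-- `W` is a symmetric positive definite solution of `Aᵀ W A - W = - I`. -/
def IsLyapunovSolution {κ : Type} [Fintype κ] [DecidableEq κ] (A W : Matrix κ κ ℝ) : Prop :=
  W.PosDef ∧ A.transpose * W * A - W = -1

open scoped Matrix.Norms.L2Operator in
/-- The spectral norm: the operator norm of a real matrix for the Euclidean norms. -/
def specNorm {κ ι : Type} [Fintype κ] [Fintype ι] [DecidableEq ι] (A : Matrix κ ι ℝ) : ℝ :=
  ‖A‖

/-! ### The algorithm -/

open scoped Classical in
/-- The sequences produced by the algorithm with step size `β`. Here `ψ k i j l` is the estimate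
by agent `⟨i, j⟩` of the partial derivative of the averaged objective of coalition `i` with
respect to `x_{il}`, and `ξ k a` is the estimate by agent `a` of the collective state.
The initial estimates `ξ 0` are arbitrary. -/
structure IsTrajectory (f : Agent n → State n → ℝ) (R : Agent n → ℝ)
    (G : SimpleGraph (Agent n)) (W : Matrix (Agent n) (Agent n) ℝ)
    (C : (i : Fin N) → Matrix (Fin (n i)) (Fin (n i)) ℝ) (β : ℝ)
    (x : ℕ → State n) (η : ℕ → Agent n → ℝ)
    (ψ : ℕ → (i : Fin N) → Fin (n i) → Fin (n i) → ℝ)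
    (ξ : ℕ → Agent n → State n) : Prop where
  x_init : ∀ a, x 0 a = R a
  η_init : ∀ a, η 0 a = 0
  ψ_init : ∀ i j l, ψ 0 i j l = partialDeriv (f ⟨i, j⟩) ⟨i, l⟩ (ξ 0 ⟨i, j⟩)
  x_eq : ∀ k i j, x k ⟨i, j⟩ = x 0 ⟨i, j⟩ -
    ∑ m ∈ (coalitionGraph G i).neighborFinset j, (η k ⟨i, j⟩ - η k ⟨i, m⟩)
  η_step : ∀ k i j, η (k + 1) ⟨i, j⟩ = η k ⟨i, j⟩ +
    β * ∑ m ∈ (coalitionGraph G i).neighborFinset j, (ψ k i j j - ψ k i j m)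
  ψ_step : ∀ k i j l, ψ (k + 1) i j l = ∑ m, C i j m * ψ k i m l +
    partialDeriv (f ⟨i, j⟩) ⟨i, l⟩ (ξ (k + 1) ⟨i, j⟩) -
    partialDeriv (f ⟨i, j⟩) ⟨i, l⟩ (ξ k ⟨i, j⟩)
  ξ_step : ∀ k a c, ξ (k + 1) a c = selfWeight W a c * ξ k a c +
    ∑ d ∈ G.neighborFinset a, W a d * ξ k d c + W a c * x k c

/-! ### The bound on the step size -/

/-- `l_i`, the sum over `j` of the Lipschitz constants `l_{ij}`. -/
def coalitionLip (l : Agent n → ℝ≥0) (i : Fin N) : ℝ :=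
  ∑ j, (l ⟨i, j⟩ : ℝ)

/-- The sum over `j` of the squares `l_{ij}²`. -/
def coalitionLipSq (l : Agent n → ℝ≥0) (i : Fin N) : ℝ :=
  ∑ j, (l ⟨i, j⟩ : ℝ) ^ 2

/-- The constant `γ_ψ`. -/
def gammaPsi (G : SimpleGraph (Agent n)) : ℝ :=
  4 * ⨆ i, (n i : ℝ) * specNorm (lapRows G i) ^ 2

/-- The constant `b`. -/
def bConst (W : Matrix (Agent n) (Agent n) ℝ)
    (WM : Matrix (Agent n × Agent n) (Agent n × Agent n) ℝ) : ℝ :=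
  ((∑ i, n i : ℕ) : ℝ) *
    (2 * specNorm ((estimationMatrix W).transpose * WM) ^ 2 + specNorm WM)

/-- The coefficient `2 ‖C̄_iᵀ W_{c_i} Ī_i‖² + ‖Ī_iᵀ W_{c_i} Ī_i‖`, where `C̄_i` and `Ī_i` are
`C_i` and the identity minus the averaging matrix. -/
def mixingConst {m : ℕ} (C Wc : Matrix (Fin m) (Fin m) ℝ) : ℝ :=
  2 * specNorm ((C - averaging m).transpose * Wc * (1 - averaging m)) ^ 2 +
    specNorm ((1 - averaging m).transpose * Wc * (1 - averaging m))

/-- The constant `γ_ξ`. -/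
def gammaXi (G : SimpleGraph (Agent n)) (W : Matrix (Agent n) (Agent n) ℝ)
    (C Wc : (i : Fin N) → Matrix (Fin (n i)) (Fin (n i)) ℝ) (l : Agent n → ℝ≥0) : ℝ :=
  4 * ((⨆ i, 1 / (n i : ℝ) * coalitionLipSq l i * specNorm (lap G i) ^ 2) +
    2 * gammaPsi G * (⨆ a : Agent n, mixingConst (C a.1) (Wc a.1) * (l a : ℝ) ^ 2) *
      specNorm (1 - estimationMatrix W) ^ 2)

/-- The step size is at most the minimum of three quotients. Each bound `β ≤ p / q` is written
as `β * q ≤ p`, so that a quotient whose denominator vanishes imposes nothing (for the games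
considered, this happens only when every coalition has a single member). -/
structure StepSizeBound (G : SimpleGraph (Agent n)) (W : Matrix (Agent n) (Agent n) ℝ)
    (C : (i : Fin N) → Matrix (Fin (n i)) (Fin (n i)) ℝ)
    (WM : Matrix (Agent n × Agent n) (Agent n × Agent n) ℝ)
    (Wc : (i : Fin N) → Matrix (Fin (n i)) (Fin (n i)) ℝ)
    (l : Agent n → ℝ≥0) (μ β : ℝ) : Prop where
  fst : β * (2 * (∑ i, coalitionLip l i ^ 2 * specNorm (lap G i) ^ 2 / (n i : ℝ) +
    gammaXi G W C Wc l * bConst W WM)) ≤ μ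
  snd : β * (8 * μ * ⨆ i, specNorm (lap G i * lapRows G i) ^ 2) ≤ gammaPsi G
  trd : β * (8 * μ * ⨆ i, specNorm (lap G i) ^ 4 * coalitionLipSq l i / (n i : ℝ) ^ 2) ≤
    gammaXi G W C Wc l

end DRA

end

open DRA

/-! For convex differentiable objectives the equilibria are the admissible states whose
pseudo-gradient is constant on each coalition. Strong monotonicity allows at most one such state,
and a projected pseudo-gradient step is a contraction whose fixed point is one
(`exists_isStationary`). The Lyapunov matrices exist because $\bar C_i$ strictly shrinks every
nonzero vector, and because $\mathcal M$ is substochastic with row deficits that spread over the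
connected network.

For the convergence, the column sums of $C_i$ keep the mean of the gradient estimates equal to the
mean of the partial derivatives at the agents' own estimates. The remaining disagreement `psiDev`
follows a perturbed stable recursion, but it enters the recursion of $\eta$ at first order in
$\beta$. A change of variables removes it. The solution $s$ of $(1-\bar C_i)s=$ (disagreement minus
centred gradient deviation), called `trackSol`, satisfies $s(k+1)=s(k)-$`psiDev`$(k)$. Adding
$\beta\breve L_is$ to $\eta-\eta_0$ and centring gives a vector $z_i$ driven by the gradient sums
alone (`drivenState_succ`), with $L_iz_i=-(x_i-x_i^*)+\beta L_i\breve L_is$. Hence the increment of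
$\sum_i n_i\|z_i\|^2$ contains $-2\beta\langle x-x^*,\mathcal P(x)-\mathcal
P(x^*)\rangle\le-2\beta\mu\|x-x^*\|^2$, and the disagreement appears only with the factor $\beta^2$.

The Lyapunov function is $\sum_i n_i\|z_i\|^2$ plus $A$ times the quadratic form of the disagreement
plus $B$ times that of the estimation error. One step changes it by at most a linear combination of
$\|x-x^*\|^2$, the squared estimation error and the squared disagreement, and
`exists_lyapunov_weights` chooses $A$ and $B$ so that all three coefficients are negative. The step
size bound contains no explicit term for some of the contributions. They are absorbed through
relations between the constants, above all $n_{\mathrm{sum}}^2\le 2b\|I-\mathcal M\|^2$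
(`IsWeightMatrix.sq_card_le`) and the bound of $\mu$ by the Lipschitz constants (`le_coalitionLip`).
-/

noncomputable section

namespace DRA

open Matrix

/-! ### Squared Euclidean norms of plain vectors -/

/-- The squared Euclidean norm of a vector. -/
def nsq {ι : Type*} [Fintype ι] (v : ι → ℝ) : ℝ := v ⬝ᵥ v

section nsq

variable {ι κ : Type} [Fintype ι] [Fintype κ]

lemma nsq_eq_sum (v : ι → ℝ) : nsq v = ∑ i, v i ^ 2 := by
  simp [nsq, dotProduct, sq]

lemma nsq_nonneg (v : ι → ℝ) : 0 ≤ nsq v := by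
  rw [nsq_eq_sum]; positivity

lemma nsq_eq_zero {v : ι → ℝ} : nsq v = 0 ↔ v = 0 := dotProduct_self_eq_zero

lemma nsq_smul (c : ℝ) (v : ι → ℝ) : nsq (c • v) = c ^ 2 * nsq v := by
  simp [nsq, sq, mul_assoc]

lemma nsq_neg (v : ι → ℝ) : nsq (-v) = nsq v := by simp [nsq]

lemma nsq_add (v w : ι → ℝ) : nsq (v + w) = nsq v + 2 * (v ⬝ᵥ w) + nsq w := by
  simp only [nsq, add_dotProduct, dotProduct_add, dotProduct_comm w v]; ring

lemma two_mul_dotProduct_le (v w : ι → ℝ) {t : ℝ} (ht : 0 < t) :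
    2 * (v ⬝ᵥ w) ≤ t * nsq v + nsq w / t := by
  have h := nsq_nonneg (t • v + (-1 : ℝ) • w)
  rw [nsq_add, nsq_smul, nsq_smul, smul_dotProduct, dotProduct_smul, smul_eq_mul, smul_eq_mul] at h
  have h2 : 0 ≤ (t ^ 2 * nsq v + 2 * (t * (-1 * (v ⬝ᵥ w))) + (-1) ^ 2 * nsq w) / t :=
    div_nonneg h ht.le
  have h3 : (t ^ 2 * nsq v + 2 * (t * (-1 * (v ⬝ᵥ w))) + (-1) ^ 2 * nsq w) / t =
      t * nsq v + nsq w / t - 2 * (v ⬝ᵥ w) := by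
    field_simp; ring
  linarith

lemma nsq_add_le (v w : ι → ℝ) : nsq (v + w) ≤ 2 * nsq v + 2 * nsq w := by
  have h := two_mul_dotProduct_le v w one_pos
  rw [nsq_add]; linarith

lemma nsq_sub_le (v w : ι → ℝ) : nsq (v - w) ≤ 2 * nsq v + 2 * nsq w := by
  rw [sub_eq_add_neg, ← nsq_neg w]; exact nsq_add_le _ _

lemma abs_dotProduct_le (v w : ι → ℝ) {a b : ℝ} (ha : 0 ≤ a) (hb : 0 ≤ b)
    (hv : nsq v ≤ a ^ 2) (hw : nsq w ≤ b ^ 2) : |v ⬝ᵥ w| ≤ a * b := by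
  apply abs_le_of_sq_le_sq _ (by positivity)
  have h : (v ⬝ᵥ w) ^ 2 ≤ nsq v * nsq w := by
    rw [nsq_eq_sum, nsq_eq_sum]
    exact Finset.sum_mul_sq_le_sq_mul_sq _ _ _
  calc (v ⬝ᵥ w) ^ 2 ≤ nsq v * nsq w := h
    _ ≤ a ^ 2 * b ^ 2 := mul_le_mul hv hw (nsq_nonneg _) (by positivity)
    _ = (a * b) ^ 2 := by ring

lemma nsq_eq_norm_sq (v : ι → ℝ) : nsq v = ‖(WithLp.toLp 2 v : EuclideanSpace ℝ ι)‖ ^ 2 := by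
  rw [EuclideanSpace.norm_sq_eq, nsq_eq_sum]; simp

lemma norm_sq_eq_nsq (v : EuclideanSpace ℝ ι) : ‖v‖ ^ 2 = nsq (fun i => v i) := by
  rw [EuclideanSpace.norm_sq_eq, nsq_eq_sum]; simp

variable [DecidableEq ι]

lemma specNorm_nonneg (A : Matrix κ ι ℝ) : 0 ≤ specNorm A := by
  unfold specNorm
  exact @norm_nonneg _ Matrix.instL2OpNormedAddCommGroup.toSeminormedAddCommGroup.toSeminormedAddGroup A

lemma nsq_mulVec_le (A : Matrix κ ι ℝ) (v : ι → ℝ) :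
    nsq (A *ᵥ v) ≤ specNorm A ^ 2 * nsq v := by
  open scoped Matrix.Norms.L2Operator in
  have h := Matrix.l2_opNorm_mulVec A (WithLp.toLp 2 v)
  have h2 := pow_le_pow_left₀ (norm_nonneg _) h 2
  rw [mul_pow] at h2
  rw [nsq_eq_norm_sq, nsq_eq_norm_sq]
  exact h2

lemma dotProduct_mulVec_self_le (A : Matrix ι ι ℝ) (v : ι → ℝ) :
    v ⬝ᵥ A *ᵥ v ≤ specNorm A * nsq v := by
  have h := abs_dotProduct_le v (A *ᵥ v) (Real.sqrt_nonneg (nsq v))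
    (mul_nonneg (specNorm_nonneg A) (Real.sqrt_nonneg (nsq v)))
    (by rw [Real.sq_sqrt (nsq_nonneg v)])
    (by rw [mul_pow, Real.sq_sqrt (nsq_nonneg v)]; exact nsq_mulVec_le A v)
  have h2 : √(nsq v) * (specNorm A * √(nsq v)) = specNorm A * nsq v := by
    rw [mul_left_comm, Real.mul_self_sqrt (nsq_nonneg v)]
  exact (le_abs_self _).trans (h.trans h2.le)

lemma specNorm_sq_le {A : Matrix κ ι ℝ} {c : ℝ} (hc : 0 ≤ c)
    (h : ∀ v, nsq (A *ᵥ v) ≤ c * nsq v) : specNorm A ^ 2 ≤ c := by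
  have h1 : specNorm A ≤ √c := by
    unfold specNorm
    rw [Matrix.l2_opNorm_def]
    refine ContinuousLinearMap.opNorm_le_bound _ (Real.sqrt_nonneg _) fun v => ?_
    apply le_of_sq_le_sq _ (by positivity)
    rw [mul_pow, Real.sq_sqrt hc]
    have := h (fun i => v i)
    rw [nsq_eq_norm_sq, nsq_eq_norm_sq] at this
    exact this
  calc specNorm A ^ 2 ≤ √c ^ 2 := pow_le_pow_left₀ (specNorm_nonneg A) h1 2
    _ = c := Real.sq_sqrt hc

lemma sq_apply_le_specNorm_sq (A : Matrix ι ι ℝ) (p q : ι) : A p q ^ 2 ≤ specNorm A ^ 2 := by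
  have h := nsq_mulVec_le A (Pi.single q 1)
  have h1 : nsq (Pi.single q (1 : ℝ) : ι → ℝ) = 1 := by simp [nsq]
  rw [h1, mul_one, nsq_eq_sum] at h
  refine le_trans ?_ h
  have := Finset.single_le_sum (f := fun i => (A *ᵥ Pi.single q 1) i ^ 2)
    (fun i _ => sq_nonneg _) (Finset.mem_univ p)
  simpa using this

end nsq

/-! ### Discrete Lyapunov equations -/

section Lyapunov

variable {ι κ : Type} [Fintype ι] [DecidableEq ι] [Fintype κ] [DecidableEq κ]

lemma IsLyapunovSolution.quad {A W : Matrix ι ι ℝ} (h : IsLyapunovSolution A W) (w : ι → ℝ) :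
    (A *ᵥ w) ⬝ᵥ W *ᵥ (A *ᵥ w) = w ⬝ᵥ W *ᵥ w - nsq w := by
  have h1 : Aᵀ * W * A = W - 1 := by rw [← sub_add_cancel (Aᵀ * W * A) W, h.2]; abel
  have h2 : (A *ᵥ w) ⬝ᵥ W *ᵥ (A *ᵥ w) = w ⬝ᵥ (Aᵀ * W * A) *ᵥ w := by
    rw [← mulVec_mulVec, ← mulVec_mulVec, dotProduct_mulVec w, vecMul_transpose]
  rw [h2, h1, sub_mulVec, dotProduct_sub, one_mulVec, nsq]

lemma IsLyapunovSolution.dotProduct_comm {A W : Matrix ι ι ℝ} (h : IsLyapunovSolution A W)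
    (v w : ι → ℝ) : v ⬝ᵥ W *ᵥ w = w ⬝ᵥ W *ᵥ v := by
  have hs : Wᵀ = W := by simpa using h.1.isHermitian.eq
  rw [dotProduct_mulVec, ← mulVec_transpose, hs, _root_.dotProduct_comm]

/-- One step of a perturbed linear recursion decreases the Lyapunov function up to the size of
the perturbation. -/
lemma IsLyapunovSolution.step {A W : Matrix ι ι ℝ} (h : IsLyapunovSolution A W)
    (T : Matrix ι κ ℝ) (w : ι → ℝ) (d : κ → ℝ) :
    (A *ᵥ w + T *ᵥ d) ⬝ᵥ W *ᵥ (A *ᵥ w + T *ᵥ d) ≤ w ⬝ᵥ W *ᵥ w - 1 / 2 * nsq w +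
      (2 * specNorm (Aᵀ * W * T) ^ 2 + specNorm (Tᵀ * W * T)) * nsq d := by
  have e1 : (A *ᵥ w) ⬝ᵥ W *ᵥ (T *ᵥ d) = w ⬝ᵥ (Aᵀ * W * T) *ᵥ d := by
    rw [← mulVec_mulVec, ← mulVec_mulVec, dotProduct_mulVec w, vecMul_transpose]
  have e2 : (T *ᵥ d) ⬝ᵥ W *ᵥ (T *ᵥ d) = d ⬝ᵥ (Tᵀ * W * T) *ᵥ d := by
    rw [← mulVec_mulVec, ← mulVec_mulVec, dotProduct_mulVec d, vecMul_transpose]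
  have e3 := h.quad w
  -- Young's inequality with weight 1/2 spends half of the decrease `nsq w` on the cross term; this
  -- is the source of the factor 2 before the squared norm in the constants `b` and `mixingConst`.
  have e4 := two_mul_dotProduct_le w ((Aᵀ * W * T) *ᵥ d) (t := 1 / 2) (by norm_num)
  have e5 := nsq_mulVec_le (Aᵀ * W * T) d
  have e6 := dotProduct_mulVec_self_le (Tᵀ * W * T) d
  rw [mulVec_add, dotProduct_add, add_dotProduct, add_dotProduct, h.dotProduct_comm (T *ᵥ d) (A *ᵥ w),
    e1, e2, e3]
  have e7 : nsq ((Aᵀ * W * T) *ᵥ d) / (1 / 2) = 2 * nsq ((Aᵀ * W * T) *ᵥ d) := by ring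
  rw [e7] at e4
  linarith

/-- A solution of `w = A w + T d` is a fixed point of the perturbed recursion, so in the one-step
bound the two quadratic forms cancel and only the decrease remains. The Lyapunov constants thereby
also bound the resolvent of `A` at 1. -/
lemma IsLyapunovSolution.nsq_le {A W : Matrix ι ι ℝ} (h : IsLyapunovSolution A W)
    (T : Matrix ι κ ℝ) {w : ι → ℝ} {d : κ → ℝ} (hw : w - A *ᵥ w = T *ᵥ d) :
    nsq w ≤ 2 * (2 * specNorm (Aᵀ * W * T) ^ 2 + specNorm (Tᵀ * W * T)) * nsq d := by
  have h1 := h.step T w d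
  rw [← hw, add_sub_cancel] at h1
  linarith

lemma IsLyapunovSolution.isUnit_one_sub {A W : Matrix ι ι ℝ} (h : IsLyapunovSolution A W) :
    IsUnit (1 - A) := by
  rw [← mulVec_injective_iff_isUnit]
  intro v w hvw
  have h1 : (1 - A) *ᵥ (v - w) = 0 := by rw [mulVec_sub, sub_eq_zero]; exact hvw
  have h2 : nsq (v - w) ≤ _ := h.nsq_le (1 : Matrix ι ι ℝ) (w := v - w) (d := 0) (by
    rw [mulVec_zero, ← h1, sub_mulVec, one_mulVec])
  have h3 : nsq (0 : ι → ℝ) = 0 := by simp [nsq]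
  rw [h3, mul_zero] at h2
  exact sub_eq_zero.1 (nsq_eq_zero.1 (le_antisymm h2 (nsq_nonneg _)))

lemma IsLyapunovSolution.quad_nonneg {A W : Matrix ι ι ℝ} (h : IsLyapunovSolution A W)
    (w : ι → ℝ) : 0 ≤ w ⬝ᵥ W *ᵥ w := by
  simpa using h.1.posSemidef.dotProduct_mulVec_nonneg w

/-- The equation reads `W = 1 + Aᵀ W A`, and the second summand is positive semidefinite. -/
lemma IsLyapunovSolution.nsq_le_quad {A W : Matrix ι ι ℝ} (h : IsLyapunovSolution A W)
    (w : ι → ℝ) : nsq w ≤ w ⬝ᵥ W *ᵥ w := by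
  have h1 := h.quad w
  have h2 := h.quad_nonneg (A *ᵥ w)
  linarith

/-- The solution is the convergent series of `(A ^ k)ᵀ * A ^ k`: conjugation by `A` shifts the index
by one and so drops the term `k = 0`, which is the identity. That same term makes the sum positive
definite. -/
lemma exists_isLyapunovSolution_of_geometric (A : Matrix ι ι ℝ) {c r : ℝ} (hr0 : 0 ≤ r)
    (hr : r < 1) (hA : ∀ k p q, |(A ^ k) p q| ≤ c * r ^ k) : ∃ W, IsLyapunovSolution A W := by
  have hs : Summable fun k => (A ^ k)ᵀ * A ^ k := by
    refine Pi.summable.2 fun p => Pi.summable.2 fun q => ?_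
    have hg : Summable fun k : ℕ => (Fintype.card ι * c ^ 2) * (r ^ 2) ^ k :=
      (summable_geometric_of_lt_one (by positivity) (by nlinarith)).mul_left _
    refine Summable.of_norm_bounded hg fun k => ?_
    rw [mul_apply, Real.norm_eq_abs]
    refine (Finset.abs_sum_le_sum_abs _ _).trans ?_
    calc ∑ s, |(A ^ k)ᵀ p s * (A ^ k) s q| ≤ ∑ _s : ι, (c * r ^ k) * (c * r ^ k) := by
          refine Finset.sum_le_sum fun s _ => ?_
          rw [abs_mul]
          exact mul_le_mul (hA k s p) (hA k s q) (abs_nonneg _)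
            ((abs_nonneg _).trans (hA k s p))
      _ = _ := by simp; ring
  obtain ⟨W, hW⟩ := hs
  have hq : ∀ x : ι → ℝ, HasSum (fun k => nsq ((A ^ k) *ᵥ x)) (x ⬝ᵥ W *ᵥ x) := by
    intro x
    have := hW.map (AddMonoidHom.mk' (fun B : Matrix ι ι ℝ => x ⬝ᵥ B *ᵥ x)
      (fun B B' => by rw [add_mulVec, dotProduct_add]))
      (by
        change Continuous fun B : Matrix ι ι ℝ => x ⬝ᵥ B *ᵥ x
        simp only [dotProduct, mulVec]
        fun_prop)
    have h2 : (fun k => nsq ((A ^ k) *ᵥ x)) = (AddMonoidHom.mk'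
        (fun B : Matrix ι ι ℝ => x ⬝ᵥ B *ᵥ x) (fun B B' => by rw [add_mulVec, dotProduct_add])) ∘
        fun k => (A ^ k)ᵀ * A ^ k := by
      funext k
      simp only [Function.comp, AddMonoidHom.mk'_apply, nsq]
      rw [← mulVec_mulVec, dotProduct_mulVec x, vecMul_transpose]
    rw [h2]
    exact this
  refine ⟨W, ?_, ?_⟩
  · refine PosDef.of_dotProduct_mulVec_pos ?_ fun x hx => ?_
    · have h2 : HasSum (fun k => (A ^ k)ᵀ * A ^ k) Wᵀ := by
        have := hW.matrix_transpose
        simpa using this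
      rw [IsHermitian, conjTranspose_eq_transpose_of_trivial]
      exact h2.unique hW
    · have h1 := le_hasSum (hq x) 0 (fun k _ => nsq_nonneg _)
      simp only [pow_zero, one_mulVec] at h1
      have h2 : 0 < nsq x :=
        lt_of_le_of_ne (nsq_nonneg x) fun h => hx (nsq_eq_zero.1 h.symm)
      simpa using h2.trans_le h1
  · have h1 : HasSum (fun k => (A ^ (k + 1))ᵀ * A ^ (k + 1)) (Aᵀ * W * A) := by
      have h2 : (fun k => (A ^ (k + 1))ᵀ * A ^ (k + 1)) = fun k => Aᵀ * ((A ^ k)ᵀ * A ^ k) * A := by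
        funext k
        rw [pow_succ, transpose_mul]
        simp only [Matrix.mul_assoc]
      rw [h2]
      exact (hW.mul_left Aᵀ).mul_right A
    have h2 := (hasSum_nat_add_iff' 1).2 hW
    have h3 := h1.unique h2
    rw [h3]
    simp

/-- Conjugation by `A` shifts the finite sum of the `(A ^ s)ᵀ * W * A ^ s`, so the difference
telescopes to the Lyapunov equation of the power. The exponent `p + 1` guarantees that the term `s =
0`, which is `W` itself, is present and makes the sum definite. -/
lemma exists_isLyapunovSolution_of_pow {A : Matrix ι ι ℝ} (p : ℕ)
    (h : ∃ W, IsLyapunovSolution (A ^ (p + 1)) W) : ∃ W, IsLyapunovSolution A W := by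
  obtain ⟨W, hW⟩ := h
  refine ⟨∑ s ∈ Finset.range (p + 1), (A ^ s)ᵀ * W * A ^ s, ?_, ?_⟩
  · rw [Finset.sum_range_succ']
    refine PosDef.posSemidef_add (posSemidef_sum _ fun s _ => ?_) ?_
    · have := hW.1.posSemidef.conjTranspose_mul_mul_same (A ^ (s + 1))
      simpa using this
    · simpa using hW.1
  · rw [Finset.mul_sum, Finset.sum_mul, ← Finset.sum_sub_distrib]
    have h1 : ∀ s, Aᵀ * ((A ^ s)ᵀ * W * A ^ s) * A - (A ^ s)ᵀ * W * A ^ s =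
        (A ^ (s + 1))ᵀ * W * A ^ (s + 1) - (A ^ s)ᵀ * W * A ^ s := by
      intro s
      rw [pow_succ, transpose_mul]
      simp only [Matrix.mul_assoc]
    simp_rw [h1]
    rw [Finset.sum_range_sub (fun s => (A ^ s)ᵀ * W * A ^ s)]
    simpa using hW.2

/-- Compactness of the unit sphere turns the strict inequality into a uniform factor `r < 1` for
squared norms; the entries of `A ^ k` are then at most `√r ^ k`. -/
lemma exists_isLyapunovSolution_of_nsq_lt {A : Matrix ι ι ℝ}
    (h : ∀ v, v ≠ 0 → nsq (A *ᵥ v) < nsq v) : ∃ W, IsLyapunovSolution A W := by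
  obtain ⟨r, hr0, hr1, hr⟩ : ∃ r : ℝ, 0 ≤ r ∧ r < 1 ∧ ∀ v, nsq (A *ᵥ v) ≤ r * nsq v := by
    cases isEmpty_or_nonempty ι with
    | inl hι =>
      exact ⟨0, le_rfl, one_pos, fun v => by simp [nsq]⟩
    | inr hι =>
      have hc : IsCompact (Metric.sphere (0 : EuclideanSpace ℝ ι) 1) := isCompact_sphere _ _
      have hne : (Metric.sphere (0 : EuclideanSpace ℝ ι) 1).Nonempty :=
        NormedSpace.sphere_nonempty.2 zero_le_one
      have hcont : Continuous fun v : EuclideanSpace ℝ ι => nsq (A *ᵥ (fun i => v i)) := by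
        simp only [nsq, dotProduct, mulVec]
        fun_prop
      obtain ⟨v₀, hv₀, hmax⟩ := hc.exists_isMaxOn hne hcont.continuousOn
      have hv₀1 : nsq (fun i => v₀ i) = 1 := by
        rw [← norm_sq_eq_nsq, mem_sphere_zero_iff_norm.1 hv₀, one_pow]
      refine ⟨nsq (A *ᵥ (fun i => v₀ i)), nsq_nonneg _, ?_, fun v => ?_⟩
      · rw [← hv₀1]
        refine h _ fun h0 => ?_
        rw [nsq_eq_zero.2 h0] at hv₀1
        exact zero_ne_one hv₀1
      · rcases (nsq_nonneg v).eq_or_lt with h0 | h0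
        · have : v = 0 := nsq_eq_zero.1 h0.symm
          simp [this, nsq]
        · have hs : √(nsq v) ≠ 0 := (Real.sqrt_pos.2 h0).ne'
          have hmem : (WithLp.toLp 2 ((√(nsq v))⁻¹ • v) : EuclideanSpace ℝ ι) ∈
              Metric.sphere (0 : EuclideanSpace ℝ ι) 1 := by
            rw [mem_sphere_zero_iff_norm, ← sq_eq_sq₀ (norm_nonneg _) zero_le_one,
              ← nsq_eq_norm_sq, nsq_smul, inv_pow, Real.sq_sqrt h0.le, one_pow]
            exact inv_mul_cancel₀ h0.ne'
          have h1 := hmax hmem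
          simp only [Set.mem_ofPred_eq] at h1
          change nsq (A *ᵥ ((√(nsq v))⁻¹ • v)) ≤ _ at h1
          rw [mulVec_smul, nsq_smul, inv_pow, Real.sq_sqrt h0.le, inv_mul_le_iff₀ h0] at h1
          linarith
  have hpow : ∀ k v, nsq ((A ^ k) *ᵥ v) ≤ r ^ k * nsq v := by
    intro k
    induction k with
    | zero => intro v; simp
    | succ k ih =>
      intro v
      rw [pow_succ, ← mulVec_mulVec]
      refine (ih _).trans ?_
      rw [pow_succ, mul_assoc]
      exact mul_le_mul_of_nonneg_left (hr v) (by positivity)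
  have hsq : √r < 1 := by rw [Real.sqrt_lt' one_pos]; simpa using hr1
  refine exists_isLyapunovSolution_of_geometric A (c := 1) (Real.sqrt_nonneg r) hsq
    fun k p q => ?_
  apply abs_le_of_sq_le_sq _ (by positivity)
  have h1 := sq_apply_le_specNorm_sq (A ^ k) p q
  have h2 := specNorm_sq_le (by positivity) (hpow k)
  rw [one_mul, ← pow_mul, mul_comm k 2, pow_mul, Real.sq_sqrt hr0]
  exact h1.trans h2

end Lyapunov

/-! ### Averaging and centring -/

section averaging

variable {m : ℕ}

lemma averaging_mulVec (v : Fin m → ℝ) (j : Fin m) :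
    (averaging m *ᵥ v) j = 1 / (m : ℝ) * ∑ k, v k := by
  simp [averaging, mulVec, dotProduct, Finset.mul_sum]

lemma averaging_mulVec_of_sum_eq_zero {v : Fin m → ℝ} (hv : ∑ k, v k = 0) :
    averaging m *ᵥ v = 0 := by
  ext j; rw [averaging_mulVec, hv]; simp

lemma centre_mulVec_of_sum_eq_zero {v : Fin m → ℝ} (hv : ∑ k, v k = 0) :
    (1 - averaging m) *ᵥ v = v := by
  rw [sub_mulVec, one_mulVec, averaging_mulVec_of_sum_eq_zero hv, sub_zero]

lemma sum_centre_mulVec (v : Fin m → ℝ) : ∑ j, ((1 - averaging m) *ᵥ v) j = 0 := by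
  rcases Nat.eq_zero_or_pos m with rfl | hm
  · simp
  · have : (m : ℝ) ≠ 0 := by positivity
    simp only [sub_mulVec, one_mulVec, Pi.sub_apply, averaging_mulVec, Finset.sum_sub_distrib]
    simp [this]

lemma nsq_centre_le (v : Fin m → ℝ) : nsq ((1 - averaging m) *ᵥ v) ≤ nsq v := by
  have h1 : ((1 - averaging m) *ᵥ v) ⬝ᵥ (averaging m *ᵥ v) = 0 := by
    have h := sum_centre_mulVec v
    simp only [dotProduct, averaging_mulVec, ← Finset.sum_mul, h, zero_mul]
  have h2 : nsq v = nsq ((1 - averaging m) *ᵥ v + averaging m *ᵥ v) := by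
    rw [sub_mulVec, one_mulVec, sub_add_cancel]
  rw [h2, nsq_add, h1]
  linarith [nsq_nonneg (averaging m *ᵥ v)]

lemma averaging_mul_averaging : averaging m * averaging m = averaging m := by
  ext i j
  have : (m : ℝ) ≠ 0 := by
    have := i.pos; positivity
  simp [averaging, mul_apply]
  field_simp

lemma mul_averaging_of_doublyStochastic {C : Matrix (Fin m) (Fin m) ℝ}
    (hC : C ∈ doublyStochastic ℝ (Fin m)) : C * averaging m = averaging m := by
  ext i j
  have h := sum_row_of_mem_doublyStochastic hC i
  simp [averaging, mul_apply, ← Finset.sum_mul, h]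

lemma averaging_mul_of_doublyStochastic {C : Matrix (Fin m) (Fin m) ℝ}
    (hC : C ∈ doublyStochastic ℝ (Fin m)) : averaging m * C = averaging m := by
  ext i j
  have h := sum_col_of_mem_doublyStochastic hC j
  simp [averaging, mul_apply, ← Finset.mul_sum, h]

/-- Centring turns the mixing matrix into its deviation from the averaging matrix. -/
lemma centre_mulVec_mixing {C : Matrix (Fin m) (Fin m) ℝ}
    (hC : C ∈ doublyStochastic ℝ (Fin m)) (v : Fin m → ℝ) :
    (1 - averaging m) *ᵥ (C *ᵥ v) = (C - averaging m) *ᵥ ((1 - averaging m) *ᵥ v) := by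
  rw [mulVec_mulVec, mulVec_mulVec]
  congr 1
  rw [sub_mul, one_mul, averaging_mul_of_doublyStochastic hC, mul_sub (C - averaging m), mul_one,
    sub_mul C, mul_averaging_of_doublyStochastic hC, averaging_mul_averaging, sub_self, sub_zero]

end averaging

/-! ### Mixing matrices -/

section mixing

variable {m : ℕ} {H : SimpleGraph (Fin m)} {C : Matrix (Fin m) (Fin m) ℝ}

lemma eq_of_forall_adj_eq {V α : Type*} {H : SimpleGraph V} (hH : H.Connected) {v : V → α}
    (h : ∀ j k, H.Adj j k → v j = v k) (j k : V) : v j = v k := by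
  obtain ⟨p⟩ := hH.preconnected j k
  induction p with
  | nil => rfl
  | cons hadj _ ih => exact (h _ _ hadj).trans ih

lemma eq_zero_of_const_of_sum {v : Fin m → ℝ} (h : ∀ j k, v j = v k) (hs : ∑ k, v k = 0) :
    v = 0 := by
  funext j
  have hm : (m : ℝ) ≠ 0 := by
    have := j.pos; positivity
  have h1 : ∑ k, v k = m * v j := by
    rw [Finset.sum_congr rfl fun k _ => h k j]; simp
  rw [h1] at hs
  simpa [hm] using hs

/-- Each row of `C` is a probability vector, and the inner sum is the variance of `w` under it.
Since the columns also sum to one, the second moments add up to `nsq w`. -/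
lemma nsq_sub_nsq_mulVec_of_doublyStochastic (hC : C ∈ doublyStochastic ℝ (Fin m))
    (w : Fin m → ℝ) :
    nsq w - nsq (C *ᵥ w) = ∑ j, ∑ k, C j k * (w k - (C *ᵥ w) j) ^ 2 := by
  have h1 : ∀ j, ∑ k, C j k * (w k - (C *ᵥ w) j) ^ 2 =
      ∑ k, C j k * w k ^ 2 - (C *ᵥ w) j ^ 2 := by
    intro j
    have hr := sum_row_of_mem_doublyStochastic hC j
    have h2 : ∑ k, C j k * w k = (C *ᵥ w) j := rfl
    calc ∑ k, C j k * (w k - (C *ᵥ w) j) ^ 2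
        = ∑ k, (C j k * w k ^ 2 - 2 * (C *ᵥ w) j * (C j k * w k) + (C *ᵥ w) j ^ 2 * C j k) :=
          Finset.sum_congr rfl fun k _ => by ring
      _ = _ := by
          rw [Finset.sum_add_distrib, Finset.sum_sub_distrib, ← Finset.mul_sum, ← Finset.mul_sum,
            h2, hr]; ring
  simp_rw [h1]
  rw [Finset.sum_sub_distrib, Finset.sum_comm, nsq_eq_sum, nsq_eq_sum]
  congr 1
  refine Finset.sum_congr rfl fun k _ => ?_
  rw [← Finset.sum_mul, sum_col_of_mem_doublyStochastic hC, one_mul]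

/-- If no norm were lost, all row variances would vanish, so `w` would take the value `(C *ᵥ w) j`
at `j` and at all its neighbours. The positive diagonal is what links `w j` itself to that value;
connectedness then makes `w` constant, hence zero. -/
lemma IsMixingMatrix.nsq_mulVec_lt (hC : IsMixingMatrix H C) (hH : H.Connected)
    {w : Fin m → ℝ} (hw : w ≠ 0) (hs : ∑ k, w k = 0) : nsq (C *ᵥ w) < nsq w := by
  rw [← sub_pos, nsq_sub_nsq_mulVec_of_doublyStochastic hC.mem_doublyStochastic]
  have hnn : ∀ j k, 0 ≤ C j k * (w k - (C *ᵥ w) j) ^ 2 := fun j k =>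
    mul_nonneg (nonneg_of_mem_doublyStochastic hC.mem_doublyStochastic) (sq_nonneg _)
  refine lt_of_le_of_ne (Finset.sum_nonneg fun j _ => Finset.sum_nonneg fun k _ => hnn j k) ?_
  intro h0
  apply hw
  have h1 : ∀ j k, C j k * (w k - (C *ᵥ w) j) ^ 2 = 0 := by
    intro j k
    have := (Finset.sum_eq_zero_iff_of_nonneg
      (fun j _ => Finset.sum_nonneg fun k _ => hnn j k)).1 h0.symm j (Finset.mem_univ j)
    exact (Finset.sum_eq_zero_iff_of_nonneg (fun k _ => hnn j k)).1 this k (Finset.mem_univ k)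
  have h2 : ∀ j k, (j = k ∨ H.Adj j k) → w k = (C *ᵥ w) j := by
    intro j k hjk
    have := (mul_eq_zero.1 (h1 j k)).resolve_left (hC.pos j k hjk).ne'
    exact sub_eq_zero.1 (pow_eq_zero_iff two_ne_zero |>.1 this)
  refine eq_zero_of_const_of_sum (eq_of_forall_adj_eq hH fun j k hjk => ?_) hs
  rw [h2 j j (Or.inl rfl), h2 j k (Or.inr hjk)]

/-- The deviation matrix is `C` after centring. Centring does not increase the norm, and `C` is
strictly contractive on nonzero centred vectors. -/
lemma IsMixingMatrix.exists_isLyapunovSolution (hC : IsMixingMatrix H C) (hH : H.Connected) :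
    ∃ Wc, IsLyapunovSolution (C - averaging m) Wc := by
  refine exists_isLyapunovSolution_of_nsq_lt fun v hv => ?_
  have h1 : (C - averaging m) *ᵥ v = C *ᵥ ((1 - averaging m) *ᵥ v) := by
    rw [mulVec_mulVec, mul_sub, mul_one,
      mul_averaging_of_doublyStochastic hC.mem_doublyStochastic]
  rw [h1]
  by_cases hw : (1 - averaging m) *ᵥ v = 0
  · rw [hw, mulVec_zero]
    have h2 : nsq (0 : Fin m → ℝ) = 0 := nsq_eq_zero.2 rfl
    rw [h2]
    exact lt_of_le_of_ne (nsq_nonneg v) fun h => hv (nsq_eq_zero.1 h.symm)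
  · exact (hC.nsq_mulVec_lt hH hw (sum_centre_mulVec v)).trans_le (nsq_centre_le v)

lemma exists_ne_zero_sum_eq_zero (hm : 2 ≤ m) : ∃ v : Fin m → ℝ, v ≠ 0 ∧ ∑ k, v k = 0 := by
  refine ⟨Pi.single ⟨0, by omega⟩ 1 - Pi.single ⟨1, by omega⟩ 1, fun h => ?_, by simp⟩
  have := congrFun h ⟨0, by omega⟩
  simp at this

lemma mixingConst_nonneg (C Wc : Matrix (Fin m) (Fin m) ℝ) : 0 ≤ mixingConst C Wc :=
  add_nonneg (by positivity) (specNorm_nonneg _)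

/-- Because `Wc` dominates the identity, any nonzero centred vector forces the second summand up to
1. With a single member there is no such vector and the constant is zero, which is why singleton
coalitions need separate treatment below. -/
lemma one_le_mixingConst {Wc : Matrix (Fin m) (Fin m) ℝ}
    (hW : IsLyapunovSolution (C - averaging m) Wc) (hm : 2 ≤ m) : 1 ≤ mixingConst C Wc := by
  obtain ⟨v, hv, hs⟩ := exists_ne_zero_sum_eq_zero hm
  have h1 := hW.nsq_le_quad v
  have h2 := dotProduct_mulVec_self_le ((1 - averaging m)ᵀ * Wc * (1 - averaging m)) v
  rw [← mulVec_mulVec, ← mulVec_mulVec, dotProduct_mulVec v, vecMul_transpose,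
    centre_mulVec_of_sum_eq_zero hs] at h2
  have h3 : 0 < nsq v := lt_of_le_of_ne (nsq_nonneg v) fun h => hv (nsq_eq_zero.1 h.symm)
  have h4 : 1 ≤ specNorm ((1 - averaging m)ᵀ * Wc * (1 - averaging m)) := by
    by_contra! h
    nlinarith
  unfold mixingConst
  nlinarith [sq_nonneg (specNorm ((C - averaging m)ᵀ * Wc * (1 - averaging m)))]

end mixing

/-! ### Laplacian matrices -/

section laplacian

variable {N : ℕ} {n : Fin N → ℕ} (G : SimpleGraph (Agent n)) (i : Fin N)

open scoped Classical in
lemma lap_mulVec_apply (v : Fin (n i) → ℝ) (j : Fin (n i)) :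
    (lap G i *ᵥ v) j = ∑ k ∈ (coalitionGraph G i).neighborFinset j, (v j - v k) := by
  unfold lap
  rw [SimpleGraph.lapMatrix_mulVec_apply, Finset.sum_sub_distrib]
  simp

open scoped Classical in
lemma lap_transpose : (lap G i)ᵀ = lap G i := by
  unfold lap; exact SimpleGraph.isSymm_lapMatrix _ _

lemma lap_mulVec_one : lap G i *ᵥ (fun _ => 1) = 0 := by
  ext j; rw [lap_mulVec_apply]; simp

lemma sum_lap_mulVec (v : Fin (n i) → ℝ) : ∑ j, (lap G i *ᵥ v) j = 0 := by
  have h : (fun _ => (1 : ℝ)) ⬝ᵥ lap G i *ᵥ v = 0 := by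
    rw [dotProduct_mulVec, ← mulVec_transpose, lap_transpose, lap_mulVec_one, zero_dotProduct]
  simpa [dotProduct] using h

lemma lap_mulVec_averaging (v : Fin (n i) → ℝ) : lap G i *ᵥ (averaging (n i) *ᵥ v) = 0 := by
  have h : averaging (n i) *ᵥ v = (1 / (n i : ℝ) * ∑ k, v k) • fun _ => 1 := by
    ext j; simp [averaging_mulVec]
  rw [h, mulVec_smul, lap_mulVec_one, smul_zero]

lemma lap_mulVec_centre (v : Fin (n i) → ℝ) :
    lap G i *ᵥ ((1 - averaging (n i)) *ᵥ v) = lap G i *ᵥ v := by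
  rw [sub_mulVec (1 : Matrix _ _ ℝ), one_mulVec, mulVec_sub, lap_mulVec_averaging, sub_zero]

lemma dotProduct_lap_mulVec (v w : Fin (n i) → ℝ) :
    v ⬝ᵥ lap G i *ᵥ w = (lap G i *ᵥ v) ⬝ᵥ w := by
  rw [dotProduct_mulVec, ← mulVec_transpose, lap_transpose]

variable {G i}

-- The averaging term removes the constants from the kernel of the Laplacian: the coordinates of `L
-- z` sum to zero, so summing the equation isolates the sum of `z`, and what remains is a harmonic
-- vector on a connected graph. Inverting this matrix yields both the range of the Laplacian and its
-- spectral gap on centred vectors.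
open scoped Classical in
lemma isUnit_lap_add_averaging (hG : (coalitionGraph G i).Connected) :
    IsUnit (lap G i + averaging (n i)) := by
  rw [← mulVec_injective_iff_isUnit]
  intro v w hvw
  have h1 : (lap G i + averaging (n i)) *ᵥ (v - w) = 0 := by
    rw [mulVec_sub, sub_eq_zero]; exact hvw
  rw [← sub_eq_zero]
  set z := v - w
  have hs : ∑ k, z k = 0 := by
    have h2 : ∑ j, ((lap G i + averaging (n i)) *ᵥ z) j = ∑ k, z k := by
      have hm : (n i : ℝ) ≠ 0 ∨ n i = 0 := by
        rcases Nat.eq_zero_or_pos (n i) with h | h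
        · exact Or.inr h
        · left; positivity
      simp only [add_mulVec, Pi.add_apply, Finset.sum_add_distrib, sum_lap_mulVec,
        averaging_mulVec, zero_add]
      rcases hm with hm | hm
      · simp [hm]
      · have : IsEmpty (Fin (n i)) := by rw [hm]; infer_instance
        simp
    rw [← h2, h1]; simp
  rw [add_mulVec, averaging_mulVec_of_sum_eq_zero hs, add_zero] at h1
  refine eq_zero_of_const_of_sum (fun j k => ?_) hs
  unfold lap at h1
  exact (SimpleGraph.lapMatrix_mulVec_eq_zero_iff_forall_reachable _).1 h1 j k
    (hG.preconnected j k)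

lemma exists_lap_mulVec_eq (hG : (coalitionGraph G i).Connected) {w : Fin (n i) → ℝ}
    (hw : ∑ k, w k = 0) : ∃ v, lap G i *ᵥ v = w := by
  have hu := isUnit_lap_add_averaging hG
  obtain ⟨v, hv⟩ := (mulVec_surjective_iff_isUnit.2 hu) w
  refine ⟨v, ?_⟩
  rw [add_mulVec] at hv
  have h1 : (1 - averaging (n i)) *ᵥ (lap G i *ᵥ v + averaging (n i) *ᵥ v) = lap G i *ᵥ v := by
    rw [mulVec_add, centre_mulVec_of_sum_eq_zero (sum_lap_mulVec G i v), mulVec_mulVec, sub_mul,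
      one_mul, averaging_mul_averaging, sub_self, zero_mulVec, add_zero]
  rw [← h1, hv, centre_mulVec_of_sum_eq_zero hw]

lemma exists_nsq_le_lap (hG : (coalitionGraph G i).Connected) :
    ∃ c : ℝ, 0 ≤ c ∧ ∀ z : Fin (n i) → ℝ, ∑ k, z k = 0 → nsq z ≤ c * nsq (lap G i *ᵥ z) := by
  refine ⟨specNorm (lap G i + averaging (n i))⁻¹ ^ 2, sq_nonneg _, fun z hz => ?_⟩
  have hu := (Matrix.isUnit_iff_isUnit_det _).1 (isUnit_lap_add_averaging hG)
  have h1 : z = (lap G i + averaging (n i))⁻¹ *ᵥ (lap G i *ᵥ z) := by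
    have h2 : lap G i *ᵥ z = (lap G i + averaging (n i)) *ᵥ z := by
      rw [add_mulVec, averaging_mulVec_of_sum_eq_zero hz, add_zero]
    rw [h2, mulVec_mulVec, nonsing_inv_mul _ hu, one_mulVec]
  calc nsq z = nsq ((lap G i + averaging (n i))⁻¹ *ᵥ (lap G i *ᵥ z)) := by rw [← h1]
    _ ≤ _ := nsq_mulVec_le _ _

lemma lapRows_mulVec_apply (τ : Fin (n i) × Fin (n i) → ℝ) (j : Fin (n i)) :
    (lapRows G i *ᵥ τ) j = ∑ k, lap G i j k * τ (j, k) := by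
  simp [lapRows, mulVec, dotProduct, Fintype.sum_prod_type]

lemma lapRows_mulVec_snd (v : Fin (n i) → ℝ) :
    lapRows G i *ᵥ (fun q => v q.2) = lap G i *ᵥ v := by
  ext j; rw [lapRows_mulVec_apply]; rfl

/-- Stacking `n i` copies of `v` multiplies the squared norm by `n i`, and `lapRows` maps the
stacked vector to `L v`. -/
lemma specNorm_lap_sq_le : specNorm (lap G i) ^ 2 ≤ n i * specNorm (lapRows G i) ^ 2 := by
  refine specNorm_sq_le (by positivity) fun v => ?_
  rw [← lapRows_mulVec_snd]
  refine (nsq_mulVec_le _ _).trans_eq ?_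
  have h : nsq (fun q : Fin (n i) × Fin (n i) => v q.2) = n i * nsq v := by
    simp [nsq_eq_sum, Fintype.sum_prod_type]
  rw [h]; ring

lemma lap_mulVec_eq_zero_of_le_one (h : n i ≤ 1) (v : Fin (n i) → ℝ) : lap G i *ᵥ v = 0 := by
  have : Subsingleton (Fin (n i)) := by
    rw [Fin.subsingleton_iff_le_one]; exact h
  ext j
  rw [lap_mulVec_apply]
  exact Finset.sum_eq_zero fun k _ => by rw [Subsingleton.elim j k, sub_self]

lemma specNorm_lap_eq_zero (h : n i ≤ 1) : specNorm (lap G i) = 0 := by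
  have h1 : specNorm (lap G i) ^ 2 ≤ 0 := specNorm_sq_le le_rfl fun v => by
    rw [lap_mulVec_eq_zero_of_le_one h, nsq_eq_zero.2 rfl]; simp
  nlinarith [specNorm_nonneg (lap G i)]

lemma specNorm_lap_pos (hG : (coalitionGraph G i).Connected) (h : 2 ≤ n i) :
    0 < specNorm (lap G i) := by
  refine lt_of_le_of_ne (specNorm_nonneg _) fun h0 => ?_
  obtain ⟨v, hv, hs⟩ := exists_ne_zero_sum_eq_zero h
  obtain ⟨c, hc, hc'⟩ := exists_nsq_le_lap hG
  have h1 := nsq_mulVec_le (lap G i) v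
  rw [← h0] at h1
  have h2 := hc' v hs
  have h3 : nsq (lap G i *ᵥ v) = 0 := le_antisymm (by simpa using h1) (nsq_nonneg _)
  rw [h3, mul_zero] at h2
  exact hv (nsq_eq_zero.1 (le_antisymm h2 (nsq_nonneg _)))

end laplacian

/-! ### Substochastic matrices -/

section substochastic

variable {ι : Type} [Fintype ι] [DecidableEq ι] {A : Matrix ι ι ℝ}

lemma pow_apply_nonneg (hA : ∀ p q, 0 ≤ A p q) (k : ℕ) : ∀ p q, 0 ≤ (A ^ k) p q := by
  induction k with
  | zero =>
    intro p q
    rw [pow_zero, one_apply]; split_ifs <;> norm_num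
  | succ k ih =>
    intro p q
    rw [pow_succ, mul_apply]
    exact Finset.sum_nonneg fun s _ => mul_nonneg (ih p s) (hA s q)

lemma exists_isLyapunovSolution_of_rowSum_lt_one (hA : ∀ p q, 0 ≤ A p q)
    (h : ∀ p, (A *ᵥ fun _ => 1) p < 1) : ∃ W, IsLyapunovSolution A W := by
  obtain ⟨r, hr0, hr1, hr⟩ : ∃ r : ℝ, 0 ≤ r ∧ r < 1 ∧ ∀ p, (A *ᵥ fun _ => 1) p ≤ r := by
    cases isEmpty_or_nonempty ι with
    | inl hι => exact ⟨0, le_rfl, one_pos, fun p => hι.elim p⟩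
    | inr hι =>
      obtain ⟨p₀, -, hp₀⟩ := Finset.exists_max_image Finset.univ (A *ᵥ fun _ => 1)
        Finset.univ_nonempty
      refine ⟨_, ?_, h p₀, fun p => hp₀ p (Finset.mem_univ p)⟩
      exact Finset.sum_nonneg fun q _ => mul_nonneg (hA _ _) zero_le_one
  have hpow : ∀ k p, ((A ^ k) *ᵥ fun _ => 1) p ≤ r ^ k := by
    intro k
    induction k with
    | zero => intro p; simp
    | succ k ih =>
      intro p
      rw [pow_succ', ← mulVec_mulVec, pow_succ']
      calc (A *ᵥ ((A ^ k) *ᵥ fun _ => 1)) p ≤ ∑ q, A p q * r ^ k :=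
            Finset.sum_le_sum fun q _ => mul_le_mul_of_nonneg_left (ih q) (hA p q)
        _ = (A *ᵥ fun _ => 1) p * r ^ k := by
            simp [mulVec, dotProduct, Finset.sum_mul]
        _ ≤ r * r ^ k := mul_le_mul_of_nonneg_right (hr p) (by positivity)
  refine exists_isLyapunovSolution_of_geometric A (c := 1) hr0 hr1 fun k p q => ?_
  rw [abs_of_nonneg (pow_apply_nonneg hA k p q), one_mul]
  refine le_trans ?_ (hpow k p)
  have h1 := Finset.single_le_sum (f := fun s => (A ^ k) p s * 1)
    (fun s _ => mul_nonneg (pow_apply_nonneg hA k p s) zero_le_one) (Finset.mem_univ q)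
  simpa [mulVec, dotProduct] using h1

end substochastic

/-! ### The estimation matrix -/

section estimation

variable {N : ℕ} {n : Fin N → ℕ} {G : SimpleGraph (Agent n)} {W : Matrix (Agent n) (Agent n) ℝ}

lemma estimationMatrix_mulVec_apply (W : Matrix (Agent n) (Agent n) ℝ)
    (v : Agent n × Agent n → ℝ) (a c : Agent n) :
    (estimationMatrix W *ᵥ v) (a, c) = ∑ d, W a d * v (d, c) + selfWeight W a c * v (a, c) := by
  unfold estimationMatrix
  rw [add_mulVec, Pi.add_apply, mulVec_diagonal]
  congr 1
  simp only [mulVec, dotProduct, Fintype.sum_prod_type, Matrix.kronecker, kroneckerMap_apply,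
    one_apply]
  simp

lemma IsWeightMatrix.nonneg (hW : IsWeightMatrix G W) (a c : Agent n) : 0 ≤ W a c := by
  by_cases h : G.Adj a c
  · exact (hW.pos_of_adj a c h).le
  · exact (hW.eq_zero a c h).ge

lemma IsWeightMatrix.self_eq_zero (hW : IsWeightMatrix G W) (a : Agent n) : W a a = 0 :=
  hW.eq_zero a a (G.irrefl)

lemma IsWeightMatrix.selfWeight_pos (hW : IsWeightMatrix G W) (a c : Agent n) :
    0 < selfWeight W a c := by
  have := hW.sum_add_max_lt a c
  unfold selfWeight; linarith

lemma IsWeightMatrix.estimationMatrix_nonneg (hW : IsWeightMatrix G W)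
    (p q : Agent n × Agent n) : 0 ≤ estimationMatrix W p q := by
  unfold estimationMatrix
  rw [Matrix.add_apply]
  refine add_nonneg ?_ ?_
  · simp only [Matrix.kronecker, kroneckerMap_apply, one_apply]
    split_ifs
    · simpa using hW.nonneg _ _
    · simp
  · rw [diagonal_apply]
    split_ifs
    · exact (hW.selfWeight_pos _ _).le
    · exact le_rfl

/-- The missing mass `W a c` of row `(a, c)` is the weight that the recursion of the estimates puts
on the true state. Only rows with `a` adjacent to `c` are deficient. -/
lemma sum_add_selfWeight (W : Matrix (Agent n) (Agent n) ℝ) (a c : Agent n) :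
    ∑ d, W a d + selfWeight W a c = 1 - W a c := by
  unfold selfWeight; ring

lemma IsWeightMatrix.rowSum_pow_le_one (hW : IsWeightMatrix G W) (k : ℕ) :
    ∀ q, ((estimationMatrix W ^ k) *ᵥ fun _ => 1) q ≤ 1 := by
  induction k with
  | zero => intro q; simp
  | succ k ih =>
    rintro ⟨a, c⟩
    rw [pow_succ', ← mulVec_mulVec, estimationMatrix_mulVec_apply]
    calc _ ≤ ∑ d, W a d * 1 + selfWeight W a c * 1 := by
          gcongr with d
          · exact hW.nonneg a d
          · exact ih _
          · exact (hW.selfWeight_pos a c).le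
          · exact ih _
      _ ≤ 1 := by
          simp only [mul_one]
          rw [sum_add_selfWeight]
          linarith [hW.nonneg a c]

/-- A deficit at `(d, c)` is passed on to `(a, c)` with positive weight: `W a d` along an edge, the
self weight when `a = d`. Deficits therefore spread over the network and never disappear. -/
lemma IsWeightMatrix.rowSum_pow_succ_lt_one (hW : IsWeightMatrix G W) {k : ℕ} {a d c : Agent n}
    (had : a = d ∨ G.Adj a d) (h : ((estimationMatrix W ^ k) *ᵥ fun _ => 1) (d, c) < 1) :
    ((estimationMatrix W ^ (k + 1)) *ᵥ fun _ => 1) (a, c) < 1 := by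
  rw [pow_succ', ← mulVec_mulVec, estimationMatrix_mulVec_apply]
  have hle := hW.rowSum_pow_le_one k
  have hself := hW.selfWeight_pos a c
  have h1 : ∑ d, W a d * 1 + selfWeight W a c * 1 ≤ 1 := by
    simp only [mul_one]
    rw [sum_add_selfWeight]
    linarith [hW.nonneg a c]
  refine lt_of_lt_of_le ?_ h1
  rcases had with rfl | had
  · exact add_lt_add_of_le_of_lt
      (Finset.sum_le_sum fun e _ => mul_le_mul_of_nonneg_left (hle _) (hW.nonneg a e))
      (mul_lt_mul_of_pos_left h hself)
  · exact add_lt_add_of_lt_of_le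
      (Finset.sum_lt_sum (fun e _ => mul_le_mul_of_nonneg_left (hle _) (hW.nonneg a e))
        ⟨d, Finset.mem_univ d, mul_lt_mul_of_pos_left h (hW.pos_of_adj a d had)⟩)
      (mul_le_mul_of_nonneg_left (hle _) hself.le)

/-- A walk from `a` to a neighbour of `c` carries the deficit back to the row `(a, c)`. As deficits
persist, one common power of the matrix has all row sums below 1. -/
lemma IsWeightMatrix.exists_isLyapunovSolution (hW : IsWeightMatrix G W) (hG : G.Connected)
    [Nontrivial (Agent n)] : ∃ WM, IsLyapunovSolution (estimationMatrix W) WM := by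
  have h1 : ∀ q, ∃ k, ((estimationMatrix W ^ k) *ᵥ fun _ => 1) q < 1 := by
    rintro ⟨a, c⟩
    obtain ⟨e, hce⟩ := hG.preconnected.exists_adj_of_nontrivial c
    obtain ⟨p⟩ := hG.preconnected a e
    induction p with
    | nil =>
      rename_i a
      refine ⟨1, ?_⟩
      rw [pow_one, estimationMatrix_mulVec_apply]
      simp only [mul_one]
      rw [sum_add_selfWeight]
      linarith [hW.pos_of_adj a c hce.symm]
    | cons hadj _ ih =>
      obtain ⟨k, hk⟩ := ih hce
      exact ⟨k + 1, hW.rowSum_pow_succ_lt_one (Or.inr hadj) hk⟩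
  choose K hK using h1
  have hmono : ∀ q k, ((estimationMatrix W ^ (K q + k)) *ᵥ fun _ => 1) q < 1 := by
    intro q k
    induction k with
    | zero => exact hK q
    | succ k ih => exact hW.rowSum_pow_succ_lt_one (a := q.1) (c := q.2) (Or.inl rfl) ih
  -- The sum of all the `K q` serves as a common exponent; one more step only brings it to the
  -- successor form required here.
  refine exists_isLyapunovSolution_of_pow (∑ q, K q) ?_
  refine exists_isLyapunovSolution_of_rowSum_lt_one
    (pow_apply_nonneg hW.estimationMatrix_nonneg _) fun q => ?_
  have h2 : K q ≤ ∑ q, K q := Finset.single_le_sum (fun _ _ => Nat.zero_le _) (Finset.mem_univ q)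
  have h3 := hmono q (∑ q, K q + 1 - K q)
  rwa [show K q + (∑ q, K q + 1 - K q) = ∑ q, K q + 1 by omega] at h3

lemma card_agent : Fintype.card (Agent n) = ∑ i, n i := by simp [Agent]

/-- The network constant `b` cannot be small compared with the squared inverse of the norm of
`1 - M`. -/
lemma IsWeightMatrix.sq_card_le (hW : IsWeightMatrix G W)
    {WM : Matrix (Agent n × Agent n) (Agent n × Agent n) ℝ}
    (hWM : IsLyapunovSolution (estimationMatrix W) WM) :
    ((∑ i, n i : ℕ) : ℝ) ^ 2 ≤ 2 * (bConst W WM * specNorm (1 - estimationMatrix W) ^ 2) := by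
  set S : ℝ := ((∑ i, n i : ℕ) : ℝ) with hS
  set q := 2 * specNorm ((estimationMatrix W)ᵀ * WM) ^ 2 + specNorm WM with hq
  have hq0 : 0 ≤ q := by have := specNorm_nonneg WM; positivity
  set m := specNorm (1 - estimationMatrix W) ^ 2 with hm
  have hcard : ((Fintype.card (Agent n) : ℕ) : ℝ) = S := by rw [card_agent]
  -- The test vector has every agent err by 1 about `c` and by 0 about all others. The matrix `1 -
  -- M` leaves of it only the deficits `W a c`, while its squared norm is the number of agents.
  have h1 : ∀ c : Agent n, S ≤ 2 * q * ∑ a, W a c ^ 2 := by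
    intro c
    set w : Agent n × Agent n → ℝ := fun p => if p.2 = c then 1 else 0 with hw
    have h2 := hWM.nsq_le (1 : Matrix (Agent n × Agent n) (Agent n × Agent n) ℝ) (w := w)
      (d := w - estimationMatrix W *ᵥ w) (by rw [one_mulVec])
    have h3 : nsq w = S := by
      rw [nsq_eq_sum, Fintype.sum_prod_type, ← hcard]
      simp [hw]
    have h4 : nsq (w - estimationMatrix W *ᵥ w) = ∑ a, W a c ^ 2 := by
      rw [nsq_eq_sum, Fintype.sum_prod_type]
      refine Finset.sum_congr rfl fun a _ => ?_
      rw [Finset.sum_eq_single c]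
      · rw [Pi.sub_apply, estimationMatrix_mulVec_apply]
        simp only [hw, if_true, mul_one]
        rw [sum_add_selfWeight]; ring
      · intro d _ hd
        rw [Pi.sub_apply, estimationMatrix_mulVec_apply]
        simp [hw, hd]
      · intro h; exact absurd (Finset.mem_univ c) h
    rw [h3, h4] at h2
    simpa [hq] using h2
  -- The diagonal entry of `1 - M` at `(a, a)` is the whole row sum of `W` at `a`, as `W a a = 0`,
  -- and it dominates the Euclidean norm of that row.
  have h5 : ∀ a : Agent n, ∑ c, W a c ^ 2 ≤ m := by
    intro a
    have h6 := sq_apply_le_specNorm_sq (1 - estimationMatrix W) (a, a) (a, a)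
    have h7 : (1 - estimationMatrix W) (a, a) (a, a) = ∑ d, W a d := by
      have := hW.self_eq_zero a
      simp [estimationMatrix, Matrix.kronecker, selfWeight, this]
    rw [h7] at h6
    exact (Finset.sum_sq_le_sq_sum_of_nonneg fun c _ => hW.nonneg a c).trans h6
  have h8 : S * S ≤ 2 * q * (S * m) := by
    calc S * S = ∑ _c : Agent n, S := by
          rw [Finset.sum_const, Finset.card_univ, nsmul_eq_mul, hcard]
      _ ≤ ∑ c, 2 * q * ∑ a, W a c ^ 2 := Finset.sum_le_sum fun c _ => h1 c
      _ = 2 * q * ∑ a, ∑ c, W a c ^ 2 := by rw [← Finset.mul_sum, Finset.sum_comm]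
      _ ≤ 2 * q * ∑ _a : Agent n, m := by
          gcongr with a
          exact h5 a
      _ = 2 * q * (S * m) := by
          rw [Finset.sum_const, Finset.card_univ, nsmul_eq_mul, hcard]
  unfold bConst
  rw [← hS, ← hq]
  calc S ^ 2 = S * S := sq S
    _ ≤ _ := h8
    _ = _ := by ring

end estimation

/-! ### Gradients -/

section gradients

variable {N : ℕ} {n : Fin N → ℕ}

/-- The block of a collective vector that belongs to coalition `i`. -/
def block (v : State n) (i : Fin N) : Fin (n i) → ℝ := fun j => v ⟨i, j⟩

lemma norm_sq_eq_sum_block (v : State n) : ‖v‖ ^ 2 = ∑ i, nsq (block v i) := by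
  rw [EuclideanSpace.norm_sq_eq, Fintype.sum_sigma]
  simp [nsq_eq_sum, block]

lemma nsq_block_le (v : State n) (i : Fin N) : nsq (block v i) ≤ ‖v‖ ^ 2 := by
  rw [norm_sq_eq_sum_block]
  exact Finset.single_le_sum (f := fun i => nsq (block v i)) (fun _ _ => nsq_nonneg _)
    (Finset.mem_univ i)

lemma inner_eq_sum_block (v w : State n) : inner ℝ v w = ∑ i, block v i ⬝ᵥ block w i := by
  rw [PiLp.inner_apply, Fintype.sum_sigma]
  simp [dotProduct, block, mul_comm]

lemma block_sub (v w : State n) (i : Fin N) : block (v - w) i = block v i - block w i := rfl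

lemma block_sum {ι : Type*} (s : Finset ι) (v : ι → State n) (i : Fin N) :
    block (∑ k ∈ s, v k) i = ∑ k ∈ s, block (v k) i := by
  ext j
  simp [block]

variable {f : Agent n → State n → ℝ} {l : Agent n → ℝ≥0}

lemma gradient_coalitionCost (hdiff : ∀ a, ContDiff ℝ 1 (f a)) (i : Fin N) (x : State n) :
    gradient (coalitionCost f i) x = ∑ j, gradient (f ⟨i, j⟩) x := by
  have h : ∀ j, DifferentiableAt ℝ (f ⟨i, j⟩) x := fun j =>
    (hdiff _).differentiable one_ne_zero x
  have h2 : fderiv ℝ (coalitionCost f i) x = ∑ j, fderiv ℝ (f ⟨i, j⟩) x := by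
    unfold coalitionCost
    rw [fderiv_fun_sum fun j _ => h j]
  unfold gradient
  rw [h2, map_sum]

lemma block_pseudoGradient (hdiff : ∀ a, ContDiff ℝ 1 (f a)) (i : Fin N) (x : State n) :
    block (pseudoGradient f x) i = ∑ j, block (gradient (f ⟨i, j⟩) x) i := by
  rw [← block_sum, ← gradient_coalitionCost hdiff]
  rfl

lemma nsq_block_gradient_sub_le (hlip : ∀ a, LipschitzWith (l a) (gradient (f a)))
    (a : Agent n) (i : Fin N) (x y : State n) :
    nsq (block (gradient (f a) x) i - block (gradient (f a) y) i) ≤ (l a * ‖x - y‖) ^ 2 := by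
  rw [← block_sub]
  refine (nsq_block_le _ _).trans ?_
  have h := (hlip a).dist_le_mul x y
  rw [dist_eq_norm, dist_eq_norm] at h
  exact pow_le_pow_left₀ (norm_nonneg _) h 2

lemma coalitionLip_nonneg (l : Agent n → ℝ≥0) (i : Fin N) : 0 ≤ coalitionLip l i :=
  Finset.sum_nonneg fun j _ => (l ⟨i, j⟩).2

lemma coalitionLipSq_nonneg (l : Agent n → ℝ≥0) (i : Fin N) : 0 ≤ coalitionLipSq l i :=
  Finset.sum_nonneg fun _ _ => sq_nonneg _

lemma nsq_block_sum_gradient_sub_le (hlip : ∀ a, LipschitzWith (l a) (gradient (f a)))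
    (i : Fin N) (x y : Fin (n i) → State n) :
    nsq (∑ j, (block (gradient (f ⟨i, j⟩) (x j)) i - block (gradient (f ⟨i, j⟩) (y j)) i)) ≤
      (∑ j, (l ⟨i, j⟩ : ℝ) * ‖x j - y j‖) ^ 2 := by
  have h1 : ∑ j, (block (gradient (f ⟨i, j⟩) (x j)) i - block (gradient (f ⟨i, j⟩) (y j)) i) =
      block (∑ j, (gradient (f ⟨i, j⟩) (x j) - gradient (f ⟨i, j⟩) (y j))) i := by
    rw [block_sum]; rfl
  rw [h1]
  refine (nsq_block_le _ _).trans (pow_le_pow_left₀ (norm_nonneg _) ?_ 2)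
  refine (norm_sum_le _ _).trans (Finset.sum_le_sum fun j _ => ?_)
  have h := (hlip ⟨i, j⟩).dist_le_mul (x j) (y j)
  rwa [dist_eq_norm, dist_eq_norm] at h

lemma nsq_block_pseudoGradient_sub_le (hdiff : ∀ a, ContDiff ℝ 1 (f a))
    (hlip : ∀ a, LipschitzWith (l a) (gradient (f a))) (i : Fin N) (x y : State n) :
    nsq (block (pseudoGradient f x) i - block (pseudoGradient f y) i) ≤
      coalitionLip l i ^ 2 * ‖x - y‖ ^ 2 := by
  rw [block_pseudoGradient hdiff, block_pseudoGradient hdiff, ← Finset.sum_sub_distrib]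
  refine (nsq_block_sum_gradient_sub_le hlip i (fun _ => x) (fun _ => y)).trans_eq ?_
  rw [← Finset.sum_mul, mul_pow]; rfl

lemma norm_pseudoGradient_sub_sq_le (hdiff : ∀ a, ContDiff ℝ 1 (f a))
    (hlip : ∀ a, LipschitzWith (l a) (gradient (f a))) (x y : State n) :
    ‖pseudoGradient f x - pseudoGradient f y‖ ^ 2 ≤
      (∑ i, coalitionLip l i ^ 2) * ‖x - y‖ ^ 2 := by
  rw [norm_sq_eq_sum_block, Finset.sum_mul]
  exact Finset.sum_le_sum fun i _ => nsq_block_pseudoGradient_sub_le hdiff hlip i x y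

/-- Monotonicity is tested on the unit vector of one member, whose pseudo-gradient entry is
controlled by the Lipschitz bound of its coalition. -/
lemma le_coalitionLip {μ : ℝ} (hdiff : ∀ a, ContDiff ℝ 1 (f a))
    (hlip : ∀ a, LipschitzWith (l a) (gradient (f a)))
    (hmono : ∀ y z : State n,
      μ * ‖y - z‖ ^ 2 ≤ inner ℝ (y - z) (pseudoGradient f y - pseudoGradient f z))
    (i : Fin N) (hi : 1 ≤ n i) : μ ≤ coalitionLip l i := by
  set j : Fin (n i) := ⟨0, hi⟩
  set y : State n := EuclideanSpace.single ⟨i, j⟩ (1 : ℝ) with hy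
  have h1 := hmono y 0
  have h2 := nsq_block_pseudoGradient_sub_le hdiff hlip i y 0
  have hn : ‖y‖ = 1 := by simp [hy]
  rw [sub_zero, hn] at h1 h2
  rw [hy, EuclideanSpace.inner_single_left] at h1
  simp only [map_one, one_mul, one_pow, mul_one] at h1 h2
  refine h1.trans (le_of_sq_le_sq (le_trans ?_ h2) (coalitionLip_nonneg l i))
  rw [nsq_eq_sum]
  exact Finset.single_le_sum
    (f := fun k => (block (pseudoGradient f y) i - block (pseudoGradient f 0) i) k ^ 2)
    (fun _ _ => sq_nonneg _) (Finset.mem_univ j)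

end gradients

/-! ### Nash equilibria as stationary points -/

section nash

variable {N : ℕ} {n : Fin N → ℕ} {f : Agent n → State n → ℝ} {R : Agent n → ℝ}

/-- The pseudo-gradient is constant on each coalition. -/
def IsStationary (f : Agent n → State n → ℝ) (x : State n) : Prop :=
  ∀ i j k, pseudoGradient f x ⟨i, j⟩ = pseudoGradient f x ⟨i, k⟩

lemma differentiable_coalitionCost (hdiff : ∀ a, ContDiff ℝ 1 (f a)) (i : Fin N) :
    Differentiable ℝ (coalitionCost f i) := by
  unfold coalitionCost
  exact Differentiable.fun_sum fun j _ => (hdiff _).differentiable one_ne_zero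

lemma convexOn_coalitionCost (hconv : ∀ a, ConvexOn ℝ Set.univ (f a)) (i : Fin N) :
    ConvexOn ℝ Set.univ (coalitionCost f i) := by
  refine ⟨convex_univ, fun x _ y _ a b ha hb hab => ?_⟩
  simp only [coalitionCost, smul_eq_mul, Finset.mul_sum, ← Finset.sum_add_distrib]
  exact Finset.sum_le_sum fun j _ =>
    (hconv ⟨i, j⟩).2 (Set.mem_univ x) (Set.mem_univ y) ha hb hab

lemma hasDerivAt_comp_line {F : State n → ℝ} (hF : Differentiable ℝ F) (x v : State n) :
    HasDerivAt (fun t : ℝ => F (x + t • v)) (inner ℝ (gradient F x) v) 0 := by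
  have h1 : HasDerivAt (fun t : ℝ => x + t • v) v 0 := by
    simpa using ((hasDerivAt_id (0 : ℝ)).smul_const v).const_add x
  have h2 : HasFDerivAt F (fderiv ℝ F x) (x + (0 : ℝ) • v) := by
    simpa using (hF x).hasFDerivAt
  have h3 := h2.comp_hasDerivAt (0 : ℝ) h1
  rw [inner_gradient_left]
  exact h3

lemma inner_gradient_le_sub {F : State n → ℝ} (hF : Differentiable ℝ F)
    (hconv : ConvexOn ℝ Set.univ F) (x y : State n) :
    inner ℝ (gradient F x) (y - x) ≤ F y - F x := by
  have hc : ConvexOn ℝ Set.univ (fun t : ℝ => F (x + t • (y - x))) := by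
    have := hconv.comp_affineMap (AffineMap.lineMap x y : ℝ →ᵃ[ℝ] State n)
    rw [Set.preimage_univ] at this
    have h2 : (fun t : ℝ => F (x + t • (y - x))) = F ∘ (AffineMap.lineMap x y : ℝ →ᵃ[ℝ] State n) := by
      funext t
      rw [Function.comp_apply, AffineMap.lineMap_apply, vsub_eq_sub, vadd_eq_add, add_comm]
    rw [h2]
    exact this
  have h := hc.le_slope_of_hasDerivAt (Set.mem_univ (0 : ℝ)) (Set.mem_univ (1 : ℝ)) one_pos
    (hasDerivAt_comp_line hF x (y - x))
  simpa [slope_def_field] using h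

lemma dotProduct_eq_zero_of_const {m : ℕ} {v w : Fin m → ℝ} (hv : ∑ j, v j = 0)
    (hw : ∀ j k, w j = w k) : v ⬝ᵥ w = 0 := by
  rcases Nat.eq_zero_or_pos m with rfl | hm
  · exact Fintype.sum_empty _
  · have : ∀ j, v j * w j = v j * w ⟨0, hm⟩ := fun j => by rw [hw j ⟨0, hm⟩]
    simp only [dotProduct, this, ← Finset.sum_mul, hv, zero_mul]

/-- An admissible deviation has zero sum over the coalition, hence is orthogonal to a gradient block
that is constant there; convexity makes this first-order condition sufficient. -/
lemma isNashEquilibrium_of_isStationary (hconv : ∀ a, ConvexOn ℝ Set.univ (f a))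
    (hdiff : ∀ a, ContDiff ℝ 1 (f a)) {x : State n} (hx : ∀ i, MeetsResource R i x)
    (hst : IsStationary f x) : IsNashEquilibrium f R x := by
  refine ⟨hx, fun i y hy hyR => ?_⟩
  have h1 := inner_gradient_le_sub (differentiable_coalitionCost hdiff i)
    (convexOn_coalitionCost hconv i) x y
  have h2 : inner ℝ (gradient (coalitionCost f i) x) (y - x) = 0 := by
    rw [inner_eq_sum_block]
    refine Finset.sum_eq_zero fun i' _ => ?_
    by_cases hi : i' = i
    · subst hi
      rw [dotProduct_comm]
      refine dotProduct_eq_zero_of_const ?_ (hst i')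
      have e1 : ∑ j, y ⟨i', j⟩ = coalitionResource R i' := hyR
      have e2 : ∑ j, x ⟨i', j⟩ = coalitionResource R i' := hx i'
      simp [block, e1, e2]
    · have : block (y - x) i' = 0 := by
        ext j
        simp [block, hy ⟨i', j⟩ hi]
      rw [this, dotProduct_zero]
  linarith

/-- Moving resource from member `k` to member `j` preserves the constraint in both directions, so
the derivative along the difference of the two unit vectors vanishes. -/
lemma IsNashEquilibrium.isStationary (hdiff : ∀ a, ContDiff ℝ 1 (f a)) {x : State n}
    (hx : IsNashEquilibrium f R x) : IsStationary f x := by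
  intro i j k
  by_cases hjk : j = k
  · rw [hjk]
  set v : State n := EuclideanSpace.single ⟨i, j⟩ (1 : ℝ) - EuclideanSpace.single ⟨i, k⟩ (1 : ℝ)
    with hv
  have hd := hasDerivAt_comp_line (differentiable_coalitionCost hdiff i) x v
  have hmin : IsLocalMin (fun t : ℝ => coalitionCost f i (x + t • v)) 0 := by
    refine Filter.Eventually.of_forall fun t => ?_
    simp only [zero_smul, add_zero]
    refine hx.2 i _ (fun a ha => ?_) ?_
    · have h1 : a ≠ ⟨i, j⟩ := fun h => ha (by rw [h])
      have h2 : a ≠ ⟨i, k⟩ := fun h => ha (by rw [h])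
      simp [hv, h1, h2]
    · have h3 : ∑ j, x ⟨i, j⟩ = coalitionResource R i := hx.1 i
      have h4 : ∑ m, v ⟨i, m⟩ = 0 := by
        simp [hv, PiLp.single_apply]
      change ∑ m, (x ⟨i, m⟩ + t * v ⟨i, m⟩) = _
      rw [Finset.sum_add_distrib, ← Finset.mul_sum, h3, h4, mul_zero, add_zero]
  have h0 := hmin.hasDerivAt_eq_zero hd
  rw [hv, inner_sub_right, EuclideanSpace.inner_single_right,
    EuclideanSpace.inner_single_right] at h0
  simp only [one_mul, conj_trivial] at h0
  exact sub_eq_zero.1 h0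

lemma eq_of_isStationary {μ : ℝ} (hμ : 0 < μ)
    (hmono : ∀ y z : State n,
      μ * ‖y - z‖ ^ 2 ≤ inner ℝ (y - z) (pseudoGradient f y - pseudoGradient f z))
    {x y : State n} (hx : ∀ i, MeetsResource R i x) (hy : ∀ i, MeetsResource R i y)
    (hxs : IsStationary f x) (hys : IsStationary f y) : y = x := by
  have h1 := hmono y x
  have h2 : inner ℝ (y - x) (pseudoGradient f y - pseudoGradient f x) = 0 := by
    rw [inner_eq_sum_block]
    refine Finset.sum_eq_zero fun i _ => dotProduct_eq_zero_of_const ?_ fun j k => ?_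
    · have e1 : ∑ j, y ⟨i, j⟩ = coalitionResource R i := hy i
      have e2 : ∑ j, x ⟨i, j⟩ = coalitionResource R i := hx i
      simp [block, e1, e2]
    · simp [block, hxs i j k, hys i j k]
  rw [h2] at h1
  have h3 : ‖y - x‖ ^ 2 ≤ 0 := by
    by_contra! h
    nlinarith
  have h4 : ‖y - x‖ = 0 := by nlinarith [norm_nonneg (y - x)]
  exact sub_eq_zero.1 (norm_eq_zero.1 h4)

/-- The orthogonal projection onto the collective vectors whose entries sum to zero over each
coalition. -/
def centreState (v : State n) : State n :=
  WithLp.toLp 2 fun a => ((1 - averaging (n a.1)) *ᵥ block v a.1) a.2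

lemma block_centreState (v : State n) (i : Fin N) :
    block (centreState v) i = (1 - averaging (n i)) *ᵥ block v i := rfl

lemma norm_centreState_sub_le (v w : State n) : ‖centreState v - centreState w‖ ≤ ‖v - w‖ := by
  apply le_of_sq_le_sq _ (norm_nonneg _)
  rw [norm_sq_eq_sum_block, norm_sq_eq_sum_block]
  refine Finset.sum_le_sum fun i _ => ?_
  rw [block_sub, block_sub, block_centreState, block_centreState, ← mulVec_sub]
  exact nsq_centre_le _

lemma exists_isStationary {l : Agent n → ℝ≥0} {μ : ℝ} (hμ : 0 < μ)
    (hdiff : ∀ a, ContDiff ℝ 1 (f a))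
    (hlip : ∀ a, LipschitzWith (l a) (gradient (f a)))
    (hmono : ∀ y z : State n,
      μ * ‖y - z‖ ^ 2 ≤ inner ℝ (y - z) (pseudoGradient f y - pseudoGradient f z)) :
    ∃ x : State n, (∀ i, MeetsResource R i x) ∧ IsStationary f x := by
  -- Adding `μ ^ 2` to the squared Lipschitz constant makes `ℓ` positive and the contraction factor
  -- `1 - μ ^ 2 / ℓ` nonnegative without further argument.
  set ℓ : ℝ := ∑ i, coalitionLip l i ^ 2 + μ ^ 2 with hℓ
  have hμℓ : μ ^ 2 ≤ ℓ := by
    have : 0 ≤ ∑ i, coalitionLip l i ^ 2 := Finset.sum_nonneg fun i _ => sq_nonneg _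
    linarith
  have hℓ0 : 0 < ℓ := lt_of_lt_of_le (by positivity) hμℓ
  set R' : State n := WithLp.toLp 2 R with hR'
  set τ : ℝ := μ / ℓ with hτ
  have hτ0 : 0 < τ := div_pos hμ hℓ0
  -- A pseudo-gradient step followed by the orthogonal projection onto the affine space of
  -- admissible states. The step `τ = μ / ℓ` minimises `1 - 2 τ μ + τ ^ 2 ℓ`.
  set T : State n → State n := fun x =>
    R' + centreState (x - τ • pseudoGradient f x - R') with hT
  have hq0 : 0 ≤ 1 - μ ^ 2 / ℓ := by rw [sub_nonneg, div_le_one hℓ0]; exact hμℓ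
  have hcontr : ∀ x y, ‖T x - T y‖ ≤ √(1 - μ ^ 2 / ℓ) * ‖x - y‖ := by
    intro x y
    have h1 : ‖T x - T y‖ ≤ ‖(x - y) - τ • (pseudoGradient f x - pseudoGradient f y)‖ := by
      simp only [hT, add_sub_add_left_eq_sub]
      refine (norm_centreState_sub_le _ _).trans_eq ?_
      congr 1
      rw [smul_sub]; abel
    refine h1.trans (le_of_sq_le_sq ?_ (by positivity))
    have h2 := hmono x y
    have h3 := norm_pseudoGradient_sub_sq_le hdiff hlip x y
    have h4 : ‖pseudoGradient f x - pseudoGradient f y‖ ^ 2 ≤ ℓ * ‖x - y‖ ^ 2 := by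
      refine h3.trans (mul_le_mul_of_nonneg_right ?_ (sq_nonneg _))
      rw [hℓ]; nlinarith
    rw [norm_sub_sq_real, inner_smul_right, norm_smul, mul_pow, mul_pow, Real.sq_sqrt hq0,
      Real.norm_eq_abs, sq_abs]
    have h5 := mul_le_mul_of_nonneg_left h2 hτ0.le
    have h6 := mul_le_mul_of_nonneg_left h4 (sq_nonneg τ)
    have h7 : τ * μ = μ ^ 2 / ℓ := by rw [hτ]; ring
    have h8 : τ ^ 2 * ℓ = μ ^ 2 / ℓ := by rw [hτ]; field_simp
    have h9 : τ * (μ * ‖x - y‖ ^ 2) = μ ^ 2 / ℓ * ‖x - y‖ ^ 2 := by rw [← mul_assoc, h7]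
    have h10 : τ ^ 2 * (ℓ * ‖x - y‖ ^ 2) = μ ^ 2 / ℓ * ‖x - y‖ ^ 2 := by rw [← mul_assoc, h8]
    linarith
  have hK : ContractingWith (Real.toNNReal √(1 - μ ^ 2 / ℓ)) T := by
    refine ⟨?_, LipschitzWith.of_dist_le_mul fun x y => ?_⟩
    · rw [← NNReal.coe_lt_coe, Real.coe_toNNReal _ (Real.sqrt_nonneg _), NNReal.coe_one,
        Real.sqrt_lt' one_pos, one_pow]
      have : 0 < μ ^ 2 / ℓ := by positivity
      linarith
    · rw [Real.coe_toNNReal _ (Real.sqrt_nonneg _), dist_eq_norm, dist_eq_norm]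
      exact hcontr x y
  have hfix : T (hK.fixedPoint T) = hK.fixedPoint T := hK.fixedPoint_isFixedPt
  set x := hK.fixedPoint T with hx
  have hb : ∀ i, block x i - block R' i =
      (1 - averaging (n i)) *ᵥ (block x i - τ • block (pseudoGradient f x) i - block R' i) := by
    intro i
    have h1 : block (T x) i = block R' i +
        (1 - averaging (n i)) *ᵥ (block x i - τ • block (pseudoGradient f x) i - block R' i) := rfl
    rw [hfix] at h1
    exact sub_eq_iff_eq_add'.2 h1
  have hsum : ∀ i, ∑ j, (block x i - block R' i) j = 0 := by
    intro i
    rw [hb i]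
    exact sum_centre_mulVec _
  refine ⟨x, fun i => ?_, fun i j k => ?_⟩
  · have h1 := hsum i
    simp only [Pi.sub_apply, Finset.sum_sub_distrib, sub_eq_zero] at h1
    exact h1
  · have h2 : τ • ((1 - averaging (n i)) *ᵥ block (pseudoGradient f x) i) = 0 := by
      have h3 := hb i
      have h4 : block x i - τ • block (pseudoGradient f x) i - block R' i =
          (block x i - block R' i) - τ • block (pseudoGradient f x) i := by abel
      rw [h4, mulVec_sub, centre_mulVec_of_sum_eq_zero (hsum i), mulVec_smul] at h3
      exact (sub_eq_self.1 h3.symm)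
    have h5 := (smul_eq_zero.1 h2).resolve_left hτ0.ne'
    rw [sub_mulVec, one_mulVec, sub_eq_zero] at h5
    have h6 := congrFun h5 j
    have h7 := congrFun h5 k
    rw [averaging_mulVec] at h6 h7
    exact h6.trans h7.symm

end nash

/-! ### The weights of the Lyapunov function -/

set_option maxHeartbeats 1600000 in
/-- The step size bounds leave room for a Lyapunov function all of whose coefficients of
decrease are negative. -/
lemma exists_lyapunov_weights {β μ g K m b n G1 G2 G3 S0 Q κ : ℝ} (hβ : 0 < β) (hμ : 0 < μ)
    (hg : 0 < g) (hK : 0 < K) (hm : 0 ≤ m) (hb : 0 ≤ b) (hn : 2 ≤ n) (hG1 : 0 ≤ G1)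
    (hS0 : 0 ≤ S0) (hQ : 0 ≤ Q) (hκ : 1 ≤ κ)
    (h1 : β * (2 * (S0 + 4 * (G1 + 2 * g * K * m) * b)) ≤ μ)
    (h2 : β * (8 * μ * G2) ≤ g)
    (h3 : β * (8 * μ * G3) ≤ 4 * (G1 + 2 * g * K * m))
    (h4 : n ^ 2 ≤ 2 * (b * m))
    (h5 : 8 * Q ≤ S0 * g) (h6 : 4 * Q ≤ G1 * n * g) (h7 : κ * μ ^ 2 ≤ K * n ^ 2) :
    ∃ A B ε : ℝ, 0 < A ∧ 0 < B ∧ 0 < ε ∧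
      -(2 * β * μ) + β * μ / 4 + β ^ 2 * (5 / 2 * S0 + 8 * g * K * n) + 2 * β ^ 2 * b * Q * B ≤ -ε ∧
      5 / 2 * β ^ 2 * G1 + 8 * β ^ 2 * g * K + 4 * β * (n * K) / μ + A * K * m +
        4 * β ^ 2 * b * G3 * B - B / 2 ≤ -ε ∧
      4 * β ^ 2 * g * κ + 4 * β ^ 2 * b * G2 * B - A / 2 ≤ -ε := by
  have hgK : 0 < g * K := mul_pos hg hK
  have hgKm : 0 ≤ g * K * m := by positivity
  -- budgets
  set γ := 4 * (G1 + 2 * g * K * m) with hγ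
  have hγ0 : 0 ≤ γ := by positivity
  -- The first step size bound becomes `2 β S0 + 2 w ≤ μ`; the estimates below draw on these two
  -- shares.
  set w := β * (γ * b) with hw
  have hw0 : 0 ≤ w := by positivity
  have hsw : 2 * (β * S0) + 2 * w ≤ μ := by rw [hw]; linarith
  have hβS : 0 ≤ β * S0 := by positivity
  have hw2 : 2 * w ≤ μ := by linarith
  have hS2 : 2 * (β * S0) ≤ μ := by linarith
  -- the part of the budget due to the gradient tracking
  have hT : β * (g * K * n ^ 2) * 4 + 4 * (β * (G1 * b)) ≤ w := by
    -- Here `h4` brings in terms in `g K n ^ 2`, which the step size bound does not mention: they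
    -- are controlled by the part `8 g K m b` of `γ b`.
    have : β * (g * K) * n ^ 2 ≤ β * (g * K) * (2 * (b * m)) :=
      mul_le_mul_of_nonneg_left h4 (by positivity)
    rw [hw, hγ]; linarith
  have hGb : 0 ≤ β * (G1 * b) := by positivity
  have hTn : β * (g * K * n ^ 2) * 4 ≤ w := by linarith
  have hGw : 4 * (β * (G1 * b)) ≤ w := by
    have : 0 ≤ β * (g * K * n ^ 2) := by positivity
    linarith
  have hmb : 8 * (β * (g * K * m * b)) ≤ w := by
    rw [hw, hγ]; linarith
  have hmb0 : 0 ≤ β * (g * K * m * b) := by positivity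
  -- The constant `κ` is absent from the step size bound; `h7` trades `κ μ ^ 2` for `K n ^ 2`,
  -- already covered by `w`.
  have hκβ : 8 * (β * g * κ * μ) ≤ 1 := by
    have e1 : β * g * (κ * μ ^ 2) ≤ β * g * (K * n ^ 2) :=
      mul_le_mul_of_nonneg_left h7 (by positivity)
    have e2 : 8 * (β * g * κ * μ) * μ ≤ 1 * μ := by linarith
    exact le_of_mul_le_mul_right e2 hμ
  have hQκ : 128 * (β ^ 2 * Q * κ) ≤ 1 := by
    have e1 : β ^ 2 * κ * (8 * Q) ≤ β ^ 2 * κ * (S0 * g) :=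
      mul_le_mul_of_nonneg_left h5 (by positivity)
    have e2 : (β * g * κ) * (2 * (β * S0)) ≤ (β * g * κ) * μ :=
      mul_le_mul_of_nonneg_left hS2 (by positivity)
    linarith
  have hQ1 : 128 * (β ^ 2 * Q) ≤ 1 := by
    have : β ^ 2 * Q * 1 ≤ β ^ 2 * Q * κ := mul_le_mul_of_nonneg_left hκ (by positivity)
    linarith
  -- the weights
  set X := 5 / 2 * β ^ 2 * G1 + 8 * β ^ 2 * (g * K) + 4 * β * (n * K) / μ +
    16 * β ^ 2 * κ * (g * K * m) with hX
  have hX0 : 0 < X := by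
    have : 0 < 8 * β ^ 2 * (g * K) := by positivity
    have : 0 ≤ 4 * β * (n * K) / μ := by positivity
    have : 0 ≤ 5 / 2 * β ^ 2 * G1 := by positivity
    have : 0 ≤ 16 * β ^ 2 * κ * (g * K * m) := by positivity
    linarith
  -- Of the decrease `B / 2 = 8 X` in the estimation part, the term with `G3` takes at most `B / 4`,
  -- the feedback of `A = 2 Y` through its `B`-dependent part at most `B / 8`, and the remaining
  -- terms equal `X`. One `X` is left.
  set B := 16 * X with hB
  have hB0 : 0 < B := by positivity
  -- Each summand is twice a bound for one of the positive terms of the consensus part, the second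
  -- by `h2`; with `A = 2 * Y` half of `Y` is left.
  set Y := 8 * β ^ 2 * g * κ + β * b * B * g / μ with hY
  have hY0 : 0 < Y := by
    have : 0 < 8 * β ^ 2 * g * κ := by positivity
    have : 0 ≤ β * b * B * g / μ := by positivity
    linarith
  -- decrease of the consensus part
  have hP : 4 * β ^ 2 * g * κ + 4 * β ^ 2 * b * G2 * B - (2 * Y) / 2 ≤ -(Y / 2) := by
    have e1 : β * b * B / (2 * μ) * (β * (8 * μ * G2)) ≤ β * b * B / (2 * μ) * g :=
      mul_le_mul_of_nonneg_left h2 (by positivity)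
    have e2 : β * b * B / (2 * μ) * (β * (8 * μ * G2)) = 4 * β ^ 2 * b * G2 * B := by
      field_simp; ring
    have e3 : β * b * B / (2 * μ) * g = (β * b * B * g / μ) / 2 := by
      field_simp
    rw [e2, e3] at e1
    rw [hY]; linarith
  -- decrease of the estimation part
  have hE : 5 / 2 * β ^ 2 * G1 + 8 * β ^ 2 * g * K + 4 * β * (n * K) / μ + 2 * Y * K * m +
        4 * β ^ 2 * b * G3 * B - B / 2 ≤ -X := by
    have e1 : β * b * B / (2 * μ) * (β * (8 * μ * G3)) ≤ β * b * B / (2 * μ) * γ :=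
      mul_le_mul_of_nonneg_left h3 (by positivity)
    have e2 : β * b * B / (2 * μ) * (β * (8 * μ * G3)) = 4 * β ^ 2 * b * G3 * B := by
      field_simp; ring
    have e3 : β * b * B / (2 * μ) * γ = B * (w / (2 * μ)) := by
      rw [hw]; field_simp
    have e4 : w / (2 * μ) ≤ 1 / 4 := by
      rw [div_le_div_iff₀ (by positivity) (by norm_num)]; linarith
    have e5 : B * (w / (2 * μ)) ≤ B * (1 / 4) := mul_le_mul_of_nonneg_left e4 hB0.le
    have e6 : 2 * Y * K * m = 16 * β ^ 2 * κ * (g * K * m) + B * (2 * (β * (g * K * m * b)) / μ) := by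
      rw [hY]; field_simp; ring
    have e7 : 2 * (β * (g * K * m * b)) / μ ≤ 1 / 8 := by
      rw [div_le_div_iff₀ hμ (by norm_num)]; linarith
    have e8 : B * (2 * (β * (g * K * m * b)) / μ) ≤ B * (1 / 8) :=
      mul_le_mul_of_nonneg_left e7 hB0.le
    rw [e2, e3] at e1
    rw [e6]
    have e9 : B = 16 * X := hB
    rw [hX] at e9 ⊢
    linarith
  -- decrease of the state part
  have hU : -(2 * β * μ) + β * μ / 4 + β ^ 2 * (5 / 2 * S0 + 8 * g * K * n) +
      2 * β ^ 2 * b * Q * B ≤ -(β * μ / 64) := by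
    have e0 : β ^ 2 * (5 / 2 * S0 + 8 * g * K * n) ≤ β * (5 / 4 * μ) := by
      have f1 : β * (g * K * n * 2) * 4 ≤ w := by
        have : β * (g * K * n) * 2 ≤ β * (g * K * n) * n :=
          mul_le_mul_of_nonneg_left hn (by positivity)
        linarith
      have f2 : β * (5 / 2 * S0 + 8 * g * K * n) ≤ 5 / 4 * μ := by linarith
      calc _ = β * (β * (5 / 2 * S0 + 8 * g * K * n)) := by ring
        _ ≤ _ := mul_le_mul_of_nonneg_left f2 hβ.le
    -- By `e0` the terms without `B` sum to at most `-βμ / 2`. The four products below cost at most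
    -- 5/64, 1/64, 8/64 and 16/64 of `βμ`, so a negative multiple survives.
    have hexp : 2 * β ^ 2 * b * Q * B = 80 * (β ^ 2 * Q) * (β * (β * (G1 * b))) +
        256 * (β ^ 2 * Q) * (β ^ 2 * (g * K * b)) + 128 * β / μ * (β ^ 2 * (b * Q * (n * K))) +
        512 * (β ^ 2 * Q * κ) * (β * (β * (g * K * m * b))) := by
      rw [hB, hX]; field_simp; ring
    -- the product of the two parts of the budget
    have hprod : β ^ 2 * (b * G1 * (g * K * n ^ 2)) ≤ μ ^ 2 / 256 := by
      set p := 4 * (β * (G1 * b)) with hp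
      set q := β * (g * K * n ^ 2) * 4 with hq
      have f1 : p + q ≤ μ / 2 := by linarith
      have f2 : 0 ≤ p + q := by positivity
      have f3 : 4 * (p * q) ≤ (p + q) ^ 2 := by linarith [sq_nonneg (p - q)]
      have f4 : (p + q) ^ 2 ≤ (μ / 2) ^ 2 := pow_le_pow_left₀ f2 f1 2
      have f5 : p * q = 16 * (β ^ 2 * (b * G1 * (g * K * n ^ 2))) := by rw [hp, hq]; ring
      rw [f5] at f3
      linarith
    have e1 : 80 * (β ^ 2 * Q) * (β * (β * (G1 * b))) ≤ β * μ * (5 / 64) := by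
      have f1 : 128 * (β ^ 2 * Q) * (β * (β * (G1 * b))) ≤ 1 * (β * (β * (G1 * b))) :=
        mul_le_mul_of_nonneg_right hQ1 (by positivity)
      have f2 : β * (8 * (β * (G1 * b))) ≤ β * μ := mul_le_mul_of_nonneg_left (by linarith) hβ.le
      linarith
    have e4 : 512 * (β ^ 2 * Q * κ) * (β * (β * (g * K * m * b))) ≤ β * μ * (1 / 4) := by
      have f1 : 128 * (β ^ 2 * Q * κ) * (β * (β * (g * K * m * b))) ≤
          1 * (β * (β * (g * K * m * b))) :=
        mul_le_mul_of_nonneg_right hQκ (by positivity)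
      have f2 : β * (16 * (β * (g * K * m * b))) ≤ β * μ :=
        mul_le_mul_of_nonneg_left (by linarith) hβ.le
      linarith
    have e3 : 128 * β / μ * (β ^ 2 * (b * Q * (n * K))) ≤ β * μ * (1 / 8) := by
      have f1 : β ^ 2 * b * (n * K) * (4 * Q) ≤ β ^ 2 * b * (n * K) * (G1 * n * g) :=
        mul_le_mul_of_nonneg_left h6 (by positivity)
      have f2 : β ^ 2 * (b * Q * (n * K)) ≤ μ ^ 2 / 1024 := by linarith
      calc 128 * β / μ * (β ^ 2 * (b * Q * (n * K))) ≤ 128 * β / μ * (μ ^ 2 / 1024) :=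
            mul_le_mul_of_nonneg_left f2 (by positivity)
        _ = _ := by field_simp; norm_num
    have e2 : 256 * (β ^ 2 * Q) * (β ^ 2 * (g * K * b)) ≤ β * μ * (1 / 64) := by
      have f0 : 8 * (β * g * μ) ≤ 1 := by
        have : β * g * μ * 1 ≤ β * g * μ * κ := mul_le_mul_of_nonneg_left hκ (by positivity)
        linarith
      have f1 : β ^ 2 * (β ^ 2 * (g * K * b)) * (4 * Q) ≤
          β ^ 2 * (β ^ 2 * (g * K * b)) * (G1 * n * g) :=
        mul_le_mul_of_nonneg_left h6 (by positivity)
      have f2 : β ^ 2 * n * g * (β ^ 2 * (b * G1 * (g * K * n ^ 2))) ≤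
          β ^ 2 * n * g * (μ ^ 2 / 256) := mul_le_mul_of_nonneg_left hprod (by positivity)
      have f3 : β * μ * n * (8 * (β * g * μ)) ≤ β * μ * n * 1 :=
        mul_le_mul_of_nonneg_left f0 (by positivity)
      have f4 : 256 * (β ^ 2 * Q) * (β ^ 2 * (g * K * b)) * n ^ 2 ≤ β * μ * (n / 32) := by
        have g1 : 256 * (β ^ 2 * Q) * (β ^ 2 * (g * K * b)) * n ^ 2 =
            64 * n ^ 2 * (β ^ 2 * (β ^ 2 * (g * K * b)) * (4 * Q)) := by ring
        have g2 : 64 * n ^ 2 * (β ^ 2 * (β ^ 2 * (g * K * b)) * (4 * Q)) ≤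
            64 * n ^ 2 * (β ^ 2 * (β ^ 2 * (g * K * b)) * (G1 * n * g)) :=
          mul_le_mul_of_nonneg_left f1 (by positivity)
        have g3 : 64 * n ^ 2 * (β ^ 2 * (β ^ 2 * (g * K * b)) * (G1 * n * g)) =
            64 * (β ^ 2 * n * g * (β ^ 2 * (b * G1 * (g * K * n ^ 2)))) := by ring
        rw [g1]
        linarith
      have f5 : β * μ * (n / 32) ≤ β * μ * (1 / 64) * n ^ 2 := by
        have : β * μ * n * 2 ≤ β * μ * n * n := mul_le_mul_of_nonneg_left hn (by positivity)
        linarith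
      exact le_of_mul_le_mul_right (f4.trans f5) (by positivity)
    rw [hexp]
    linarith [mul_pos hβ hμ]
  refine ⟨2 * Y, B, min (β * μ / 64) (min X (Y / 2)), by positivity, hB0, by positivity,
    hU.trans ?_, hE.trans ?_, hP.trans ?_⟩
  · exact neg_le_neg (min_le_left _ _)
  · exact neg_le_neg ((min_le_right _ _).trans (min_le_left _ _))
  · exact neg_le_neg ((min_le_right _ _).trans (min_le_right _ _))

/-- A Lyapunov function that decreases by a fixed fraction of a quantity controlling it forces
geometric decay. -/
lemma le_geometric_of_lyapunov {V S U : ℕ → ℝ} {ε c : ℝ} (hε : 0 < ε) (hc : 0 ≤ c)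
    (hS : ∀ k, 0 ≤ S k) (hV : ∀ k, 0 ≤ V k) (hUS : ∀ k, U k ≤ S k) (hVS : ∀ k, V k ≤ c * S k)
    (hstep : ∀ k, V (k + 1) ≤ V k - ε * S k) (k : ℕ) :
    U k ≤ V 0 / ε * (1 - ε / (c + 2 * ε)) ^ k := by
  -- The summand `2 * ε` keeps the relative decrease at most 1/2, so the ratio stays positive even
  -- for `c = 0`.
  have hr : 0 < c + 2 * ε := by positivity
  have hr1 : 0 ≤ 1 - ε / (c + 2 * ε) := by
    rw [sub_nonneg, div_le_one hr]; linarith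
  have hVk : ∀ k, V k ≤ V 0 * (1 - ε / (c + 2 * ε)) ^ k := by
    intro k
    induction k with
    | zero => simp
    | succ k ih =>
      have h1 : V k ≤ (c + 2 * ε) * S k := by
        have := mul_nonneg hε.le (hS k)
        linarith [hVS k]
      have h2 : ε / (c + 2 * ε) * V k ≤ ε / (c + 2 * ε) * ((c + 2 * ε) * S k) :=
        mul_le_mul_of_nonneg_left h1 (by positivity)
      have h3 : ε / (c + 2 * ε) * ((c + 2 * ε) * S k) = ε * S k := by field_simp
      calc V (k + 1) ≤ V k * (1 - ε / (c + 2 * ε)) := by linarith [hstep k]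
        _ ≤ V 0 * (1 - ε / (c + 2 * ε)) ^ k * (1 - ε / (c + 2 * ε)) :=
          mul_le_mul_of_nonneg_right ih hr1
        _ = _ := by rw [pow_succ, mul_assoc]
  -- No lower bound of `V` in terms of `U` is needed: the decrease over the next step cannot exceed
  -- `V k`.
  have h4 : ε * U k ≤ V k := by
    have := mul_le_mul_of_nonneg_left (hUS k) hε.le
    linarith [hstep k, hV (k + 1)]
  rw [div_mul_eq_mul_div, le_div_iff₀ hε, mul_comm]
  exact h4.trans (hVk k)

/-! ### The sequences produced by the algorithm, coalition by coalition -/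

/-- The family of columns `w` as one vector indexed by pairs (row, column). -/
def pairUp {m : ℕ} (w : Fin m → Fin m → ℝ) : Fin m × Fin m → ℝ := fun q => w q.2 q.1

lemma nsq_pairUp {m : ℕ} (w : Fin m → Fin m → ℝ) : nsq (pairUp w) = ∑ c, nsq (w c) := by
  simp_rw [nsq_eq_sum]
  rw [Fintype.sum_prod_type, Finset.sum_comm]
  rfl

section sequences

variable {N : ℕ} {n : Fin N → ℕ}

/-- The vector of the partial derivatives with respect to `x_{ic}` of the objectives of the
members of coalition `i`, each taken at the estimate of that member. -/
def gradCol (f : Agent n → State n → ℝ) (y : Agent n → State n) (i : Fin N) (c : Fin (n i)) :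
    Fin (n i) → ℝ :=
  fun j => block (gradient (f ⟨i, j⟩) (y ⟨i, j⟩)) i c

/-- The sum of the gradients of the members of coalition `i` at their own estimates. -/
def gradSum (f : Agent n → State n → ℝ) (y : Agent n → State n) (i : Fin N) : Fin (n i) → ℝ :=
  ∑ j, block (gradient (f ⟨i, j⟩) (y ⟨i, j⟩)) i

/-- The column of the estimates of the derivative with respect to `x_{ic}`. -/
def psiCol (ψ : (i : Fin N) → Fin (n i) → Fin (n i) → ℝ) (i : Fin N) (c : Fin (n i)) :
    Fin (n i) → ℝ := fun j => ψ i j c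

/-- The disagreement of the estimates `psiCol`. -/
def psiDev (ψ : (i : Fin N) → Fin (n i) → Fin (n i) → ℝ) (i : Fin N) (c : Fin (n i)) :
    Fin (n i) → ℝ := (1 - averaging (n i)) *ᵥ psiCol ψ i c

/-- The error of the estimates of the collective state. -/
def estError (x : State n) (ξ : Agent n → State n) : Agent n × Agent n → ℝ :=
  fun p => ξ p.1 p.2 - x p.2

/-- The preimage under `1 - (C_i - averaging)` of the tracking error relative to the gradients at
`y`. -/
def trackSol (f : Agent n → State n → ℝ) (y : State n)
    (C : (i : Fin N) → Matrix (Fin (n i)) (Fin (n i)) ℝ)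
    (ψ : (i : Fin N) → Fin (n i) → Fin (n i) → ℝ) (ξ : Agent n → State n)
    (i : Fin N) (c : Fin (n i)) : Fin (n i) → ℝ :=
  (1 - (C i - averaging (n i)))⁻¹ *ᵥ ((1 - averaging (n i)) *ᵥ
    (psiCol ψ i c - (gradCol f ξ i c - gradCol f (fun _ => y) i c)))

/-- Regrouped by agents instead of by columns, the sum consists of blocks of gradient differences,
so each Lipschitz constant is used once. -/
lemma sum_nsq_gradCol_sub_le {f : Agent n → State n → ℝ} {l : Agent n → ℝ≥0}
    (hlip : ∀ a, LipschitzWith (l a) (gradient (f a))) (y z : Agent n → State n) (i : Fin N) :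
    ∑ c, nsq (gradCol f y i c - gradCol f z i c) ≤
      ∑ j, (l ⟨i, j⟩ : ℝ) ^ 2 * ‖y ⟨i, j⟩ - z ⟨i, j⟩‖ ^ 2 := by
  have h : ∑ c, nsq (gradCol f y i c - gradCol f z i c) = ∑ j, nsq
      (block (gradient (f ⟨i, j⟩) (y ⟨i, j⟩)) i - block (gradient (f ⟨i, j⟩) (z ⟨i, j⟩)) i) := by
    simp_rw [nsq_eq_sum]
    rw [Finset.sum_comm]
    rfl
  rw [h]
  refine Finset.sum_le_sum fun j _ => ?_
  rw [← mul_pow]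
  exact nsq_block_gradient_sub_le hlip ⟨i, j⟩ i _ _

lemma sum_gradCol (f : Agent n → State n → ℝ) (y : Agent n → State n) (i : Fin N)
    (c : Fin (n i)) : ∑ j, gradCol f y i c j = gradSum f y i c := by
  simp [gradCol, gradSum]

lemma nsq_estError (x : State n) (ξ : Agent n → State n) :
    nsq (estError x ξ) = ∑ a, ‖ξ a - x‖ ^ 2 := by
  rw [nsq_eq_sum, Fintype.sum_prod_type]
  refine Finset.sum_congr rfl fun a _ => ?_
  rw [EuclideanSpace.norm_sq_eq]
  simp [estError]

lemma lap_mulVec_of_const {G : SimpleGraph (Agent n)} {i : Fin N} {v : Fin (n i) → ℝ}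
    (hv : ∀ j k, v j = v k) : lap G i *ᵥ v = 0 := by
  ext j
  rw [lap_mulVec_apply]
  exact Finset.sum_eq_zero fun k _ => by rw [hv j k, sub_self]

variable {f : Agent n → State n → ℝ} {R : Agent n → ℝ} {G : SimpleGraph (Agent n)}
  {W : Matrix (Agent n) (Agent n) ℝ} {C : (i : Fin N) → Matrix (Fin (n i)) (Fin (n i)) ℝ}
  {β : ℝ} {x : ℕ → State n} {η : ℕ → Agent n → ℝ}
  {ψ : ℕ → (i : Fin N) → Fin (n i) → Fin (n i) → ℝ} {ξ : ℕ → Agent n → State n}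

namespace IsTrajectory

lemma block_x (h : IsTrajectory f R G W C β x η ψ ξ) (k : ℕ) (i : Fin N) :
    block (x k) i = (fun j => R ⟨i, j⟩) - lap G i *ᵥ fun j => η k ⟨i, j⟩ := by
  ext j
  rw [Pi.sub_apply, lap_mulVec_apply, ← h.x_init, ← h.x_eq]
  rfl

lemma meetsResource (h : IsTrajectory f R G W C β x η ψ ξ) (k : ℕ) (i : Fin N) :
    MeetsResource R i (x k) := by
  have h1 : ∑ j, block (x k) i j = ∑ j, R ⟨i, j⟩ := by
    rw [h.block_x]
    simp only [Pi.sub_apply, Finset.sum_sub_distrib, sum_lap_mulVec, sub_zero]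
  exact h1

lemma eta_succ (h : IsTrajectory f R G W C β x η ψ ξ) (k : ℕ) (i : Fin N) :
    (fun j => η (k + 1) ⟨i, j⟩) =
      (fun j => η k ⟨i, j⟩) + β • (lapRows G i *ᵥ pairUp (psiCol (ψ k) i)) := by
  ext j
  have h1 : (lapRows G i *ᵥ pairUp (psiCol (ψ k) i)) j = (lap G i *ᵥ fun c => ψ k i j c) j := by
    rw [lapRows_mulVec_apply]; rfl
  rw [Pi.add_apply, Pi.smul_apply, h1, lap_mulVec_apply, h.η_step, smul_eq_mul]

lemma psiCol_succ (h : IsTrajectory f R G W C β x η ψ ξ) (k : ℕ) (i : Fin N) (c : Fin (n i)) :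
    psiCol (ψ (k + 1)) i c =
      C i *ᵥ psiCol (ψ k) i c + (gradCol f (ξ (k + 1)) i c - gradCol f (ξ k) i c) := by
  ext j
  change ψ (k + 1) i j c = _
  rw [h.ψ_step, add_sub_assoc]
  rfl

/-- This is the invariant of gradient tracking: mixing preserves the sum over the members, and the
added increments telescope from the initial condition. -/
lemma sum_psiCol (h : IsTrajectory f R G W C β x η ψ ξ)
    (hC : ∀ i, C i ∈ doublyStochastic ℝ (Fin (n i))) (k : ℕ) (i : Fin N) (c : Fin (n i)) :
    ∑ j, psiCol (ψ k) i c j = gradSum f (ξ k) i c := by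
  induction k with
  | zero =>
    rw [← sum_gradCol]
    exact Finset.sum_congr rfl fun j _ => h.ψ_init i j c
  | succ k ih =>
    have h1 : ∑ j, (C i *ᵥ psiCol (ψ k) i c) j = ∑ j, psiCol (ψ k) i c j := by
      simp only [mulVec, dotProduct]
      rw [Finset.sum_comm]
      simp only [← Finset.sum_mul, sum_col_of_mem_doublyStochastic (hC i), one_mul]
    rw [h.psiCol_succ]
    simp only [Pi.add_apply, Pi.sub_apply, Finset.sum_add_distrib, Finset.sum_sub_distrib, h1, ih,
      sum_gradCol]
    ring

lemma psiDev_succ (h : IsTrajectory f R G W C β x η ψ ξ)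
    (hC : ∀ i, C i ∈ doublyStochastic ℝ (Fin (n i))) (k : ℕ) (i : Fin N) (c : Fin (n i)) :
    psiDev (ψ (k + 1)) i c = (C i - averaging (n i)) *ᵥ psiDev (ψ k) i c +
      (1 - averaging (n i)) *ᵥ (gradCol f (ξ (k + 1)) i c - gradCol f (ξ k) i c) := by
  unfold psiDev
  rw [h.psiCol_succ, mulVec_add, centre_mulVec_mixing (hC i)]

-- The row deficit of the estimation matrix equals the weight on the true state, so exact estimates
-- are stationary and the increment is linear in the error alone.
open scoped Classical in
lemma estimate_succ_sub (h : IsTrajectory f R G W C β x η ψ ξ) (hW : IsWeightMatrix G W)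
    (k : ℕ) (a c : Agent n) :
    ξ (k + 1) a c - ξ k a c = -(((1 - estimationMatrix W) *ᵥ estError (x k) (ξ k)) (a, c)) := by
  have h1 : ∀ v : Agent n → ℝ, ∑ d ∈ G.neighborFinset a, W a d * v d = ∑ d, W a d * v d := by
    intro v
    refine Finset.sum_subset (Finset.subset_univ _) fun d _ hd => ?_
    rw [hW.eq_zero a d (fun hadj => hd (by simpa using hadj)), zero_mul]
  have h2 := h.ξ_step k a c
  rw [h1 fun d => ξ k d c] at h2
  rw [sub_mulVec, one_mulVec, Pi.sub_apply, estimationMatrix_mulVec_apply, h2]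
  simp only [estError, mul_sub, Finset.sum_sub_distrib, ← Finset.sum_mul]
  have h3 := sum_add_selfWeight W a c
  have h4 : (∑ d, W a d) = 1 - W a c - selfWeight W a c := by linarith
  rw [h4]; ring

lemma estError_succ (h : IsTrajectory f R G W C β x η ψ ξ) (hW : IsWeightMatrix G W) (k : ℕ) :
    estError (x (k + 1)) (ξ (k + 1)) = estimationMatrix W *ᵥ estError (x k) (ξ k) +
      (1 : Matrix (Agent n × Agent n) (Agent n × Agent n) ℝ) *ᵥ
        fun p => x k p.2 - x (k + 1) p.2 := by
  ext ⟨a, c⟩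
  have h1 := h.estimate_succ_sub hW k a c
  rw [sub_mulVec, one_mulVec, Pi.sub_apply] at h1
  rw [one_mulVec, Pi.add_apply]
  simp only [estError] at h1 ⊢
  linarith

lemma sum_norm_estimate_succ_sub_le (h : IsTrajectory f R G W C β x η ψ ξ)
    (hW : IsWeightMatrix G W) (k : ℕ) :
    ∑ a, ‖ξ (k + 1) a - ξ k a‖ ^ 2 ≤
      specNorm (1 - estimationMatrix W) ^ 2 * nsq (estError (x k) (ξ k)) := by
  refine le_trans (le_of_eq ?_) (nsq_mulVec_le _ _)
  rw [nsq_eq_sum, Fintype.sum_prod_type]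
  refine Finset.sum_congr rfl fun a _ => ?_
  rw [EuclideanSpace.norm_sq_eq]
  refine Finset.sum_congr rfl fun c _ => ?_
  rw [Real.norm_eq_abs, sq_abs, PiLp.sub_apply, h.estimate_succ_sub hW, neg_sq]

section track

variable {Wc : (i : Fin N) → Matrix (Fin (n i)) (Fin (n i)) ℝ} (y : State n)

lemma _root_.DRA.one_sub_mulVec_trackSol
    (hWc : ∀ i, IsLyapunovSolution (C i - averaging (n i)) (Wc i))
    (ψ : (i : Fin N) → Fin (n i) → Fin (n i) → ℝ) (ξ : Agent n → State n) (i : Fin N)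
    (c : Fin (n i)) :
    (1 - (C i - averaging (n i))) *ᵥ trackSol f y C ψ ξ i c = psiDev ψ i c -
      (1 - averaging (n i)) *ᵥ (gradCol f ξ i c - gradCol f (fun _ => y) i c) := by
  have hu := (Matrix.isUnit_iff_isUnit_det _).1 (hWc i).isUnit_one_sub
  unfold trackSol psiDev
  rw [mulVec_mulVec, mul_nonsing_inv _ hu, one_mulVec, mulVec_sub]

/-- With `A` the deviation matrix, the disagreement minus the centred gradient deviation from `y`
changes by `-(1 - A) psiDev`: the gradient increments cancel. Applying the inverse of `1 - A` makes
the increment exactly `-psiDev`. The reference gradients at `y` do not affect this, but they make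
the solution small near the equilibrium. -/
lemma trackSol_succ (h : IsTrajectory f R G W C β x η ψ ξ)
    (hC : ∀ i, C i ∈ doublyStochastic ℝ (Fin (n i)))
    (hWc : ∀ i, IsLyapunovSolution (C i - averaging (n i)) (Wc i)) (k : ℕ) (i : Fin N)
    (c : Fin (n i)) :
    trackSol f y C (ψ (k + 1)) (ξ (k + 1)) i c =
      trackSol f y C (ψ k) (ξ k) i c - psiDev (ψ k) i c := by
  have hinj := mulVec_injective_iff_isUnit.2 (hWc i).isUnit_one_sub
  apply hinj
  rw [mulVec_sub, one_sub_mulVec_trackSol y hWc, one_sub_mulVec_trackSol y hWc,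
    h.psiDev_succ hC, sub_mulVec 1 (C i - averaging (n i)), one_mulVec]
  have h1 : gradCol f (ξ (k + 1)) i c - gradCol f (fun _ => y) i c =
      (gradCol f (ξ (k + 1)) i c - gradCol f (ξ k) i c) +
        (gradCol f (ξ k) i c - gradCol f (fun _ => y) i c) := by abel
  rw [h1, mulVec_add]
  abel

/-- The right-hand side `d` is centred, so it may be written as `(1 - averaging) d`, and the
resolvent bound applies with the constant `mixingConst`. The factor 4 combines the 2 of that bound
with the 2 from splitting `d`. -/
lemma _root_.DRA.nsq_trackSol_le
    (hWc : ∀ i, IsLyapunovSolution (C i - averaging (n i)) (Wc i))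
    (ψ : (i : Fin N) → Fin (n i) → Fin (n i) → ℝ) (ξ : Agent n → State n) (i : Fin N)
    (c : Fin (n i)) :
    nsq (trackSol f y C ψ ξ i c) ≤ 4 * mixingConst (C i) (Wc i) *
      (nsq (psiDev ψ i c) + nsq (gradCol f ξ i c - gradCol f (fun _ => y) i c)) := by
  have h1 := one_sub_mulVec_trackSol (f := f) y hWc ψ ξ i c
  set d := psiDev ψ i c -
      (1 - averaging (n i)) *ᵥ (gradCol f ξ i c - gradCol f (fun _ => y) i c) with hd
  have hdc : (1 - averaging (n i)) *ᵥ d = d := by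
    apply centre_mulVec_of_sum_eq_zero
    simp only [hd, psiDev, Pi.sub_apply, Finset.sum_sub_distrib, sum_centre_mulVec, sub_zero]
  rw [sub_mulVec, one_mulVec, ← hdc] at h1
  have h2 := (hWc i).nsq_le (1 - averaging (n i)) h1
  have h3 : nsq d ≤ 2 * nsq (psiDev ψ i c) +
      2 * nsq (gradCol f ξ i c - gradCol f (fun _ => y) i c) := by
    have := nsq_centre_le (gradCol f ξ i c - gradCol f (fun _ => y) i c)
    have := nsq_sub_le (psiDev ψ i c)
      ((1 - averaging (n i)) *ᵥ (gradCol f ξ i c - gradCol f (fun _ => y) i c))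
    linarith
  have h4 := mixingConst_nonneg (C i) (Wc i)
  have h5 := mul_le_mul_of_nonneg_left h3 h4
  change nsq _ ≤ 2 * mixingConst (C i) (Wc i) * nsq d at h2
  linarith

end track

/-- The rows of the Laplacian matrix see the mean of the estimates through the sum of the
gradients. -/
lemma lapRows_mulVec_pairUp_psiCol (h : IsTrajectory f R G W C β x η ψ ξ)
    (hC : ∀ i, C i ∈ doublyStochastic ℝ (Fin (n i))) (k : ℕ) (i : Fin N) :
    lapRows G i *ᵥ pairUp (psiCol (ψ k) i) =
      (1 / (n i : ℝ)) • (lap G i *ᵥ gradSum f (ξ k) i) +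
        lapRows G i *ᵥ pairUp (psiDev (ψ k) i) := by
  have h1 : pairUp (psiCol (ψ k) i) =
      (fun q => ((1 / (n i : ℝ)) • gradSum f (ξ k) i) q.2) + pairUp (psiDev (ψ k) i) := by
    ext ⟨j, c⟩
    simp only [pairUp, psiDev, Pi.add_apply, sub_mulVec, one_mulVec, Pi.sub_apply,
      averaging_mulVec, h.sum_psiCol hC, Pi.smul_apply, smul_eq_mul]
    ring
  rw [h1, mulVec_add, lapRows_mulVec_snd, mulVec_smul]

lemma block_x_succ_sub (h : IsTrajectory f R G W C β x η ψ ξ)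
    (hC : ∀ i, C i ∈ doublyStochastic ℝ (Fin (n i))) (k : ℕ) (i : Fin N) :
    block (x (k + 1)) i - block (x k) i =
      -(β • ((1 / (n i : ℝ)) • (lap G i *ᵥ (lap G i *ᵥ gradSum f (ξ k) i)) +
        (lap G i * lapRows G i) *ᵥ pairUp (psiDev (ψ k) i))) := by
  rw [h.block_x, h.block_x, h.eta_succ, mulVec_add, mulVec_smul,
    h.lapRows_mulVec_pairUp_psiCol hC, mulVec_add, mulVec_smul, mulVec_mulVec _ (lap G i) (lapRows G i)]
  abel

end IsTrajectory

/-- The state of coalition `i` in coordinates in which the dynamics is driven by the sum of the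
gradients of its members alone. -/
def drivenState (G : SimpleGraph (Agent n)) (f : Agent n → State n → ℝ) (y : State n)
    (C : (i : Fin N) → Matrix (Fin (n i)) (Fin (n i)) ℝ) (β : ℝ) (i : Fin N)
    (η₀ : Fin (n i) → ℝ) (η : Agent n → ℝ) (ψ : (i : Fin N) → Fin (n i) → Fin (n i) → ℝ)
    (ξ : Agent n → State n) : Fin (n i) → ℝ :=
  (1 - averaging (n i)) *ᵥ ((fun j => η ⟨i, j⟩) - η₀ +
    β • (lapRows G i *ᵥ pairUp (trackSol f y C ψ ξ i)))

/-- The increment of `η` contains `β` times `lapRows` applied to the disagreement, and the increment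
of `trackSol` cancels precisely this term. -/
lemma IsTrajectory.drivenState_succ {Wc : (i : Fin N) → Matrix (Fin (n i)) (Fin (n i)) ℝ}
    (y : State n) (h : IsTrajectory f R G W C β x η ψ ξ)
    (hC : ∀ i, C i ∈ doublyStochastic ℝ (Fin (n i)))
    (hWc : ∀ i, IsLyapunovSolution (C i - averaging (n i)) (Wc i)) (k : ℕ) (i : Fin N)
    (η₀ : Fin (n i) → ℝ) :
    drivenState G f y C β i η₀ (η (k + 1)) (ψ (k + 1)) (ξ (k + 1)) =
      drivenState G f y C β i η₀ (η k) (ψ k) (ξ k) +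
        (β / (n i : ℝ)) • (lap G i *ᵥ gradSum f (ξ k) i) := by
  have h1 : pairUp (trackSol f y C (ψ (k + 1)) (ξ (k + 1)) i) =
      pairUp (trackSol f y C (ψ k) (ξ k) i) - pairUp (psiDev (ψ k) i) := by
    ext ⟨j, c⟩
    simp only [pairUp, Pi.sub_apply, h.trackSol_succ y hC hWc]
  have h2 : (β / (n i : ℝ)) • (lap G i *ᵥ gradSum f (ξ k) i) =
      (1 - averaging (n i)) *ᵥ ((β / (n i : ℝ)) • (lap G i *ᵥ gradSum f (ξ k) i)) := by
    rw [mulVec_smul, centre_mulVec_of_sum_eq_zero (sum_lap_mulVec G i _)]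
  unfold drivenState
  rw [h2, ← mulVec_add, h.eta_succ, h.lapRows_mulVec_pairUp_psiCol hC, h1, mulVec_sub, smul_add,
    smul_sub, smul_smul, mul_one_div]
  congr 1
  abel

lemma IsTrajectory.lap_mulVec_drivenState (y : State n) (h : IsTrajectory f R G W C β x η ψ ξ)
    (k : ℕ) (i : Fin N) {η₀ : Fin (n i) → ℝ}
    (hη₀ : block y i = (fun j => R ⟨i, j⟩) - lap G i *ᵥ η₀) :
    lap G i *ᵥ drivenState G f y C β i η₀ (η k) (ψ k) (ξ k) =
      -(block (x k) i - block y i) +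
        β • (lap G i *ᵥ (lapRows G i *ᵥ pairUp (trackSol f y C (ψ k) (ξ k) i))) := by
  unfold drivenState
  rw [lap_mulVec_centre, mulVec_add, mulVec_sub, mulVec_smul, h.block_x, hη₀]
  congr 1
  abel

end sequences

/-! ### Decrease of the Lyapunov function along the algorithm -/

section drift

variable {N : ℕ} {n : Fin N → ℕ} {G : SimpleGraph (Agent n)} {i : Fin N}

/-- Symmetry of the Laplacian moves it from the forcing onto `z`, where it produces the state error
`-u`. This turns the increment into the inner product to which strong monotonicity applies. -/
lemma nsq_drift_le (hi : 1 ≤ n i) {β : ℝ} {z z' u F D τ : Fin (n i) → ℝ}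
    (hz' : z' = z + (β / (n i : ℝ)) • (lap G i *ᵥ (F + D)))
    (hz : lap G i *ᵥ z = -u + β • (lap G i *ᵥ τ)) :
    n i * nsq z' ≤ n i * nsq z - 2 * β * (u ⬝ᵥ F) - 2 * β * (u ⬝ᵥ D) +
      β ^ 2 * (4 * (n i * nsq τ) + 5 / 4 * (1 / n i * nsq (lap G i *ᵥ (F + D)))) := by
  have hn : (0 : ℝ) < n i := by exact_mod_cast hi
  set q := lap G i *ᵥ (F + D) with hq
  have h1 : z ⬝ᵥ q = -(u ⬝ᵥ F) - u ⬝ᵥ D + β * (τ ⬝ᵥ q) := by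
    rw [hq, dotProduct_lap_mulVec, hz, add_dotProduct, neg_dotProduct, smul_dotProduct,
      dotProduct_add, ← dotProduct_lap_mulVec, smul_eq_mul]
    ring
  -- The weight `4 * n i` matches the factor `1 / n i` of the quadratic term, giving 1 + 1/4 = 5/4
  -- in total.
  have h2 := two_mul_dotProduct_le τ q (t := 4 * n i) (by positivity)
  have h3 : n i * nsq z' = n i * nsq z + 2 * β * (z ⬝ᵥ q) + β ^ 2 * (1 / n i * nsq q) := by
    rw [hz', nsq_add, dotProduct_smul, nsq_smul, smul_eq_mul]
    field_simp
  have h4 : nsq q / (4 * n i) = 1 / 4 * (1 / n i * nsq q) := by field_simp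
  rw [h3, h1]
  rw [h4] at h2
  have h5 := mul_le_mul_of_nonneg_left h2 (sq_nonneg β)
  linarith

lemma nsq_lap_mulVec_add_le (F D : Fin (n i) → ℝ) :
    nsq (lap G i *ᵥ (F + D)) ≤ specNorm (lap G i) ^ 2 * (2 * nsq F + 2 * nsq D) :=
  (nsq_mulVec_le _ _).trans (mul_le_mul_of_nonneg_left (nsq_add_le _ _) (sq_nonneg _))

lemma nsq_inv_smul_lap_lap_le (F : Fin (n i) → ℝ) :
    nsq ((1 / (n i : ℝ)) • (lap G i *ᵥ (lap G i *ᵥ F))) ≤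
      specNorm (lap G i) ^ 4 / (n i : ℝ) ^ 2 * nsq F := by
  rw [nsq_smul]
  have h1 := nsq_mulVec_le (lap G i) (lap G i *ᵥ F)
  have h2 := mul_le_mul_of_nonneg_left (nsq_mulVec_le (lap G i) F)
    (sq_nonneg (specNorm (lap G i)))
  have h3 := mul_le_mul_of_nonneg_left (h1.trans h2) (sq_nonneg (1 / (n i : ℝ)))
  refine h3.trans_eq ?_
  ring

end drift

section bounds

variable {N : ℕ} {n : Fin N → ℕ} {f : Agent n → State n → ℝ} {R : Agent n → ℝ}
  {l : Agent n → ℝ≥0} {G : SimpleGraph (Agent n)}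
  {W : Matrix (Agent n) (Agent n) ℝ} {C Wc : (i : Fin N) → Matrix (Fin (n i)) (Fin (n i)) ℝ}
  {β : ℝ} {x : ℕ → State n} {η : ℕ → Agent n → ℝ}
  {ψ : ℕ → (i : Fin N) → Fin (n i) → Fin (n i) → ℝ} {ξ : ℕ → Agent n → State n}

/-- The total squared disagreement of the gradient estimates. -/
def psiEnergy (ψ : (i : Fin N) → Fin (n i) → Fin (n i) → ℝ) : ℝ :=
  ∑ i, ∑ c, nsq (psiDev ψ i c)

/-- The total squared estimation error of the members of coalition `i`. -/
def estEnergy (x : State n) (ξ : Agent n → State n) (i : Fin N) : ℝ :=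
  ∑ j, ‖ξ ⟨i, j⟩ - x‖ ^ 2

lemma estEnergy_nonneg (x : State n) (ξ : Agent n → State n) (i : Fin N) :
    0 ≤ estEnergy x ξ i := Finset.sum_nonneg fun _ _ => sq_nonneg _

lemma psiEnergy_nonneg (ψ : (i : Fin N) → Fin (n i) → Fin (n i) → ℝ) : 0 ≤ psiEnergy ψ :=
  Finset.sum_nonneg fun _ _ => Finset.sum_nonneg fun _ _ => nsq_nonneg _

lemma sum_estEnergy (x : State n) (ξ : Agent n → State n) :
    ∑ i, estEnergy x ξ i = nsq (estError x ξ) := by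
  rw [nsq_estError, Fintype.sum_sigma]; rfl

lemma nsq_gradSum_sub_le (hdiff : ∀ a, ContDiff ℝ 1 (f a))
    (hlip : ∀ a, LipschitzWith (l a) (gradient (f a))) (x : State n) (ξ : Agent n → State n)
    (i : Fin N) : nsq (gradSum f ξ i - block (pseudoGradient f x) i) ≤
      coalitionLipSq l i * estEnergy x ξ i := by
  rw [block_pseudoGradient hdiff, gradSum, ← Finset.sum_sub_distrib]
  refine (nsq_block_sum_gradient_sub_le hlip i (fun j => ξ ⟨i, j⟩) (fun _ => x)).trans ?_
  exact Finset.sum_mul_sq_le_sq_mul_sq _ _ _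

lemma sum_nsq_lapRows_trackSol_le (hlip : ∀ a, LipschitzWith (l a) (gradient (f a)))
    (hWc : ∀ i, IsLyapunovSolution (C i - averaging (n i)) (Wc i)) {g κ K : ℝ} (hg0 : 0 ≤ g)
    (hg : ∀ i, 4 * (n i * specNorm (lapRows G i) ^ 2) ≤ g)
    (hκ : ∀ i, mixingConst (C i) (Wc i) ≤ κ)
    (hK : ∀ a : Agent n, mixingConst (C a.1) (Wc a.1) * (l a : ℝ) ^ 2 ≤ K)
    (x y : State n) (ψ : (i : Fin N) → Fin (n i) → Fin (n i) → ℝ) (ξ : Agent n → State n) :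
    ∑ i, (n i : ℝ) * nsq (lapRows G i *ᵥ pairUp (trackSol f y C ψ ξ i)) ≤
      g * (κ * psiEnergy ψ + 2 * K * (nsq (estError x ξ) +
        ((∑ i, n i : ℕ) : ℝ) * ‖x - y‖ ^ 2)) := by
  have h1 : ∀ i, (n i : ℝ) * nsq (lapRows G i *ᵥ pairUp (trackSol f y C ψ ξ i)) ≤
      g * (κ * (∑ c, nsq (psiDev ψ i c)) +
        2 * K * (estEnergy x ξ i + n i * ‖x - y‖ ^ 2)) := by
    intro i
    set P := ∑ c, nsq (psiDev ψ i c)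
    have hP : 0 ≤ P := Finset.sum_nonneg fun _ _ => nsq_nonneg _
    have h2 : nsq (pairUp (trackSol f y C ψ ξ i)) ≤
        4 * (κ * P + 2 * K * (estEnergy x ξ i + n i * ‖x - y‖ ^ 2)) := by
      rw [nsq_pairUp]
      calc ∑ c, nsq (trackSol f y C ψ ξ i c)
          ≤ ∑ c, 4 * mixingConst (C i) (Wc i) * (nsq (psiDev ψ i c) +
              nsq (gradCol f ξ i c - gradCol f (fun _ => y) i c)) :=
            Finset.sum_le_sum fun c _ => nsq_trackSol_le y hWc ψ ξ i c
        _ = 4 * (mixingConst (C i) (Wc i) * P + mixingConst (C i) (Wc i) *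
              ∑ c, nsq (gradCol f ξ i c - gradCol f (fun _ => y) i c)) := by
            rw [← Finset.mul_sum, Finset.sum_add_distrib]; ring
        _ ≤ 4 * (κ * P + ∑ j, K * (2 * ‖ξ ⟨i, j⟩ - x‖ ^ 2 + 2 * ‖x - y‖ ^ 2)) := by
            have h3 := mul_le_mul_of_nonneg_left (sum_nsq_gradCol_sub_le hlip ξ (fun _ => y) i)
              (mixingConst_nonneg (C i) (Wc i))
            have h4 : mixingConst (C i) (Wc i) *
                ∑ j, (l ⟨i, j⟩ : ℝ) ^ 2 * ‖ξ ⟨i, j⟩ - y‖ ^ 2 ≤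
                ∑ j, K * (2 * ‖ξ ⟨i, j⟩ - x‖ ^ 2 + 2 * ‖x - y‖ ^ 2) := by
              rw [Finset.mul_sum]
              refine Finset.sum_le_sum fun j _ => ?_
              rw [← mul_assoc]
              refine mul_le_mul (hK ⟨i, j⟩) ?_ (sq_nonneg _)
                ((mul_nonneg (mixingConst_nonneg _ _) (sq_nonneg _)).trans (hK ⟨i, j⟩))
              have h5 := norm_add_le (ξ ⟨i, j⟩ - x) (x - y)
              rw [sub_add_sub_cancel] at h5
              have h6 := pow_le_pow_left₀ (norm_nonneg _) h5 2
              nlinarith [sq_nonneg (‖ξ ⟨i, j⟩ - x‖ - ‖x - y‖)]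
            have h5 := mul_le_mul_of_nonneg_right (hκ i) hP
            linarith
        _ = _ := by
            rw [← Finset.mul_sum, Finset.sum_add_distrib, ← Finset.mul_sum, Finset.sum_const,
              Finset.card_univ, Fintype.card_fin, nsmul_eq_mul, estEnergy]
            ring
    have h3 := nsq_mulVec_le (lapRows G i) (pairUp (trackSol f y C ψ ξ i))
    have h4 := mul_le_mul_of_nonneg_left h3 (Nat.cast_nonneg (α := ℝ) (n i))
    have h5 := mul_le_mul_of_nonneg_right (hg i) (nsq_nonneg (pairUp (trackSol f y C ψ ξ i)))
    have h6 := mul_le_mul_of_nonneg_left h2 hg0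
    linarith
  refine (Finset.sum_le_sum fun i _ => h1 i).trans_eq ?_
  rw [← Finset.mul_sum, Finset.sum_add_distrib, ← Finset.mul_sum, ← Finset.mul_sum,
    Finset.sum_add_distrib, sum_estEnergy, ← Finset.sum_mul, psiEnergy]
  push_cast
  rfl

/-- The pseudo-gradient difference of one coalition depends on the whole state, so its constants are
summed over the coalitions. The estimation part only sees the error energy of that coalition, so a
maximum suffices. -/
lemma sum_nsq_lap_forcing_le (hdiff : ∀ a, ContDiff ℝ 1 (f a))
    (hlip : ∀ a, LipschitzWith (l a) (gradient (f a))) {G1 : ℝ}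
    (hG1 : ∀ i, 1 / (n i : ℝ) * coalitionLipSq l i * specNorm (lap G i) ^ 2 ≤ G1)
    (x y : State n) (ξ : Agent n → State n) :
    ∑ i, 1 / (n i : ℝ) * nsq (lap G i *ᵥ
      ((block (pseudoGradient f x) i - block (pseudoGradient f y) i) +
        (gradSum f ξ i - block (pseudoGradient f x) i))) ≤
      2 * (∑ i, coalitionLip l i ^ 2 * specNorm (lap G i) ^ 2 / (n i : ℝ)) * ‖x - y‖ ^ 2 +
        2 * G1 * nsq (estError x ξ) := by
  have h1 : ∀ i, 1 / (n i : ℝ) * nsq (lap G i *ᵥ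
      ((block (pseudoGradient f x) i - block (pseudoGradient f y) i) +
        (gradSum f ξ i - block (pseudoGradient f x) i))) ≤
      2 * (coalitionLip l i ^ 2 * specNorm (lap G i) ^ 2 / (n i : ℝ)) * ‖x - y‖ ^ 2 +
        2 * G1 * estEnergy x ξ i := by
    intro i
    have e1 := nsq_lap_mulVec_add_le (G := G)
      (block (pseudoGradient f x) i - block (pseudoGradient f y) i)
      (gradSum f ξ i - block (pseudoGradient f x) i)
    have e2 := nsq_block_pseudoGradient_sub_le hdiff hlip i x y
    have e3 := nsq_gradSum_sub_le hdiff hlip x ξ i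
    have e4 : nsq (lap G i *ᵥ
      ((block (pseudoGradient f x) i - block (pseudoGradient f y) i) +
        (gradSum f ξ i - block (pseudoGradient f x) i))) ≤ specNorm (lap G i) ^ 2 *
        (2 * (coalitionLip l i ^ 2 * ‖x - y‖ ^ 2) + 2 * (coalitionLipSq l i * estEnergy x ξ i)) :=
      e1.trans (mul_le_mul_of_nonneg_left (by linarith) (sq_nonneg _))
    have e5 := mul_le_mul_of_nonneg_left e4 (show (0 : ℝ) ≤ 1 / n i by positivity)
    have e6 := mul_le_mul_of_nonneg_right (hG1 i) (estEnergy_nonneg x ξ i)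
    have e7 : 1 / (n i : ℝ) * (specNorm (lap G i) ^ 2 *
        (2 * (coalitionLip l i ^ 2 * ‖x - y‖ ^ 2) + 2 * (coalitionLipSq l i * estEnergy x ξ i))) =
        2 * (coalitionLip l i ^ 2 * specNorm (lap G i) ^ 2 / (n i : ℝ)) * ‖x - y‖ ^ 2 +
        2 * (1 / (n i : ℝ) * coalitionLipSq l i * specNorm (lap G i) ^ 2 * estEnergy x ξ i) := by
      ring
    linarith
  refine (Finset.sum_le_sum fun i _ => h1 i).trans_eq ?_
  rw [Finset.sum_add_distrib, ← Finset.mul_sum, ← Finset.sum_mul, ← Finset.mul_sum,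
    sum_estEnergy]

lemma IsTrajectory.norm_x_succ_sub_sq_le (h : IsTrajectory f R G W C β x η ψ ξ)
    (hdiff : ∀ a, ContDiff ℝ 1 (f a))
    (hlip : ∀ a, LipschitzWith (l a) (gradient (f a)))
    (hC : ∀ i, C i ∈ doublyStochastic ℝ (Fin (n i))) {G2 G3 : ℝ}
    (hG2 : ∀ i, specNorm (lap G i * lapRows G i) ^ 2 ≤ G2)
    (hG3 : ∀ i, specNorm (lap G i) ^ 4 * coalitionLipSq l i / (n i : ℝ) ^ 2 ≤ G3)
    {y : State n} (hy : IsStationary f y) (k : ℕ) :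
    ‖x k - x (k + 1)‖ ^ 2 ≤ β ^ 2 *
      (2 * (∑ i, specNorm (lap G i) ^ 4 * coalitionLip l i ^ 2 / (n i : ℝ) ^ 2) * ‖x k - y‖ ^ 2 +
        4 * G3 * nsq (estError (x k) (ξ k)) + 4 * G2 * psiEnergy (ψ k)) := by
  rw [norm_sub_rev, norm_sq_eq_sum_block]
  have h1 : ∀ i, nsq (block (x (k + 1) - x k) i) ≤ β ^ 2 *
      (2 * (specNorm (lap G i) ^ 4 * coalitionLip l i ^ 2 / (n i : ℝ) ^ 2) * ‖x k - y‖ ^ 2 +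
        4 * G3 * estEnergy (x k) (ξ k) i + 4 * G2 * ∑ c, nsq (psiDev (ψ k) i c)) := by
    intro i
    set F := block (pseudoGradient f (x k)) i - block (pseudoGradient f y) i with hF
    set D := gradSum f (ξ k) i - block (pseudoGradient f (x k)) i with hD
    have hL : lap G i *ᵥ gradSum f (ξ k) i = lap G i *ᵥ F + lap G i *ᵥ D := by
      -- The pseudo-gradient at the stationary point may be subtracted freely, as the Laplacian
      -- annihilates constants.
      have : gradSum f (ξ k) i = F + D + block (pseudoGradient f y) i := by
        rw [hF, hD]; abel
      rw [this, mulVec_add, mulVec_add, lap_mulVec_of_const (v := block _ _) (hy i), add_zero]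
    rw [block_sub, h.block_x_succ_sub hC, nsq_neg, nsq_smul]
    refine mul_le_mul_of_nonneg_left ?_ (sq_nonneg β)
    set Ψ := (lap G i * lapRows G i) *ᵥ pairUp (psiDev (ψ k) i) with hΨ
    have e1 : (1 / (n i : ℝ)) • (lap G i *ᵥ (lap G i *ᵥ gradSum f (ξ k) i)) + Ψ =
        (1 / (n i : ℝ)) • (lap G i *ᵥ (lap G i *ᵥ F)) +
          ((1 / (n i : ℝ)) • (lap G i *ᵥ (lap G i *ᵥ D)) + Ψ) := by
      rw [hL, mulVec_add, smul_add, add_assoc]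
    rw [e1]
    have e2 := nsq_add_le ((1 / (n i : ℝ)) • (lap G i *ᵥ (lap G i *ᵥ F)))
      ((1 / (n i : ℝ)) • (lap G i *ᵥ (lap G i *ᵥ D)) + Ψ)
    have e3 := nsq_add_le ((1 / (n i : ℝ)) • (lap G i *ᵥ (lap G i *ᵥ D))) Ψ
    have e4 := nsq_inv_smul_lap_lap_le (G := G) F
    have e5 := nsq_inv_smul_lap_lap_le (G := G) D
    have e6 := nsq_mulVec_le (lap G i * lapRows G i) (pairUp (psiDev (ψ k) i))
    rw [nsq_pairUp] at e6
    have e7 := mul_le_mul_of_nonneg_right (hG2 i)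
      (Finset.sum_nonneg fun c (_ : c ∈ Finset.univ) => nsq_nonneg (psiDev (ψ k) i c))
    have e8 := mul_le_mul_of_nonneg_left (nsq_block_pseudoGradient_sub_le hdiff hlip i (x k) y)
      (show 0 ≤ specNorm (lap G i) ^ 4 / (n i : ℝ) ^ 2 by positivity)
    have e9 := mul_le_mul_of_nonneg_left (nsq_gradSum_sub_le hdiff hlip (x k) (ξ k) i)
      (show 0 ≤ specNorm (lap G i) ^ 4 / (n i : ℝ) ^ 2 by positivity)
    have e10 := mul_le_mul_of_nonneg_right (hG3 i) (estEnergy_nonneg (x k) (ξ k) i)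
    have e11 : specNorm (lap G i) ^ 4 / (n i : ℝ) ^ 2 * (coalitionLip l i ^ 2 * ‖x k - y‖ ^ 2) =
        specNorm (lap G i) ^ 4 * coalitionLip l i ^ 2 / (n i : ℝ) ^ 2 * ‖x k - y‖ ^ 2 := by ring
    have e12 : specNorm (lap G i) ^ 4 / (n i : ℝ) ^ 2 *
        (coalitionLipSq l i * estEnergy (x k) (ξ k) i) =
        specNorm (lap G i) ^ 4 * coalitionLipSq l i / (n i : ℝ) ^ 2 *
          estEnergy (x k) (ξ k) i := by ring
    rw [e11, ← hF] at e8
    rw [e12, ← hD] at e9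
    linarith
  refine (Finset.sum_le_sum fun i _ => h1 i).trans_eq ?_
  rw [← Finset.mul_sum, Finset.sum_add_distrib, Finset.sum_add_distrib, ← Finset.sum_mul,
    ← Finset.mul_sum, ← Finset.mul_sum, ← Finset.mul_sum, sum_estEnergy]
  rfl

lemma coalitionLipSq_le {K : ℝ} (hWc : ∀ i, IsLyapunovSolution (C i - averaging (n i)) (Wc i))
    (hK : ∀ a : Agent n, mixingConst (C a.1) (Wc a.1) * (l a : ℝ) ^ 2 ≤ K) {i : Fin N}
    (hi : 2 ≤ n i) : coalitionLipSq l i ≤ n i * K := by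
  calc coalitionLipSq l i ≤ ∑ _j : Fin (n i), K := by
        refine Finset.sum_le_sum fun j _ => ?_
        have h1 := one_le_mixingConst (hWc i) hi
        have h2 := hK ⟨i, j⟩
        have h3 := mul_le_mul_of_nonneg_right h1 (sq_nonneg (l ⟨i, j⟩ : ℝ))
        linarith
    _ = _ := by simp

/-- Young's inequality with weight `μ / 4` charges a small part of the monotonicity gain. In a
singleton coalition `K` need not control the Lipschitz constant, but there the constraint forces the
two states to coincide. -/
lemma le_cross_term (hdiff : ∀ a, ContDiff ℝ 1 (f a))
    (hlip : ∀ a, LipschitzWith (l a) (gradient (f a)))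
    (hWc : ∀ i, IsLyapunovSolution (C i - averaging (n i)) (Wc i)) {K μ : ℝ} (hμ : 0 < μ)
    (hK0 : 0 ≤ K)
    (hK : ∀ a : Agent n, mixingConst (C a.1) (Wc a.1) * (l a : ℝ) ^ 2 ≤ K) {x y : State n}
    (hx : ∀ i, MeetsResource R i x) (hy : ∀ i, MeetsResource R i y) (ξ : Agent n → State n) :
    -(2 * ∑ i, (block x i - block y i) ⬝ᵥ (gradSum f ξ i - block (pseudoGradient f x) i)) ≤
      μ / 4 * ‖x - y‖ ^ 2 + 4 * (((∑ i, n i : ℕ) : ℝ) * K) / μ * nsq (estError x ξ) := by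
  set S : ℝ := ((∑ i, n i : ℕ) : ℝ) with hS
  have h1 : ∀ i, -(2 * (block x i - block y i) ⬝ᵥ
      (gradSum f ξ i - block (pseudoGradient f x) i)) ≤
      μ / 4 * nsq (block x i - block y i) + 4 * (S * K) / μ * estEnergy x ξ i := by
    intro i
    have hE := estEnergy_nonneg x ξ i
    have hS0 : 0 ≤ S := Nat.cast_nonneg _
    rcases le_or_gt 2 (n i) with hi | hi
    · have e1 := two_mul_dotProduct_le (-(block x i - block y i))
        (gradSum f ξ i - block (pseudoGradient f x) i) (t := μ / 4) (by positivity)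
      rw [nsq_neg, neg_dotProduct] at e1
      have e2 := nsq_gradSum_sub_le hdiff hlip x ξ i
      have e3 : (n i : ℝ) ≤ S := by
        rw [hS]
        exact_mod_cast Finset.single_le_sum (f := n) (fun _ _ => Nat.zero_le _)
          (Finset.mem_univ i)
      have e4 : coalitionLipSq l i ≤ S * K :=
        (coalitionLipSq_le hWc hK hi).trans (mul_le_mul_of_nonneg_right e3 hK0)
      have e5 : nsq (gradSum f ξ i - block (pseudoGradient f x) i) / (μ / 4) ≤
          S * K * estEnergy x ξ i / (μ / 4) := by
        gcongr
        exact e2.trans (mul_le_mul_of_nonneg_right e4 hE)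
      have e6 : S * K * estEnergy x ξ i / (μ / 4) = 4 * (S * K) / μ * estEnergy x ξ i := by
        field_simp
      linarith
    · have hz : block x i - block y i = 0 := by
        have : Subsingleton (Fin (n i)) := by rw [Fin.subsingleton_iff_le_one]; omega
        refine eq_zero_of_const_of_sum (fun j k => by rw [Subsingleton.elim j k]) ?_
        have e1 : ∑ j, x ⟨i, j⟩ = coalitionResource R i := hx i
        have e2 : ∑ j, y ⟨i, j⟩ = coalitionResource R i := hy i
        simp [block, e1, e2]
      rw [hz, zero_dotProduct, nsq_eq_zero.2 rfl]
      have : 0 ≤ 4 * (S * K) / μ * estEnergy x ξ i := by positivity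
      linarith
  rw [Finset.mul_sum, ← Finset.sum_neg_distrib]
  refine (Finset.sum_le_sum fun i _ => h1 i).trans_eq ?_
  rw [Finset.sum_add_distrib, ← Finset.mul_sum, ← Finset.mul_sum, sum_estEnergy,
    norm_sq_eq_sum_block]
  rfl

/-- The Lyapunov function of the gradient estimates. -/
def psiLyap (Wc : (i : Fin N) → Matrix (Fin (n i)) (Fin (n i)) ℝ)
    (ψ : (i : Fin N) → Fin (n i) → Fin (n i) → ℝ) : ℝ :=
  ∑ i, ∑ c, psiDev ψ i c ⬝ᵥ Wc i *ᵥ psiDev ψ i c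

/-- The disagreement is perturbed by gradient increments, hence by increments of the estimates,
which are `1 - M` applied to the estimation error. -/
lemma IsTrajectory.psiLyap_succ_le (h : IsTrajectory f R G W C β x η ψ ξ)
    (hW : IsWeightMatrix G W) (hlip : ∀ a, LipschitzWith (l a) (gradient (f a)))
    (hC : ∀ i, C i ∈ doublyStochastic ℝ (Fin (n i)))
    (hWc : ∀ i, IsLyapunovSolution (C i - averaging (n i)) (Wc i)) {K : ℝ} (hK0 : 0 ≤ K)
    (hK : ∀ a : Agent n, mixingConst (C a.1) (Wc a.1) * (l a : ℝ) ^ 2 ≤ K) (k : ℕ) :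
    psiLyap Wc (ψ (k + 1)) ≤ psiLyap Wc (ψ k) - 1 / 2 * psiEnergy (ψ k) +
      K * specNorm (1 - estimationMatrix W) ^ 2 * nsq (estError (x k) (ξ k)) := by
  have h1 : ∀ i, ∑ c, psiDev (ψ (k + 1)) i c ⬝ᵥ Wc i *ᵥ psiDev (ψ (k + 1)) i c ≤
      ∑ c, psiDev (ψ k) i c ⬝ᵥ Wc i *ᵥ psiDev (ψ k) i c -
        1 / 2 * ∑ c, nsq (psiDev (ψ k) i c) +
        K * ∑ j, ‖ξ (k + 1) ⟨i, j⟩ - ξ k ⟨i, j⟩‖ ^ 2 := by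
    intro i
    have e1 : ∀ c, psiDev (ψ (k + 1)) i c ⬝ᵥ Wc i *ᵥ psiDev (ψ (k + 1)) i c ≤
        psiDev (ψ k) i c ⬝ᵥ Wc i *ᵥ psiDev (ψ k) i c - 1 / 2 * nsq (psiDev (ψ k) i c) +
        mixingConst (C i) (Wc i) * nsq (gradCol f (ξ (k + 1)) i c - gradCol f (ξ k) i c) := by
      intro c
      rw [h.psiDev_succ hC]
      exact (hWc i).step (1 - averaging (n i)) _ _
    refine (Finset.sum_le_sum fun c _ => e1 c).trans ?_
    rw [Finset.sum_add_distrib, Finset.sum_sub_distrib, ← Finset.mul_sum, ← Finset.mul_sum]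
    have e2 := mul_le_mul_of_nonneg_left (sum_nsq_gradCol_sub_le hlip (ξ (k + 1)) (ξ k) i)
      (mixingConst_nonneg (C i) (Wc i))
    have e3 : mixingConst (C i) (Wc i) *
        ∑ j, (l ⟨i, j⟩ : ℝ) ^ 2 * ‖ξ (k + 1) ⟨i, j⟩ - ξ k ⟨i, j⟩‖ ^ 2 ≤
        K * ∑ j, ‖ξ (k + 1) ⟨i, j⟩ - ξ k ⟨i, j⟩‖ ^ 2 := by
      rw [Finset.mul_sum, Finset.mul_sum]
      refine Finset.sum_le_sum fun j _ => ?_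
      rw [← mul_assoc]
      exact mul_le_mul_of_nonneg_right (hK ⟨i, j⟩) (sq_nonneg _)
    linarith
  refine (Finset.sum_le_sum fun i _ => h1 i).trans ?_
  rw [Finset.sum_add_distrib, Finset.sum_sub_distrib, ← Finset.mul_sum, ← Finset.mul_sum]
  have h2 := h.sum_norm_estimate_succ_sub_le hW k
  rw [Fintype.sum_sigma] at h2
  have h3 := mul_le_mul_of_nonneg_left h2 hK0
  rw [mul_assoc]
  unfold psiLyap psiEnergy
  linarith

/-- The Lyapunov function of the estimates of the collective state. -/
def estLyap (WM : Matrix (Agent n × Agent n) (Agent n × Agent n) ℝ) (x : State n)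
    (ξ : Agent n → State n) : ℝ :=
  estError x ξ ⬝ᵥ WM *ᵥ estError x ξ

lemma IsTrajectory.estLyap_succ_le (h : IsTrajectory f R G W C β x η ψ ξ)
    (hW : IsWeightMatrix G W) {WM : Matrix (Agent n × Agent n) (Agent n × Agent n) ℝ}
    (hWM : IsLyapunovSolution (estimationMatrix W) WM) (k : ℕ) :
    estLyap WM (x (k + 1)) (ξ (k + 1)) ≤ estLyap WM (x k) (ξ k) -
      1 / 2 * nsq (estError (x k) (ξ k)) + bConst W WM * ‖x k - x (k + 1)‖ ^ 2 := by
  unfold estLyap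
  rw [h.estError_succ hW]
  refine (hWM.step _ _ _).trans_eq ?_
  have h1 : nsq (fun p : Agent n × Agent n => x k p.2 - x (k + 1) p.2) =
      ((∑ i, n i : ℕ) : ℝ) * ‖x k - x (k + 1)‖ ^ 2 := by
    rw [nsq_eq_sum, Fintype.sum_prod_type, EuclideanSpace.norm_sq_eq, ← card_agent]
    simp
  rw [h1, transpose_one, mul_one, mul_one, one_mul, bConst]
  ring

/-- The Lyapunov function of the states of the coalitions. -/
def stateLyap (G : SimpleGraph (Agent n)) (f : Agent n → State n → ℝ) (y : State n)
    (C : (i : Fin N) → Matrix (Fin (n i)) (Fin (n i)) ℝ) (β : ℝ)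
    (η₀ : (i : Fin N) → Fin (n i) → ℝ) (η : Agent n → ℝ)
    (ψ : (i : Fin N) → Fin (n i) → Fin (n i) → ℝ) (ξ : Agent n → State n) : ℝ :=
  ∑ i, n i * nsq (drivenState G f y C β i (η₀ i) η ψ ξ)

lemma IsTrajectory.stateLyap_succ_le (h : IsTrajectory f R G W C β x η ψ ξ) (hβ : 0 ≤ β)
    {μ : ℝ} (hμ : 0 < μ) (hn : ∀ i, 1 ≤ n i) (hdiff : ∀ a, ContDiff ℝ 1 (f a))
    (hlip : ∀ a, LipschitzWith (l a) (gradient (f a)))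
    (hmono : ∀ y z : State n,
      μ * ‖y - z‖ ^ 2 ≤ inner ℝ (y - z) (pseudoGradient f y - pseudoGradient f z))
    (hC : ∀ i, C i ∈ doublyStochastic ℝ (Fin (n i)))
    (hWc : ∀ i, IsLyapunovSolution (C i - averaging (n i)) (Wc i)) {g κ K G1 : ℝ} (hg0 : 0 ≤ g)
    (hK0 : 0 ≤ K)
    (hg : ∀ i, 4 * (n i * specNorm (lapRows G i) ^ 2) ≤ g)
    (hκ : ∀ i, mixingConst (C i) (Wc i) ≤ κ)
    (hK : ∀ a : Agent n, mixingConst (C a.1) (Wc a.1) * (l a : ℝ) ^ 2 ≤ K)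
    (hG1 : ∀ i, 1 / (n i : ℝ) * coalitionLipSq l i * specNorm (lap G i) ^ 2 ≤ G1)
    {y : State n} (hy : IsStationary f y) (hyR : ∀ i, MeetsResource R i y)
    {η₀ : (i : Fin N) → Fin (n i) → ℝ}
    (hη₀ : ∀ i, block y i = (fun j => R ⟨i, j⟩) - lap G i *ᵥ η₀ i) (k : ℕ) :
    stateLyap G f y C β η₀ (η (k + 1)) (ψ (k + 1)) (ξ (k + 1)) ≤
      stateLyap G f y C β η₀ (η k) (ψ k) (ξ k) +
      (-(2 * β * μ) + β * μ / 4 + β ^ 2 * (5 / 2 *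
        (∑ i, coalitionLip l i ^ 2 * specNorm (lap G i) ^ 2 / (n i : ℝ)) +
        8 * g * K * ((∑ i, n i : ℕ) : ℝ))) * ‖x k - y‖ ^ 2 +
      (5 / 2 * β ^ 2 * G1 + 8 * β ^ 2 * g * K + 4 * β * (((∑ i, n i : ℕ) : ℝ) * K) / μ) *
        nsq (estError (x k) (ξ k)) + 4 * β ^ 2 * g * κ * psiEnergy (ψ k) := by
  have h1 : ∀ i, n i * nsq (drivenState G f y C β i (η₀ i) (η (k + 1)) (ψ (k + 1)) (ξ (k + 1))) ≤
      n i * nsq (drivenState G f y C β i (η₀ i) (η k) (ψ k) (ξ k)) -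
      2 * β * ((block (x k) i - block y i) ⬝ᵥ
        (block (pseudoGradient f (x k)) i - block (pseudoGradient f y) i)) -
      2 * β * ((block (x k) i - block y i) ⬝ᵥ
        (gradSum f (ξ k) i - block (pseudoGradient f (x k)) i)) +
      β ^ 2 * (4 * (n i * nsq (lapRows G i *ᵥ pairUp (trackSol f y C (ψ k) (ξ k) i))) +
        5 / 4 * (1 / n i * nsq (lap G i *ᵥ
          ((block (pseudoGradient f (x k)) i - block (pseudoGradient f y) i) +
          (gradSum f (ξ k) i - block (pseudoGradient f (x k)) i))))) := by
    intro i
    refine nsq_drift_le (hn i) ?_ (h.lap_mulVec_drivenState y k i (hη₀ i))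
    rw [h.drivenState_succ y hC hWc k i]
    congr 2
    -- The forcing splits into the monotone part, the error caused by inexact estimates, and a block
    -- constant on the coalition that the Laplacian kills.
    have : gradSum f (ξ k) i = (block (pseudoGradient f (x k)) i - block (pseudoGradient f y) i) +
        (gradSum f (ξ k) i - block (pseudoGradient f (x k)) i) +
        block (pseudoGradient f y) i := by abel
    conv_lhs => rw [this]
    rw [mulVec_add, lap_mulVec_of_const (v := block _ _) (hy i), add_zero]
  have h2 := Finset.sum_le_sum fun i (_ : i ∈ Finset.univ) => h1 i
  rw [Finset.sum_add_distrib, Finset.sum_sub_distrib, Finset.sum_sub_distrib, ← Finset.mul_sum,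
    ← Finset.mul_sum, ← Finset.mul_sum, Finset.sum_add_distrib, ← Finset.mul_sum,
    ← Finset.mul_sum] at h2
  have h3 := hmono (x k) y
  rw [inner_eq_sum_block] at h3
  simp only [block_sub] at h3
  have h4 := le_cross_term hdiff hlip hWc hμ hK0 hK (h.meetsResource k) hyR (ξ k)
  have h5 := sum_nsq_lapRows_trackSol_le (G := G) hlip hWc hg0 hg hκ hK (x k) y (ψ k) (ξ k)
  have h6 := sum_nsq_lap_forcing_le (G := G) hdiff hlip hG1 (x k) y (ξ k)
  have h7 := mul_le_mul_of_nonneg_left h3 hβ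
  have h8 := mul_le_mul_of_nonneg_left h4 hβ
  have h9 := mul_le_mul_of_nonneg_left h5 (sq_nonneg β)
  have h10 := mul_le_mul_of_nonneg_left h6 (sq_nonneg β)
  unfold stateLyap
  refine h2.trans ?_
  have h11 : 4 * β * (((∑ i, n i : ℕ) : ℝ) * K) / μ =
    β * (4 * (((∑ i, n i : ℕ) : ℝ) * K) / μ) := by ring
  rw [h11]
  linarith

end bounds

/-! ### Linear convergence -/

section convergence

variable {N : ℕ} {n : Fin N → ℕ} {f : Agent n → State n → ℝ} {R : Agent n → ℝ}
  {l : Agent n → ℝ≥0} {G : SimpleGraph (Agent n)}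
  {W : Matrix (Agent n) (Agent n) ℝ} {C Wc : (i : Fin N) → Matrix (Fin (n i)) (Fin (n i)) ℝ}
  {β : ℝ} {x : ℕ → State n} {η : ℕ → Agent n → ℝ}
  {ψ : ℕ → (i : Fin N) → Fin (n i) → Fin (n i) → ℝ} {ξ : ℕ → Agent n → State n}

lemma stateLyap_nonneg (y : State n) (η₀ : (i : Fin N) → Fin (n i) → ℝ) (η : Agent n → ℝ)
    (ψ : (i : Fin N) → Fin (n i) → Fin (n i) → ℝ) (ξ : Agent n → State n) :
    0 ≤ stateLyap G f y C β η₀ η ψ ξ :=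
  Finset.sum_nonneg fun _ _ => mul_nonneg (Nat.cast_nonneg _) (nsq_nonneg _)

lemma psiLyap_nonneg (hWc : ∀ i, IsLyapunovSolution (C i - averaging (n i)) (Wc i))
    (ψ : (i : Fin N) → Fin (n i) → Fin (n i) → ℝ) : 0 ≤ psiLyap Wc ψ :=
  Finset.sum_nonneg fun i _ => Finset.sum_nonneg fun _ _ => (hWc i).quad_nonneg _

lemma psiLyap_le (Wc : (i : Fin N) → Matrix (Fin (n i)) (Fin (n i)) ℝ)
    (ψ : (i : Fin N) → Fin (n i) → Fin (n i) → ℝ) :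
    psiLyap Wc ψ ≤ (∑ i, specNorm (Wc i)) * psiEnergy ψ := by
  unfold psiLyap psiEnergy
  rw [Finset.mul_sum]
  refine Finset.sum_le_sum fun i _ => ?_
  rw [Finset.mul_sum]
  refine Finset.sum_le_sum fun c _ => ?_
  refine (dotProduct_mulVec_self_le _ _).trans (mul_le_mul_of_nonneg_right ?_ (nsq_nonneg _))
  exact Finset.single_le_sum (f := fun i => specNorm (Wc i)) (fun _ _ => specNorm_nonneg _)
    (Finset.mem_univ i)

/-- The driven state is centred, so the spectral gap recovers its norm from its image under the
Laplacian, which is the state error plus a `trackSol` term. The constant is chosen before the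
trajectory, so the rate does not depend on the run. -/
lemma exists_stateLyap_le (hGi : ∀ i, (coalitionGraph G i).Connected)
    (hlip : ∀ a, LipschitzWith (l a) (gradient (f a)))
    (hWc : ∀ i, IsLyapunovSolution (C i - averaging (n i)) (Wc i)) {g κ K : ℝ} (hg0 : 0 ≤ g)
    (hκ0 : 0 ≤ κ) (hK0 : 0 ≤ K)
    (hg : ∀ i, 4 * (n i * specNorm (lapRows G i) ^ 2) ≤ g)
    (hκ : ∀ i, mixingConst (C i) (Wc i) ≤ κ)
    (hK : ∀ a : Agent n, mixingConst (C a.1) (Wc a.1) * (l a : ℝ) ^ 2 ≤ K) (y : State n)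
    (β : ℝ) :
    ∃ c : ℝ, 0 ≤ c ∧ ∀ (x : ℕ → State n) (η : ℕ → Agent n → ℝ)
      (ψ : ℕ → (i : Fin N) → Fin (n i) → Fin (n i) → ℝ) (ξ : ℕ → Agent n → State n)
      (η₀ : (i : Fin N) → Fin (n i) → ℝ), IsTrajectory f R G W C β x η ψ ξ →
      (∀ i, block y i = (fun j => R ⟨i, j⟩) - lap G i *ᵥ η₀ i) → ∀ k,
      stateLyap G f y C β η₀ (η k) (ψ k) (ξ k) ≤
        c * (‖x k - y‖ ^ 2 + nsq (estError (x k) (ξ k)) + psiEnergy (ψ k)) := by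
  choose Λ hΛ0 hΛ using fun i => exists_nsq_le_lap (hGi i)
  set S : ℝ := ((∑ i, n i : ℕ) : ℝ) with hS
  have hS0 : 0 ≤ S := Nat.cast_nonneg _
  set a₁ := ∑ i, 2 * Λ i * n i with ha₁
  set a₂ := ∑ i, 2 * Λ i * β ^ 2 * specNorm (lap G i) ^ 2 with ha₂
  have ha₁0 : 0 ≤ a₁ := Finset.sum_nonneg fun i _ => by have := hΛ0 i; positivity
  have ha₂0 : 0 ≤ a₂ := Finset.sum_nonneg fun i _ => by have := hΛ0 i; positivity
  refine ⟨a₁ + a₂ * (g * (κ + 2 * K + 2 * K * S)), by positivity,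
    fun x η ψ ξ η₀ h hη₀ k => ?_⟩
  set T := g * (κ * psiEnergy (ψ k) + 2 * K * (nsq (estError (x k) (ξ k)) +
    S * ‖x k - y‖ ^ 2)) with hT
  have hsum := sum_nsq_lapRows_trackSol_le (G := G) hlip hWc hg0 hg hκ hK (x k) y (ψ k) (ξ k)
  have h1 : ∀ i, n i * nsq (drivenState G f y C β i (η₀ i) (η k) (ψ k) (ξ k)) ≤
      2 * Λ i * n i * ‖x k - y‖ ^ 2 + 2 * Λ i * β ^ 2 * specNorm (lap G i) ^ 2 * T := by
    intro i
    set τ := lapRows G i *ᵥ pairUp (trackSol f y C (ψ k) (ξ k) i) with hτ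
    have e1 := hΛ i (drivenState G f y C β i (η₀ i) (η k) (ψ k) (ξ k)) (sum_centre_mulVec _)
    rw [h.lap_mulVec_drivenState y k i (hη₀ i)] at e1
    have e2 := nsq_add_le (-(block (x k) i - block y i)) (β • (lap G i *ᵥ τ))
    rw [nsq_neg, nsq_smul, ← block_sub] at e2
    have e3 := nsq_block_le (x k - y) i
    have e4 := nsq_mulVec_le (lap G i) τ
    have e5 : n i * nsq τ ≤ T := (Finset.single_le_sum
      (f := fun i => n i * nsq (lapRows G i *ᵥ pairUp (trackSol f y C (ψ k) (ξ k) i)))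
      (fun i _ => mul_nonneg (Nat.cast_nonneg _) (nsq_nonneg _)) (Finset.mem_univ i)).trans hsum
    have hn0 : (0 : ℝ) ≤ n i := Nat.cast_nonneg _
    have e6 : nsq (drivenState G f y C β i (η₀ i) (η k) (ψ k) (ξ k)) ≤
        Λ i * (2 * ‖x k - y‖ ^ 2 + 2 * (β ^ 2 * (specNorm (lap G i) ^ 2 * nsq τ))) := by
      refine e1.trans (mul_le_mul_of_nonneg_left (e2.trans ?_) (hΛ0 i))
      have := mul_le_mul_of_nonneg_left e4 (sq_nonneg β)
      linarith
    have e7 := mul_le_mul_of_nonneg_left e6 hn0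
    have e8 := mul_le_mul_of_nonneg_left e5
      (show 0 ≤ 2 * Λ i * β ^ 2 * specNorm (lap G i) ^ 2 by have := hΛ0 i; positivity)
    linarith
  have h2 : stateLyap G f y C β η₀ (η k) (ψ k) (ξ k) ≤ a₁ * ‖x k - y‖ ^ 2 + a₂ * T := by
    refine (Finset.sum_le_sum fun i _ => h1 i).trans_eq ?_
    rw [Finset.sum_add_distrib, ← Finset.sum_mul, ← Finset.sum_mul]
  have hU : 0 ≤ ‖x k - y‖ ^ 2 := sq_nonneg _
  have hE := nsq_nonneg (estError (x k) (ξ k))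
  have hP := psiEnergy_nonneg (ψ k)
  set U := ‖x k - y‖ ^ 2
  set E := nsq (estError (x k) (ξ k))
  set P := psiEnergy (ψ k)
  have h3 : T ≤ g * (κ + 2 * K + 2 * K * S) * (U + E + P) := by
    rw [hT, mul_assoc g (κ + 2 * K + 2 * K * S)]
    refine mul_le_mul_of_nonneg_left ?_ hg0
    have f1 : 0 ≤ κ * (U + E) := by positivity
    have f2 : 0 ≤ 2 * K * (U + P) := by positivity
    have f3 : 0 ≤ 2 * K * S * (E + P) := by positivity
    linarith
  have h4 := mul_le_mul_of_nonneg_left h3 ha₂0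
  have h5 : a₁ * U ≤ a₁ * (U + E + P) := mul_le_mul_of_nonneg_left (by linarith) ha₁0
  linarith

set_option maxHeartbeats 2000000 in
/-- Linear convergence when some coalition has at least two members. -/
lemma exists_rate {μ : ℝ} (hμ : 0 < μ) (hn : ∀ i, 1 ≤ n i) (hn2 : ∃ i, 2 ≤ n i)
    (hdiff : ∀ a, ContDiff ℝ 1 (f a)) (hlip : ∀ a, LipschitzWith (l a) (gradient (f a)))
    (hmono : ∀ y z : State n,
      μ * ‖y - z‖ ^ 2 ≤ inner ℝ (y - z) (pseudoGradient f y - pseudoGradient f z))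
    (hGi : ∀ i, (coalitionGraph G i).Connected) (hW : IsWeightMatrix G W)
    (hC : ∀ i, C i ∈ doublyStochastic ℝ (Fin (n i)))
    {WM : Matrix (Agent n × Agent n) (Agent n × Agent n) ℝ}
    (hWM : IsLyapunovSolution (estimationMatrix W) WM)
    (hWc : ∀ i, IsLyapunovSolution (C i - averaging (n i)) (Wc i)) (hβ : 0 < β)
    (hstep : StepSizeBound G W C WM Wc l μ β) {y : State n} (hy : IsStationary f y)
    (hyR : ∀ i, MeetsResource R i y) :
    ∃ ρ : ℝ, 0 < ρ ∧ ρ < 1 ∧ ∀ (x : ℕ → State n) (η : ℕ → Agent n → ℝ)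
      (ψ : ℕ → (i : Fin N) → Fin (n i) → Fin (n i) → ℝ) (ξ : ℕ → Agent n → State n),
      IsTrajectory f R G W C β x η ψ ξ → ∃ c : ℝ, ∀ k, ‖x k - y‖ ≤ c * ρ ^ k := by
  obtain ⟨i₂, hi₂⟩ := hn2
  have hne : Nonempty (Fin N) := ⟨i₂⟩
  -- the constants
  set g := gammaPsi G with hgdef
  set K := ⨆ a : Agent n, mixingConst (C a.1) (Wc a.1) * (l a : ℝ) ^ 2 with hKdef
  set m := specNorm (1 - estimationMatrix W) ^ 2 with hmdef
  set b := bConst W WM with hbdef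
  set S : ℝ := ((∑ i, n i : ℕ) : ℝ) with hSdef
  set G1 := ⨆ i, 1 / (n i : ℝ) * coalitionLipSq l i * specNorm (lap G i) ^ 2 with hG1def
  set G2 := ⨆ i, specNorm (lap G i * lapRows G i) ^ 2 with hG2def
  set G3 := ⨆ i, specNorm (lap G i) ^ 4 * coalitionLipSq l i / (n i : ℝ) ^ 2 with hG3def
  set S0 := ∑ i, coalitionLip l i ^ 2 * specNorm (lap G i) ^ 2 / (n i : ℝ) with hS0def
  set Q := ∑ i, specNorm (lap G i) ^ 4 * coalitionLip l i ^ 2 / (n i : ℝ) ^ 2 with hQdef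
  -- An actual maximiser is kept because `hκμ` needs `κ` and Lipschitz constants from the same
  -- coalition.
  obtain ⟨i₀, -, hi₀⟩ := Finset.exists_max_image Finset.univ
    (fun i => mixingConst (C i) (Wc i)) Finset.univ_nonempty
  set κ := mixingConst (C i₀) (Wc i₀) with hκdef
  have hκ : ∀ i, mixingConst (C i) (Wc i) ≤ κ := fun i => hi₀ i (Finset.mem_univ i)
  have hg : ∀ i, 4 * (n i * specNorm (lapRows G i) ^ 2) ≤ g := fun i =>
    mul_le_mul_of_nonneg_left (le_ciSup (f := fun i => (n i : ℝ) * specNorm (lapRows G i) ^ 2)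
      (Set.finite_range _).bddAbove i) (by norm_num)
  have hK : ∀ a : Agent n, mixingConst (C a.1) (Wc a.1) * (l a : ℝ) ^ 2 ≤ K := fun a =>
    le_ciSup (f := fun a : Agent n => mixingConst (C a.1) (Wc a.1) * (l a : ℝ) ^ 2)
      (Set.finite_range _).bddAbove a
  have hG1 : ∀ i, 1 / (n i : ℝ) * coalitionLipSq l i * specNorm (lap G i) ^ 2 ≤ G1 := fun i =>
    le_ciSup (f := fun i => 1 / (n i : ℝ) * coalitionLipSq l i * specNorm (lap G i) ^ 2)
      (Set.finite_range _).bddAbove i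
  have hG2 : ∀ i, specNorm (lap G i * lapRows G i) ^ 2 ≤ G2 := fun i =>
    le_ciSup (f := fun i => specNorm (lap G i * lapRows G i) ^ 2)
      (Set.finite_range _).bddAbove i
  have hG3 : ∀ i, specNorm (lap G i) ^ 4 * coalitionLipSq l i / (n i : ℝ) ^ 2 ≤ G3 := fun i =>
    le_ciSup (f := fun i => specNorm (lap G i) ^ 4 * coalitionLipSq l i / (n i : ℝ) ^ 2)
      (Set.finite_range _).bddAbove i
  -- relations between the constants
  have hn0 : ∀ i, (0 : ℝ) < n i := fun i => by exact_mod_cast hn i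
  have hLg : ∀ i, 4 * specNorm (lap G i) ^ 2 ≤ g := fun i => by
    have := specNorm_lap_sq_le (G := G) (i := i)
    linarith [hg i]
  have hg0 : 0 < g := by
    have := specNorm_lap_pos (hGi i₂) hi₂
    have := hLg i₂
    have : 0 < specNorm (lap G i₂) ^ 2 := by positivity
    linarith
  have hκ1 : 1 ≤ κ := (one_le_mixingConst (hWc i₂) hi₂).trans (hκ i₂)
  have hnS : ∀ i, (n i : ℝ) ≤ S := fun i => by
    rw [hSdef]
    exact_mod_cast Finset.single_le_sum (f := n) (fun _ _ => Nat.zero_le _) (Finset.mem_univ i)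
  have hS2 : 2 ≤ S := by
    have : (2 : ℝ) ≤ n i₂ := by exact_mod_cast hi₂
    exact this.trans (hnS i₂)
  have hNS : (N : ℝ) ≤ S := by
    have : N ≤ ∑ i, n i := by
      calc N = ∑ _i : Fin N, 1 := by simp
        _ ≤ _ := Finset.sum_le_sum fun i _ => hn i
    rw [hSdef]
    exact_mod_cast this
  have hG10 : 0 ≤ G1 := le_trans (mul_nonneg (mul_nonneg (by positivity)
    (coalitionLipSq_nonneg l i₂)) (sq_nonneg _)) (hG1 i₂)
  -- In the maximising coalition, `μ` is at most the sum of the Lipschitz constants, Cauchy–Schwarz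
  -- passes to their squares, and `κ` times each square is at most `K`.
  have hκμ : κ * μ ^ 2 ≤ K * S ^ 2 := by
    have e1 := le_coalitionLip hdiff hlip hmono i₀ (hn i₀)
    have e2 : μ ^ 2 ≤ coalitionLip l i₀ ^ 2 := pow_le_pow_left₀ hμ.le e1 2
    have e3 : coalitionLip l i₀ ^ 2 ≤ n i₀ * coalitionLipSq l i₀ := by
      have := sq_sum_le_card_mul_sum_sq (s := Finset.univ)
        (f := fun j : Fin (n i₀) => (l ⟨i₀, j⟩ : ℝ))
      simpa [coalitionLip, coalitionLipSq] using this
    have e4 : κ * coalitionLipSq l i₀ ≤ n i₀ * K := by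
      calc κ * coalitionLipSq l i₀ = ∑ j, κ * (l ⟨i₀, j⟩ : ℝ) ^ 2 := by
            rw [coalitionLipSq, Finset.mul_sum]
        _ ≤ ∑ _j : Fin (n i₀), K := Finset.sum_le_sum fun j _ => hK ⟨i₀, j⟩
        _ = _ := by simp
    have hκ0 : 0 ≤ κ := zero_le_one.trans hκ1
    have hK0 : 0 ≤ K := le_trans (mul_nonneg (mixingConst_nonneg _ _) (sq_nonneg _))
      (hK ⟨i₂, ⟨0, hn i₂⟩⟩)
    calc κ * μ ^ 2 ≤ κ * (n i₀ * coalitionLipSq l i₀) :=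
          mul_le_mul_of_nonneg_left (e2.trans e3) hκ0
      _ = n i₀ * (κ * coalitionLipSq l i₀) := by ring
      _ ≤ n i₀ * (n i₀ * K) := mul_le_mul_of_nonneg_left e4 (hn0 i₀).le
      _ = K * (n i₀ : ℝ) ^ 2 := by ring
      _ ≤ K * S ^ 2 :=
          mul_le_mul_of_nonneg_left (pow_le_pow_left₀ (hn0 i₀).le (hnS i₀) 2) hK0
  have hK0 : 0 < K := by
    by_contra! h
    have : 0 < κ * μ ^ 2 := by positivity
    nlinarith [sq_nonneg S]
  have hb0 : 0 ≤ b := by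
    have := specNorm_nonneg WM
    rw [hbdef, bConst]; positivity
  have hS00 : 0 ≤ S0 := Finset.sum_nonneg fun i _ => by positivity
  have hQ0 : 0 ≤ Q := Finset.sum_nonneg fun i _ => by positivity
  -- For `n i ≥ 2` the quotient `8 / n i` is at most 4 and `hLg` applies; a singleton has zero
  -- Laplacian.
  have hQS : 8 * Q ≤ S0 * g := by
    rw [hQdef, hS0def, Finset.mul_sum, Finset.sum_mul]
    refine Finset.sum_le_sum fun i _ => ?_
    rcases le_or_gt 2 (n i) with hi | hi
    · have e1 : 8 * specNorm (lap G i) ^ 2 / n i ≤ g := by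
        have : (2 : ℝ) ≤ n i := by exact_mod_cast hi
        rw [div_le_iff₀ (hn0 i)]
        nlinarith [hLg i]
      have e2 := mul_le_mul_of_nonneg_left e1
        (show 0 ≤ coalitionLip l i ^ 2 * specNorm (lap G i) ^ 2 / (n i : ℝ) by positivity)
      refine le_trans (le_of_eq ?_) e2
      ring
    · rw [specNorm_lap_eq_zero (by omega)]; simp
  have hQG : 4 * Q ≤ G1 * S * g := by
    have e0 : ∀ i, 4 * (specNorm (lap G i) ^ 4 * coalitionLip l i ^ 2 / (n i : ℝ) ^ 2) ≤
        G1 * g := by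
      intro i
      have e3 : coalitionLip l i ^ 2 ≤ n i * coalitionLipSq l i := by
        have := sq_sum_le_card_mul_sum_sq (s := Finset.univ)
          (f := fun j : Fin (n i) => (l ⟨i, j⟩ : ℝ))
        simpa [coalitionLip, coalitionLipSq] using this
      have e4 := mul_le_mul_of_nonneg_left e3
        (show 0 ≤ 4 * (specNorm (lap G i) ^ 4 / (n i : ℝ) ^ 2) by positivity)
      have e5 : 4 * (specNorm (lap G i) ^ 4 / (n i : ℝ) ^ 2) * (n i * coalitionLipSq l i) =
          1 / (n i : ℝ) * coalitionLipSq l i * specNorm (lap G i) ^ 2 *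
            (4 * specNorm (lap G i) ^ 2) := by
        have := (hn0 i).ne'
        field_simp
      have e6 := mul_le_mul (hG1 i) (hLg i) (by positivity) hG10
      calc _ = 4 * (specNorm (lap G i) ^ 4 / (n i : ℝ) ^ 2) * coalitionLip l i ^ 2 := by ring
        _ ≤ _ := e4
        _ = _ := e5
        _ ≤ _ := e6
    calc 4 * Q ≤ ∑ _i : Fin N, G1 * g := by
          rw [hQdef, Finset.mul_sum]
          exact Finset.sum_le_sum fun i _ => e0 i
      _ = N * (G1 * g) := by simp
      _ ≤ S * (G1 * g) := mul_le_mul_of_nonneg_right hNS (by positivity)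
      _ = _ := by ring
  -- Unfolded, `gammaXi` is `4 * (G1 + 2 * g * K * m)`, which gives the three step size bounds the
  -- required form.
  obtain ⟨A, B, ε, hA, hB, hε, hcU, hcE, hcP⟩ := exists_lyapunov_weights (G2 := G2) (G3 := G3)
    hβ hμ hg0 hK0 (sq_nonneg (specNorm (1 - estimationMatrix W))) hb0 hS2 hG10 hS00 hQ0 hκ1
    hstep.fst hstep.snd hstep.trd (hW.sq_card_le hWM) hQS hQG hκμ
  obtain ⟨c₀, hc₀, hstate⟩ := exists_stateLyap_le (R := R) (W := W) hGi hlip hWc hg0.le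
    (zero_le_one.trans hκ1) hK0.le hg hκ hK y β
  set w₁ := ∑ i, specNorm (Wc i) with hw₁
  have hw₁0 : 0 ≤ w₁ := Finset.sum_nonneg fun _ _ => specNorm_nonneg _
  have hw₂0 := specNorm_nonneg WM
  set c := c₀ + A * w₁ + B * specNorm WM with hc
  have hc0 : 0 ≤ c := by positivity
  set r := 1 - ε / (c + 2 * ε) with hr
  have hr01 : 0 < r ∧ r < 1 := by
    have h1 : 0 < ε / (c + 2 * ε) := by positivity
    have h2 : ε / (c + 2 * ε) < 1 := by rw [div_lt_one (by positivity)]; linarith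
    constructor <;> rw [hr] <;> linarith
  refine ⟨√r, Real.sqrt_pos.2 hr01.1, by rw [Real.sqrt_lt' one_pos, one_pow]; exact hr01.2,
    fun x η ψ ξ h => ?_⟩
  -- The resources and the equilibrium have equal sums over each coalition, so their difference lies
  -- in the range of the Laplacian. A preimage is the limit reference for `η`, up to constants.
  have hη₀ : ∀ i, ∃ v, lap G i *ᵥ v = (fun j => R ⟨i, j⟩) - block y i := fun i => by
    refine exists_lap_mulVec_eq (hGi i) ?_
    have h1 : ∑ j, y ⟨i, j⟩ = ∑ j, R ⟨i, j⟩ := hyR i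
    simp [block, h1]
  choose η₀ hη₀ using hη₀
  have hη₀' : ∀ i, block y i = (fun j => R ⟨i, j⟩) - lap G i *ᵥ η₀ i := fun i => by
    rw [hη₀ i, sub_sub_cancel]
  set V : ℕ → ℝ := fun k => stateLyap G f y C β η₀ (η k) (ψ k) (ξ k) + A * psiLyap Wc (ψ k) +
    B * estLyap WM (x k) (ξ k) with hV
  set T : ℕ → ℝ := fun k =>
    ‖x k - y‖ ^ 2 + nsq (estError (x k) (ξ k)) + psiEnergy (ψ k) with hT
  have hU0 : ∀ k, 0 ≤ ‖x k - y‖ ^ 2 := fun k => sq_nonneg _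
  have hE0 : ∀ k, 0 ≤ nsq (estError (x k) (ξ k)) := fun k => nsq_nonneg _
  have hP0 : ∀ k, 0 ≤ psiEnergy (ψ k) := fun k => psiEnergy_nonneg _
  have hV0 : ∀ k, 0 ≤ V k := fun k => by
    have h1 := stateLyap_nonneg (G := G) (f := f) (C := C) (β := β) y η₀ (η k) (ψ k) (ξ k)
    have h2 := psiLyap_nonneg hWc (ψ k)
    have h3 : 0 ≤ estLyap WM (x k) (ξ k) := hWM.quad_nonneg _
    simp only [hV]
    positivity
  have hVT : ∀ k, V k ≤ c * T k := fun k => by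
    have h1 := hstate x η ψ ξ η₀ h hη₀' k
    have h2 := mul_le_mul_of_nonneg_left (psiLyap_le Wc (ψ k)) hA.le
    have h3 : B * estLyap WM (x k) (ξ k) ≤ B * (specNorm WM * nsq (estError (x k) (ξ k))) :=
      mul_le_mul_of_nonneg_left (dotProduct_mulVec_self_le _ _) hB.le
    have h4 : A * (w₁ * psiEnergy (ψ k)) ≤ A * (w₁ * T k) :=
      mul_le_mul_of_nonneg_left (mul_le_mul_of_nonneg_left
        (by simp only [hT]; linarith [hU0 k, hE0 k]) hw₁0) hA.le
    have h5 : B * (specNorm WM * nsq (estError (x k) (ξ k))) ≤ B * (specNorm WM * T k) :=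
      mul_le_mul_of_nonneg_left (mul_le_mul_of_nonneg_left
        (by simp only [hT]; linarith [hU0 k, hP0 k]) hw₂0) hB.le
    have h6 : c * T k = c₀ * T k + A * (w₁ * T k) + B * (specNorm WM * T k) := by
      rw [hc]; ring
    rw [h6]
    simp only [hV]
    linarith
  have hdecr : ∀ k, V (k + 1) ≤ V k - ε * T k := fun k => by
    have h1 := h.stateLyap_succ_le hβ.le hμ hn hdiff hlip hmono hC hWc hg0.le hK0.le hg hκ hK hG1
      hy hyR hη₀' k
    have h2 := mul_le_mul_of_nonneg_left (h.psiLyap_succ_le hW hlip hC hWc hK0.le hK k) hA.le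
    have h3 := mul_le_mul_of_nonneg_left (h.estLyap_succ_le hW hWM k) hB.le
    have h4 := mul_le_mul_of_nonneg_left (h.norm_x_succ_sub_sq_le hdiff hlip hC hG2 hG3 hy k)
      (mul_nonneg hB.le hb0)
    have h5 := mul_le_mul_of_nonneg_right hcU (hU0 k)
    have h6 := mul_le_mul_of_nonneg_right hcE (hE0 k)
    have h7 := mul_le_mul_of_nonneg_right hcP (hP0 k)
    simp only [hV, hT]
    linarith
  refine ⟨√(V 0 / ε), fun k => ?_⟩
  have hfin := le_geometric_of_lyapunov (U := fun k => ‖x k - y‖ ^ 2) hε hc0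
    (fun k => add_nonneg (add_nonneg (hU0 k) (hE0 k)) (hP0 k)) hV0
    (fun k => (le_add_of_nonneg_right (hE0 k)).trans (le_add_of_nonneg_right (hP0 k))) hVT hdecr k
  apply le_of_sq_le_sq _ (by positivity)
  rw [mul_pow, Real.sq_sqrt (div_nonneg (hV0 0) hε.le), ← pow_mul, mul_comm k 2, pow_mul,
    Real.sq_sqrt hr01.1.le]
  exact hfin

end convergence

end DRA

end

theorem theorem2 {N : ℕ} (n : Fin N → ℕ) (hn : ∀ i, 1 ≤ n i) (hsum : 2 ≤ ∑ i, n i)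
    (f : Agent n → State n → ℝ) (R : Agent n → ℝ)
    (l : Agent n → ℝ≥0) (μ : ℝ) (hμ : 0 < μ)
    (hconv : ∀ a, ConvexOn ℝ Set.univ (f a))
    (hdiff : ∀ a, ContDiff ℝ 1 (f a))
    (hlip : ∀ a, LipschitzWith (l a) (gradient (f a)))
    (hmono : ∀ y z : State n,
      μ * ‖y - z‖ ^ 2 ≤ inner ℝ (y - z) (pseudoGradient f y - pseudoGradient f z))
    (G : SimpleGraph (Agent n)) (hG : G.Connected)
    (hGi : ∀ i, (coalitionGraph G i).Connected)
    (W : Matrix (Agent n) (Agent n) ℝ) (hW : IsWeightMatrix G W)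
    (C : (i : Fin N) → Matrix (Fin (n i)) (Fin (n i)) ℝ)
    (hC : ∀ i, IsMixingMatrix (coalitionGraph G i) (C i)) :
    (∃ WM, IsLyapunovSolution (estimationMatrix W) WM) ∧
    (∀ i, ∃ Wc, IsLyapunovSolution (C i - averaging (n i)) Wc) ∧
    ∃ xstar : State n, IsNashEquilibrium f R xstar ∧
      (∀ y, IsNashEquilibrium f R y → y = xstar) ∧
      ∀ (WM : Matrix (Agent n × Agent n) (Agent n × Agent n) ℝ)
        (Wc : (i : Fin N) → Matrix (Fin (n i)) (Fin (n i)) ℝ) (β : ℝ),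
        IsLyapunovSolution (estimationMatrix W) WM →
        (∀ i, IsLyapunovSolution (C i - averaging (n i)) (Wc i)) →
        0 < β → StepSizeBound G W C WM Wc l μ β →
        ∃ ρ : ℝ, 0 < ρ ∧ ρ < 1 ∧
          ∀ (x : ℕ → State n) (η : ℕ → Agent n → ℝ)
            (ψ : ℕ → (i : Fin N) → Fin (n i) → Fin (n i) → ℝ) (ξ : ℕ → Agent n → State n),
            IsTrajectory f R G W C β x η ψ ξ →
            (∃ c : ℝ, ∀ k, ‖x k - xstar‖ ≤ c * ρ ^ k) ∧
            ∀ k i, MeetsResource R i (x k) := by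
  have hne : Nontrivial (Agent n) := by
    rw [← Fintype.one_lt_card_iff_nontrivial]
    simpa [Agent, Nat.lt_iff_add_one_le] using hsum
  obtain ⟨y, hyR, hy⟩ := exists_isStationary (R := R) hμ hdiff hlip hmono
  refine ⟨hW.exists_isLyapunovSolution hG, fun i => (hC i).exists_isLyapunovSolution (hGi i),
    y, isNashEquilibrium_of_isStationary hconv hdiff hyR hy,
    fun z hz => eq_of_isStationary hμ hmono hyR hz.1 hy (hz.isStationary hdiff),
    fun WM Wc β hWM hWc hβ hstep => ?_⟩
  -- If all coalitions are singletons, the constraint determines the state and every run stays at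
  -- the equilibrium; any rate will do. The Lyapunov argument needs `gammaPsi` and `κ` positive,
  -- hence a coalition with two members.
  by_cases h2 : ∃ i, 2 ≤ n i
  · obtain ⟨ρ, hρ0, hρ1, hρ⟩ := exists_rate (R := R) hμ hn h2 hdiff hlip hmono hGi hW
      (fun i => (hC i).mem_doublyStochastic) hWM hWc hβ hstep hy hyR
    exact ⟨ρ, hρ0, hρ1, fun x η ψ ξ h => ⟨hρ x η ψ ξ h, h.meetsResource⟩⟩
  · push Not at h2
    refine ⟨1 / 2, by norm_num, by norm_num, fun x η ψ ξ h =>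
      ⟨⟨0, fun k => ?_⟩, h.meetsResource⟩⟩
    have hx : x k = y := by
      ext ⟨i, j⟩
      have hi := h2 i
      have : Subsingleton (Fin (n i)) := Fin.subsingleton_iff_le_one.2 (by omega)
      have e : ∀ z : State n, MeetsResource R i z → z ⟨i, j⟩ = R ⟨i, j⟩ := fun z hz => by
        simpa [MeetsResource, coalitionResource, Fintype.sum_subsingleton _ j] using hz
      rw [e _ (h.meetsResource k i), e _ (hyR i)]
    simp [hx]
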